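/- Let $0<q<1$, and for $x\in\mathbb C$ put $q^x=e^{x\log q}$. Write $(x;q)_\infty=\prod_{k\ge0}(1-xq^k)$, $(x;q)_k=\prod_{j=0}^{k-1}(1-xq^j)$, $(x_1,\dots,x_m;q)_k=(x_1;q)_k\cdots(x_m;q)_k$ for $0\le k\le\infty$, and $${}_3\phi_2\left[\begin{matrix}x_1,x_2,x_3\\ y_1,y_2\end{matrix};q,z\right]=\sum_{k\ge0}\frac{(x_1,x_2,x_3;q)_k}{(q,y_1,y_2;q)_k}\,z^k .$$ **Theorem.** Let $a,b,c,d,e,f\in\mathbb C$ satisfy $\max\{|q^f|,|q^{1+f-d}|,|q^{1+c+f-d}|\}<1$, $d\notin\mathbb Z$, and $q^{e+f},\,q^{1+a+b-d}\notin\{q^{-n}:n\ge0\}$. Let the contour of integration run from $-i\infty$ to $i\infty$ (a piecewise $C^1$ path whose two ends are vertical half-lines) so that the decreasing sequences of poles, i.e. all $s$ with $q^{x+s+n}=1$ for some $x\in\{a,b,c,f\}$ and some integer $n\ge0$, lie to the left of it, and the increasing sequences of poles $s=n$ and $s=1-d+n$ $(n=0,1,2,\dots)$ lie to the right of it. Then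 the following integral converges absolutely, and $$\frac1{2\pi i}\int_{-i\infty}^{i\infty}\frac{(q^{1+s},q^{d+s},q^{1+a+b+c+s-d},q^{e+f+s};q)_\infty}{(q^{a+s},q^{b+s},q^{c+s},q^{f+s};q)_\infty}\,\frac{\pi q^s}{\sin \pi s\,\sin\pi(d+s)}\;{}_3\phi_2\left[\begin{matrix}q^e,\,q^{a+s},\,q^{b+s}\\ q^{e+f+s},\,q^{1+a+b+c+s-d}\end{matrix};q,q^{1+c+f-d}\right]ds$$ $$=-\csc (\pi d)\,\frac{(q,q^d,q^{1-d},q^{1+b+c-d},q^{1+a+c-d},q^{1+a+b-d},q^{e+f};q)_\infty}{(q^a,q^b,q^c,q^f,q^{1+a-d},q^{1+b-d},q^{1+c-d};q)_\infty}\;{}_3\phi_2\left[\begin{matrix}q^a,\,q^b,\,q^e\\ q^{e+f},\,q^{1+a+b-d}\end{matrix};q,q^{1+f-d}\right].$$ -/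

import Mathlib

namespace QBarnes

noncomputable section

/-- The infinite `q`-shifted factorial `(a; q)_∞ = ∏_{k ≥ 0} (1 - a q^k)` (for `|q| < 1`). -/
def qPochInf (a q : ℂ) : ℂ := ∏' k : ℕ, (1 - a * q ^ k)

/-- The finite `q`-shifted factorial `(a; q)_n = ∏_{0 ≤ k < n} (1 - a q^k)`. -/
def qPoch (a q : ℂ) (n : ℕ) : ℂ := ∏ k ∈ Finset.range n, (1 - a * q ^ k)

/-- `(a₁, …, a_m; q)_∞ = (a₁; q)_∞ ⋯ (a_m; q)_∞`. -/
def qPochInfs (as : List ℂ) (q : ℂ) : ℂ := (as.map fun a => qPochInf a q).prod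

/-- `(a₁, …, a_m; q)_n = (a₁; q)_n ⋯ (a_m; q)_n`. -/
def qPochs (as : List ℂ) (q : ℂ) (n : ℕ) : ℂ := (as.map fun a => qPoch a q n).prod

/-- The basic hypergeometric series `_rφ_s [a₁, …, a_r; b₁, …, b_s; q, z]`. -/
def basicHypergeometric (as bs : List ℂ) (q z : ℂ) : ℂ :=
  ∑' k : ℕ, qPochs as q k / qPochs (q :: bs) q k *
    ((-1) ^ k * q ^ k.choose 2) ^ (1 + (bs.length : ℤ) - (as.length : ℤ)) * z ^ k

/-- A contour running from `-i∞` to `i∞`: a continuous path `γ : ℝ → ℂ`, continuously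
differentiable with bounded derivative off a finite set of parameters (in particular any piecewise
`C¹` path), each of whose two ends is an upward vertical half-line (an "indented" vertical line). -/
structure IsVerticalContour (γ : ℝ → ℂ) : Prop where
  continuous : Continuous γ
  contDiffAt : ∃ S : Finset ℝ, ∀ t ∉ S, ContDiffAt ℝ 1 γ t
  bounded_deriv : ∃ C : ℝ, ∀ t, ‖deriv γ t‖ ≤ C
  upper_end : ∃ σ T : ℝ, ∀ t ≥ T, γ t = (σ : ℂ) + (t : ℂ) * Complex.I
  lower_end : ∃ σ T : ℝ, ∀ t ≤ T, γ t = (σ : ℂ) + (t : ℂ) * Complex.I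

/-- The index `1/(2πi) ∫ dz / (z - p)` of a contour from `-i∞` to `i∞` about `p`, cut off at the
parameters `-T` and `T`. For a simple contour its limit as `T → ∞` is `1/2` at the points to the
left of the contour and `-1/2` at the points to the right of it. -/
def truncatedIndex (γ : ℝ → ℂ) (p : ℂ) (T : ℝ) : ℂ :=
  1 / (2 * (Real.pi : ℂ) * Complex.I) * ∫ t in (-T)..T, deriv γ t / (γ t - p)

/-- The point `p` lies to the left of the contour `γ`. -/
def LiesLeftOf (γ : ℝ → ℂ) (p : ℂ) : Prop :=
  p ∉ Set.range γ ∧ Filter.Tendsto (truncatedIndex γ p) Filter.atTop (nhds (1 / 2))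

/-- The point `p` lies to the right of the contour `γ`. -/
def LiesRightOf (γ : ℝ → ℂ) (p : ℂ) : Prop :=
  p ∉ Set.range γ ∧ Filter.Tendsto (truncatedIndex γ p) Filter.atTop (nhds (-1 / 2))

/-- The decreasing sequences of poles, `s = -x - n + 2πim / log q` with `x ∈ {a, b, c, f}`, `n ≥ 0`
and `m ∈ ℤ`, i.e. the zeros of `(q^{a+s}, q^{b+s}, q^{c+s}, q^{f+s}; q)_∞`. -/
def decreasingPoles (q : ℝ) (a b c f : ℂ) : Set ℂ :=
  {s | ∃ x ∈ [a, b, c, f], ∃ n : ℕ, (q : ℂ) ^ (x + s + n) = 1}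

/-- The increasing sequences of poles, `s = n` and `s = 1 - d + n` with `n ≥ 0`: those zeros of
`sin πs` and of `sin π(d+s)` that the zeros of `(q^{1+s}, q^{d+s}; q)_∞` do not cancel. -/
def increasingPoles (d : ℂ) : Set ℂ :=
  {s | ∃ n : ℕ, s = n ∨ s = 1 - d + n}

/-- The contour `γ` has the decreasing sequences of poles on its left and the increasing sequences
of poles on its right. -/
def SeparatesPoles (γ : ℝ → ℂ) (q : ℝ) (a b c d f : ℂ) : Prop :=
  (∀ p ∈ decreasingPoles q a b c f, LiesLeftOf γ p) ∧ ∀ p ∈ increasingPoles d, LiesRightOf γ p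

/-- The integrand of the extended second `q`-Barnes lemma. -/
def integrand (q : ℝ) (a b c d e f s : ℂ) : ℂ :=
  qPochInfs [(q : ℂ) ^ (1 + s), (q : ℂ) ^ (d + s), (q : ℂ) ^ (1 + a + b + c + s - d),
      (q : ℂ) ^ (e + f + s)] q /
    qPochInfs [(q : ℂ) ^ (a + s), (q : ℂ) ^ (b + s), (q : ℂ) ^ (c + s), (q : ℂ) ^ (f + s)] q *
    ((Real.pi : ℂ) * (q : ℂ) ^ s /
      (Complex.sin ((Real.pi : ℂ) * s) * Complex.sin ((Real.pi : ℂ) * (d + s)))) *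
    basicHypergeometric [(q : ℂ) ^ e, (q : ℂ) ^ (a + s), (q : ℂ) ^ (b + s)]
      [(q : ℂ) ^ (e + f + s), (q : ℂ) ^ (1 + a + b + c + s - d)] q ((q : ℂ) ^ (1 + c + f - d))

end

end QBarnes

/-!
Write `x = q ^ s` and `A = q ^ a`, …, `F = q ^ f`, `p = q ^ (1 - d)`. Apart from the two cosecants
the integrand is `x (q x, q x / p; q)_∞ K(x)`, where `K` is a quotient of entire functions of `x`
whose denominator `(A x, B x, C x, F x; q)_∞` vanishes at the decreasing poles (`extKernel`). The
zeros of `(q x, q x / p; q)_∞` cancel the poles of the cosecants at the points `s = -1, -2, …` and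
`s = -d, -d - 1, …`, so that only the increasing poles remain on the right of the contour, and
moving the contour to the right turns the integral into `-1 / sin (π d)` times

  `∑ₙ w(q ^ n) - ∑ₙ w(p q ^ n)`,   `w(x) = x (q x, q x / p; q)_∞ K(x)`

(`integral_regIntegrand`, with `jacksonDiff` for this difference). It remains to evaluate the
difference, which is the three-term form of a nonterminating summation formula
(`jacksonDiff_extKernel`).

**The contour.** The position of a pole is given by its index, so the residue theorem is needed
only in the form `integral_contour_sub_integral_line`: near the contour truncated at a large
height, the integrand minus a sum of multiples of `1 / (z - p)` has a primitive, and the closed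
integral of `1 / (z - p)` is computed from the index of `p`. The decreasing poles are invariant
under translation by the period `2πi / log q`; having index `1 / 2`, they must lie to the left of
both vertical ends of the contour (`re_lt_of_periodic`), which confines the poles that matter to a
bounded region. The cosecants give the decay along vertical lines, and on the lines `Re s = R + k`
the factor `q ^ s` makes the integral tend to `0`. The integrand takes junk values at the removable
singularities, but a path meets a countable set with nonzero velocity only at a null set of times
(`mul_deriv_ae_eq_of_countable`).

**The summation formula.** For `E = 1` it is the nonterminating `q`-Saalschütz sum
(`jacksonDiff_saalWeight`). There the quotient of the two sides is invariant under `A ↦ A q`,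
because a combination of the summands telescopes along each geometric sequence, with boundary terms
that cancel in the difference (`saalWeight_contiguous`); hence each parameter may be replaced by
`0`, and the remaining sum telescopes again. The general case follows by applying the Cauchy
operator `∑ₖ (E; q)ₖ / (q; q)ₖ (F D)ᵏ`, with `D` the `q`-derivative in the parameter `A`, to both
sides of the Saalschütz sum divided by `(p A C; q)_∞`. The derivatives are explicit finite sums
(`cauchyDeriv`), which obey the recursion of `D` on both sides
(`jacksonDiff_baseWeight_mul_cauchyDeriv`), and the `q`-binomial theorem sums the series over `k`
(`hasSum_cauchyDeriv`).
-/

open Filter Topology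

namespace QBarnes

/-! ### Infinite and finite `q`-shifted factorials -/

section Pochhammer

variable {q : ℂ}

lemma summable_norm_mul_pow (hq : ‖q‖ < 1) (a : ℂ) : Summable fun k : ℕ => ‖-(a * q ^ k)‖ := by
  simp only [norm_neg, norm_mul, norm_pow]
  exact (summable_geometric_of_lt_one (norm_nonneg _) hq).mul_left _

lemma multipliable_qPochInf (hq : ‖q‖ < 1) (a : ℂ) : Multipliable fun k : ℕ => 1 - a * q ^ k := by
  simpa [sub_eq_add_neg] using multipliable_one_add_of_summable (summable_norm_mul_pow hq a)

lemma tendsto_qPoch (hq : ‖q‖ < 1) (a : ℂ) :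
    Tendsto (fun n => qPoch a q n) atTop (𝓝 (qPochInf a q)) :=
  (multipliable_qPochInf hq a).hasProd.tendsto_prod_nat

@[simp] lemma qPoch_zero (a q : ℂ) : qPoch a q 0 = 1 := by simp [qPoch]

lemma qPoch_succ (a q : ℂ) (n : ℕ) : qPoch a q (n + 1) = qPoch a q n * (1 - a * q ^ n) := by
  simp [qPoch, Finset.prod_range_succ]

lemma qPoch_add (a q : ℂ) (m n : ℕ) :
    qPoch a q (m + n) = qPoch a q m * qPoch (a * q ^ m) q n := by
  simp only [qPoch, Finset.prod_range_add]
  congr 1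
  exact Finset.prod_congr rfl fun k _ => by ring

@[simp] lemma qPochInf_zero (q : ℂ) : qPochInf 0 q = 1 := by simp [qPochInf]

lemma qPochInf_eq_qPoch_mul (hq : ‖q‖ < 1) (a : ℂ) (n : ℕ) :
    qPochInf a q = qPoch a q n * qPochInf (a * q ^ n) q := by
  have h1 := (tendsto_qPoch hq a).comp (tendsto_add_atTop_nat n)
  have h2 := (tendsto_qPoch hq (a * q ^ n)).const_mul (qPoch a q n)
  refine tendsto_nhds_unique h1 (h2.congr fun m => ?_)
  rw [Function.comp, add_comm m n, qPoch_add]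

lemma qPochInf_step (hq : ‖q‖ < 1) (a : ℂ) :
    qPochInf a q = (1 - a) * qPochInf (a * q) q := by
  simpa [qPoch_succ] using qPochInf_eq_qPoch_mul hq a 1

lemma qPochInf_ne_zero (hq : ‖q‖ < 1) {a : ℂ} (h : ∀ k : ℕ, a * q ^ k ≠ 1) :
    qPochInf a q ≠ 0 := by
  have := tprod_one_add_ne_zero_of_summable (f := fun k : ℕ => -(a * q ^ k))
    (fun k hk => h k (by linear_combination -hk)) (summable_norm_mul_pow hq a)
  simpa [qPochInf, sub_eq_add_neg] using this

lemma qPoch_ne_zero {a : ℂ} (h : ∀ k : ℕ, a * q ^ k ≠ 1) (n : ℕ) : qPoch a q n ≠ 0 :=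
  Finset.prod_ne_zero_iff.2 fun k _ hk => h k (by linear_combination -hk)

lemma qPochInf_eq_zero (hq : ‖q‖ < 1) {a : ℂ} {k : ℕ} (h : a * q ^ k = 1) :
    qPochInf a q = 0 := by
  rw [qPochInf_eq_qPoch_mul hq a (k + 1), qPoch_succ, h]
  simp

lemma mul_pow_ne_one_of_qPochInf_ne_zero (hq : ‖q‖ < 1) {a : ℂ} (h : qPochInf a q ≠ 0) (k : ℕ) :
    a * q ^ k ≠ 1 :=
  fun h' => h (qPochInf_eq_zero hq h')

lemma mul_pow_ne_one_of_norm_lt_one (hq : ‖q‖ < 1) {a : ℂ} (h : ‖a‖ < 1) (k : ℕ) :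
    a * q ^ k ≠ 1 := by
  intro h'
  have h2 : ‖a * q ^ k‖ < 1 := by
    rw [norm_mul, norm_pow]
    exact mul_lt_one_of_nonneg_of_lt_one_left (norm_nonneg _) h
      (pow_le_one₀ (norm_nonneg _) hq.le)
  simp [h'] at h2

lemma differentiable_qPochInf (hq : ‖q‖ < 1) : Differentiable ℂ fun a => qPochInf a q := by
  intro a
  have hU : IsOpen (Metric.ball (0 : ℂ) (‖a‖ + 1)) := Metric.isOpen_ball
  have h1 := Summable.hasProdLocallyUniformlyOn_nat_one_add
    (f := fun (k : ℕ) (a : ℂ) => -(a * q ^ k)) hU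
    (u := fun k => (‖a‖ + 1) * ‖q‖ ^ k)
    ((summable_geometric_of_lt_one (norm_nonneg _) hq).mul_left _)
    (Eventually.of_forall fun n x hx => by
      rw [norm_neg, norm_mul, norm_pow]
      gcongr
      exact (mem_ball_zero_iff.1 hx).le)
    (fun n => by fun_prop)
  have h2 := h1.tendstoLocallyUniformlyOn_finsetRange.differentiableOn
    (Eventually.of_forall fun n => by fun_prop) hU
  have h3 := h2.differentiableAt (hU.mem_nhds (x := a) (by simp))
  simpa [qPochInf, sub_eq_add_neg] using h3

lemma continuous_qPochInf (hq : ‖q‖ < 1) : Continuous fun a => qPochInf a q :=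
  (differentiable_qPochInf hq).continuous

lemma exists_norm_qPochInf_le (hq : ‖q‖ < 1) (r : ℝ) :
    ∃ M : ℝ, 0 < M ∧ ∀ a : ℂ, ‖a‖ ≤ r → ‖qPochInf a q‖ ≤ M := by
  obtain ⟨M, hM⟩ := (isCompact_closedBall (0 : ℂ) r).exists_bound_of_continuousOn
    (continuous_qPochInf hq).continuousOn
  exact ⟨max M 1, by positivity, fun a ha => (hM a (by simpa using ha)).trans (le_max_left _ _)⟩

lemma exists_norm_qPoch_le (hq : ‖q‖ < 1) (r : ℝ) :
    ∃ M : ℝ, 0 < M ∧ ∀ a : ℂ, ‖a‖ ≤ r → ∀ n, ‖qPoch a q n‖ ≤ M := by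
  have hs := (summable_geometric_of_lt_one (norm_nonneg _) hq).mul_left |r|
  refine ⟨Real.exp (∑' k, |r| * ‖q‖ ^ k), Real.exp_pos _, fun a ha n => ?_⟩
  rw [qPoch, norm_prod]
  calc ∏ k ∈ Finset.range n, ‖1 - a * q ^ k‖
      ≤ ∏ k ∈ Finset.range n, Real.exp (|r| * ‖q‖ ^ k) := by
        refine Finset.prod_le_prod (fun _ _ => norm_nonneg _) fun k _ => ?_
        calc ‖1 - a * q ^ k‖ ≤ 1 + ‖a‖ * ‖q‖ ^ k := by
              simpa using norm_sub_le 1 (a * q ^ k)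
          _ ≤ 1 + |r| * ‖q‖ ^ k := by gcongr; exact ha.trans (le_abs_self r)
          _ ≤ _ := by rw [add_comm]; exact Real.add_one_le_exp _
    _ = Real.exp (∑ k ∈ Finset.range n, |r| * ‖q‖ ^ k) := (Real.exp_sum _ _).symm
    _ ≤ _ := Real.exp_le_exp.2 (hs.sum_le_tsum _ fun _ _ => by positivity)

lemma qPoch_self_ne_zero (hq : ‖q‖ < 1) (n : ℕ) : qPoch q q n ≠ 0 :=
  qPoch_ne_zero (mul_pow_ne_one_of_norm_lt_one hq hq) n

lemma exists_norm_inv_qPoch_self_le (hq : ‖q‖ < 1) :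
    ∃ M : ℝ, 0 < M ∧ ∀ n, ‖(qPoch q q n)⁻¹‖ ≤ M := by
  obtain ⟨M, hM0, hM⟩ := exists_norm_qPochInf_le hq 1
  have h0 : qPochInf q q ≠ 0 := qPochInf_ne_zero hq (mul_pow_ne_one_of_norm_lt_one hq hq)
  refine ⟨M / ‖qPochInf q q‖, by positivity, fun n => ?_⟩
  have h1 := qPochInf_eq_qPoch_mul hq q n
  have h2 : (qPoch q q n)⁻¹ = qPochInf (q * q ^ n) q / qPochInf q q := by
    rw [eq_div_iff h0, h1, inv_mul_cancel_left₀ (qPoch_self_ne_zero hq n)]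
  rw [h2, norm_div]
  gcongr
  apply hM
  rw [← pow_succ', norm_pow]
  exact pow_le_one₀ (norm_nonneg _) hq.le

/-- The `q`-binomial theorem. Both sides satisfy `(1 - z) f(z) = (1 - a z) f(q z)`, and iterating
this relation moves the argument to `0`. -/
theorem hasSum_qBinomial (hq : ‖q‖ < 1) (a : ℂ) {z : ℂ} (hz : ‖z‖ < 1) :
    HasSum (fun n => qPoch a q n / qPoch q q n * z ^ n) (qPochInf (a * z) q / qPochInf z q) := by
  set c : ℕ → ℂ := fun n => qPoch a q n / qPoch q q n with hc
  obtain ⟨M₁, hM₁, h₁⟩ := exists_norm_qPoch_le hq ‖a‖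
  obtain ⟨M₂, hM₂, h₂⟩ := exists_norm_inv_qPoch_self_le hq
  have hcb : ∀ n, ‖c n‖ ≤ M₁ * M₂ := fun n => by
    simp only [hc, div_eq_mul_inv, norm_mul]
    gcongr
    · exact h₁ a le_rfl n
    · exact h₂ n
  have hb : ∀ y : ℂ, ‖y‖ ≤ ‖z‖ → ∀ n, ‖c n * y ^ n‖ ≤ M₁ * M₂ * ‖z‖ ^ n := fun y hy n => by
    rw [norm_mul, norm_pow]
    gcongr
    exact hcb n
  have hgs : Summable fun n => M₁ * M₂ * ‖z‖ ^ n :=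
    (summable_geometric_of_lt_one (norm_nonneg _) hz).mul_left _
  have hs : ∀ y : ℂ, ‖y‖ ≤ ‖z‖ → Summable fun n => c n * y ^ n := fun y hy =>
    hgs.of_norm_bounded (hb y hy)
  set f : ℂ → ℂ := fun y => ∑' n, c n * y ^ n with hf
  have hqz : ∀ N : ℕ, ‖z * q ^ N‖ ≤ ‖z‖ := fun N => by
    rw [norm_mul, norm_pow]
    exact mul_le_of_le_one_right (norm_nonneg _) (pow_le_one₀ (norm_nonneg _) hq.le)
  have hcs : ∀ n, c (n + 1) * (1 - q ^ (n + 1)) = c n * (1 - a * q ^ n) := fun n => by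
    have h1 := qPoch_self_ne_zero hq n
    have h2 := qPoch_self_ne_zero hq (n + 1)
    simp only [hc]
    rw [qPoch_succ q q n, ← pow_succ'] at *
    have h3 := right_ne_zero_of_mul h2
    rw [qPoch_succ]
    field_simp
  have hrec : ∀ y : ℂ, ‖y‖ ≤ ‖z‖ → (1 - y) * f y = (1 - a * y) * f (y * q) := by
    intro y hy
    have hyq : ‖y * q‖ ≤ ‖z‖ := by
      rw [norm_mul]
      exact (mul_le_of_le_one_right (norm_nonneg _) hq.le).trans hy
    have e1 := (hs y hy).tsum_eq_zero_add
    have e2 := (hs _ hyq).tsum_eq_zero_add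
    have s1 := (hs y hy).mul_left y
    have s2 := (hs _ hyq).mul_left (a * y)
    have s3 := (summable_nat_add_iff 1).2 (hs y hy)
    have s4 := (summable_nat_add_iff 1).2 (hs _ hyq)
    have key : ∑' n, c (n + 1) * y ^ (n + 1) - ∑' n, y * (c n * y ^ n)
        = ∑' n, c (n + 1) * (y * q) ^ (n + 1) - ∑' n, a * y * (c n * (y * q) ^ n) := by
      rw [← s3.tsum_sub s1, ← s4.tsum_sub s2]
      refine tsum_congr fun n => ?_
      have := hcs n
      rw [mul_pow, mul_pow]
      linear_combination y ^ (n + 1) * this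
    rw [tsum_mul_left, tsum_mul_left] at key
    simp only [hf]
    have e3 : ∑' n, c (n + 1) * y ^ (n + 1) = f y - 1 := by
      rw [hf]; simp only; rw [e1]; simp [hc]
    have e4 : ∑' n, c (n + 1) * (y * q) ^ (n + 1) = f (y * q) - 1 := by
      rw [hf]; simp only; rw [e2]; simp [hc]
    rw [e3, e4] at key
    simp only [hf] at key
    linear_combination key
  have hiter : ∀ N, qPoch z q N * f z = qPoch (a * z) q N * f (z * q ^ N) := by
    intro N
    induction N with
    | zero => simp
    | succ N ih =>
      have := hrec _ (hqz N)
      rw [qPoch_succ, qPoch_succ, pow_succ, ← mul_assoc z]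
      linear_combination (1 - z * q ^ N) * ih + qPoch (a * z) q N * this
  have hlim : Tendsto (fun N => f (z * q ^ N)) atTop (𝓝 1) := by
    have h0 : f 0 = 1 := by
      rw [hf]
      simp only
      rw [tsum_eq_single 0 (fun n hn => by simp [hn])]
      simp [hc]
    rw [← h0]
    refine tendsto_tsum_of_dominated_convergence hgs (fun n => ?_)
      (Eventually.of_forall fun N n => hb _ (hqz N) n)
    have : Tendsto (fun N : ℕ => z * q ^ N) atTop (𝓝 0) := by
      simpa using (tendsto_pow_atTop_nhds_zero_of_norm_lt_one hq).const_mul z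
    exact (this.pow n).const_mul _
  have hfin : qPochInf z q * f z = qPochInf (a * z) q := by
    refine tendsto_nhds_unique ((tendsto_qPoch hq z).mul_const _) ?_
    have := (tendsto_qPoch hq (a * z)).mul hlim
    rw [mul_one] at this
    exact this.congr fun N => (hiter N).symm
  have hz0 : qPochInf z q ≠ 0 := qPochInf_ne_zero hq (mul_pow_ne_one_of_norm_lt_one hq hz)
  rw [← hfin, mul_div_cancel_left₀ _ hz0]
  exact (hs z le_rfl).hasSum

end Pochhammer

/-! ### The nonterminating `q`-Saalschütz sum -/

section Saalschutz

variable {q : ℂ}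

lemma tendsto_mul_pow_zero (hq : ‖q‖ < 1) (y : ℂ) :
    Tendsto (fun n : ℕ => y * q ^ n) atTop (𝓝 0) := by
  simpa using (tendsto_pow_atTop_nhds_zero_of_norm_lt_one hq).const_mul y

lemma summable_mul_comp_mul_pow (hq : ‖q‖ < 1) {f : ℂ → ℂ} (hf : ContinuousAt f 0) (y : ℂ) :
    Summable fun n : ℕ => y * q ^ n * f (y * q ^ n) := by
  refine summable_of_isBigO_nat (g := fun n => ‖q‖ ^ n)
    (summable_geometric_of_lt_one (norm_nonneg _) hq) ?_
  have h1 : (fun n : ℕ => f (y * q ^ n)) =O[atTop] fun _ => (1 : ℝ) :=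
    (hf.tendsto.comp (tendsto_mul_pow_zero hq y)).isBigO_one ℝ
  have h2 : (fun n : ℕ => y * q ^ n) =O[atTop] fun n => ‖q‖ ^ n :=
    Asymptotics.IsBigO.of_bound ‖y‖ (Eventually.of_forall fun n => by simp)
  simpa using h2.mul h1

lemma hasSum_sub_comp_mul_pow (hq : ‖q‖ < 1) {h : ℂ → ℂ} (hh : ContinuousAt h 0) (y : ℂ)
    (hs : Summable fun n : ℕ => h (y * q ^ n) - h (y * q ^ (n + 1))) :
    HasSum (fun n : ℕ => h (y * q ^ n) - h (y * q ^ (n + 1))) (h y - h 0) := by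
  rw [hs.hasSum_iff_tendsto_nat]
  have : ∀ n, ∑ i ∈ Finset.range n, (h (y * q ^ i) - h (y * q ^ (i + 1)))
      = h y - h (y * q ^ n) := fun n => by
    rw [Finset.sum_range_sub']
    simp
  simp only [this]
  exact (hh.tendsto.comp (tendsto_mul_pow_zero hq y)).const_sub _

/-- The summand `x (q x, D x, p A B C x; q)_∞ / (A x, B x, C x; q)_∞` of the nonterminating
`q`-Saalschütz sum, where `D = q / p`. -/
noncomputable def saalWeight (q p A B C x : ℂ) : ℂ :=
  x * (qPochInf (q * x) q * qPochInf (q / p * x) q * qPochInf (p * A * B * C * x) q /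
    (qPochInf (A * x) q * qPochInf (B * x) q * qPochInf (C * x) q))

/-- The sum of a function over the two geometric sequences `q ^ n` and `p q ^ n`, the second
counted negatively (a Jackson integral from `p` to `1` up to normalisation). -/
noncomputable def jacksonDiff (q p : ℂ) (f : ℂ → ℂ) : ℂ :=
  ∑' n : ℕ, f (q ^ n) - ∑' n : ℕ, f (p * q ^ n)

lemma continuousAt_saal (hq : ‖q‖ < 1) (D S A B C : ℂ) :
    ContinuousAt (fun x => qPochInf (q * x) q * qPochInf (D * x) q * qPochInf (S * x) q /
    (qPochInf (A * x) q * qPochInf (B * x) q * qPochInf (C * x) q)) 0 := by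
  have h := continuous_qPochInf hq
  have h' : ∀ a : ℂ, Continuous fun x => qPochInf (a * x) q := fun a =>
    h.comp (continuous_const.mul continuous_id)
  refine ContinuousAt.div ?_ ?_ (by simp)
  · exact (((h' _).mul (h' _)).mul (h' _)).continuousAt
  · exact (((h' _).mul (h' _)).mul (h' _)).continuousAt

lemma summable_saalWeight (hq : ‖q‖ < 1) (p A B C y : ℂ) :
    Summable fun n : ℕ => saalWeight q p A B C (y * q ^ n) :=
  summable_mul_comp_mul_pow hq (continuousAt_saal hq (q / p) (p * A * B * C) A B C) y

/-- The contiguous relation in `A` for one of the two geometric sequences: a multiple of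
`(x / p, x, p A B C x; q)_∞ / (A x, B x, C x; q)_∞` telescopes, and vanishes at the initial
point. -/
lemma saalWeight_contiguous (hq : ‖q‖ < 1) {p A B C y : ℂ} (hp : p ≠ 0)
    (hy : (1 - y) * (1 - y / p) = 0) (hA : ∀ n : ℕ, A * y * q ^ n ≠ 1)
    (hB : ∀ n : ℕ, B * y * q ^ n ≠ 1) (hC : ∀ n : ℕ, C * y * q ^ n ≠ 1) :
    (1 - A) * (1 - p * A) * ∑' n : ℕ, saalWeight q p A B C (y * q ^ n) -
      (1 - p * A * B) * (1 - p * A * C) * ∑' n : ℕ, saalWeight q p (A * q) B C (y * q ^ n) =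
      -(p * A) := by
  set κ : ℂ → ℂ := fun x => qPochInf (q * x) q * qPochInf (q / p * x) q *
    qPochInf (p * A * B * C * q * x) q /
    (qPochInf (A * x) q * qPochInf (B * x) q * qPochInf (C * x) q) with hκ
  set h : ℂ → ℂ := fun x => (1 - x) * (1 - x / p) * (1 - p * A * B * C * x) * κ x with hh
  have hne : ∀ {a : ℂ}, (∀ n : ℕ, a * y * q ^ n ≠ 1) → ∀ n : ℕ,
      qPochInf (a * (y * q ^ n)) q ≠ 0 := fun {a} ha n =>
    qPochInf_ne_zero hq fun k => by
      have := ha (n + k)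
      rwa [pow_add, ← mul_assoc, mul_assoc a y] at this
  have w1 : ∀ x, saalWeight q p A B C x = x * (1 - p * A * B * C * x) * κ x := fun x => by
    rw [saalWeight, qPochInf_step hq (p * A * B * C * x), hκ]
    ring_nf
  have st : ∀ a x : ℂ, qPochInf (a * x) q = (1 - a * x) * qPochInf (a * (x * q)) q := fun a x => by
    rw [qPochInf_step hq, mul_assoc]
  have w2 : ∀ n : ℕ, saalWeight q p (A * q) B C (y * q ^ n)
      = y * q ^ n * (1 - A * (y * q ^ n)) * κ (y * q ^ n) := fun n => by
    have h1 := hne hA n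
    have h1' := h1
    rw [st] at h1
    have h2 := left_ne_zero_of_mul h1
    have h3 := right_ne_zero_of_mul h1
    rw [saalWeight, hκ]
    simp only
    rw [st A (y * q ^ n), show A * q * (y * q ^ n) = A * (y * q ^ n * q) by ring,
      show p * (A * q) * B * C * (y * q ^ n) = p * A * B * C * q * (y * q ^ n) by ring]
    generalize qPochInf (A * (y * q ^ n * q)) q = PA at *
    generalize 1 - A * (y * q ^ n) = a at *
    field_simp
  have hstep : ∀ n : ℕ, h (y * q ^ (n + 1)) = (1 - A * (y * q ^ n)) * (1 - B * (y * q ^ n)) *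
      (1 - C * (y * q ^ n)) * κ (y * q ^ n) := fun n => by
    have a1 := hne hA n
    have b1 := hne hB n
    have c1 := hne hC n
    rw [st] at a1 b1 c1
    simp only [hh, hκ]
    rw [pow_succ, ← mul_assoc y]
    generalize y * q ^ n = x at *
    rw [st A x, st B x, st C x]
    have e1 : qPochInf (q * x) q = (1 - x * q) * qPochInf (q * (x * q)) q := by
      rw [st q x, mul_comm q x]
    have e2 : qPochInf (q / p * x) q = (1 - x * q / p) * qPochInf (q / p * (x * q)) q := by
      rw [st (q / p) x]; ring
    have e3 : qPochInf (p * A * B * C * q * x) q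
        = (1 - p * A * B * C * (x * q)) * qPochInf (p * A * B * C * q * (x * q)) q := by
      rw [st]; ring
    rw [e1, e2, e3]
    have a2 := left_ne_zero_of_mul a1
    have a3 := right_ne_zero_of_mul a1
    have b2 := left_ne_zero_of_mul b1
    have b3 := right_ne_zero_of_mul b1
    have c2 := left_ne_zero_of_mul c1
    have c3 := right_ne_zero_of_mul c1
    generalize qPochInf (A * (x * q)) q = PA at *
    generalize qPochInf (B * (x * q)) q = PB at *
    generalize qPochInf (C * (x * q)) q = PC at *
    generalize 1 - A * x = a at *
    generalize 1 - B * x = b at *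
    generalize 1 - C * x = c at *
    field_simp
  have key : ∀ n : ℕ, p * A * (h (y * q ^ n) - h (y * q ^ (n + 1))) =
      (1 - A) * (1 - p * A) * saalWeight q p A B C (y * q ^ n) -
      (1 - p * A * B) * (1 - p * A * C) * saalWeight q p (A * q) B C (y * q ^ n) := fun n => by
    rw [hstep, w1, w2]
    simp only [hh]
    field_simp
    ring
  have hcont : ContinuousAt h 0 := by
    refine ContinuousAt.mul (by fun_prop) ?_
    exact continuousAt_saal hq (q / p) (p * A * B * C * q) A B C
  have hhy : h y = 0 := by simp only [hh, hy, zero_mul]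
  have hh0 : h 0 = 1 := by simp [hh, hκ]
  have s1 := (summable_saalWeight hq p A B C y).mul_left ((1 - A) * (1 - p * A))
  have s2 := (summable_saalWeight hq p (A * q) B C y).mul_left ((1 - p * A * B) * (1 - p * A * C))
  rw [← tsum_mul_left, ← tsum_mul_left, ← s1.tsum_sub s2]
  by_cases hA0 : A = 0
  · subst hA0
    simp
  have hs : Summable fun n : ℕ => h (y * q ^ n) - h (y * q ^ (n + 1)) := by
    refine ((s1.sub s2).mul_left (p * A)⁻¹).congr fun n => ?_
    rw [← key, inv_mul_cancel_left₀ (mul_ne_zero hp hA0)]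
  rw [← tsum_congr key, tsum_mul_left, (hasSum_sub_comp_mul_pow hq hcont y hs).tsum_eq, hhy, hh0]
  ring

/-- The parameter `A` produces no pole at the points `q ^ n` and `p q ^ n`. -/
def NoPole (q p A : ℂ) : Prop := ∀ n : ℕ, A * q ^ n ≠ 1 ∧ p * A * q ^ n ≠ 1

lemma NoPole.zero (q p : ℂ) : NoPole q p 0 := fun n => by simp

lemma NoPole.mul_pow {p A : ℂ} (h : NoPole q p A) (N : ℕ) : NoPole q p (A * q ^ N) := fun n => by
  have := h (N + n)
  rw [pow_add] at this
  exact ⟨by rw [mul_assoc]; exact this.1, by rw [← mul_assoc, mul_assoc]; exact this.2⟩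

lemma NoPole.ne_one {p A : ℂ} (h : NoPole q p A) {y : ℂ} (hy : y = 1 ∨ y = p) (n : ℕ) :
    A * y * q ^ n ≠ 1 := by
  rcases hy with rfl | rfl
  · simpa using (h n).1
  · rw [mul_comm A]; exact (h n).2

lemma NoPole.qPochInf_ne_zero {p A : ℂ} (hq : ‖q‖ < 1) (h : NoPole q p A) {y : ℂ}
    (hy : y = 1 ∨ y = p) (n : ℕ) : qPochInf (A * (y * q ^ n)) q ≠ 0 :=
  QBarnes.qPochInf_ne_zero hq fun k => by
    have := h.ne_one hy (n + k)
    rwa [pow_add, ← mul_assoc, mul_assoc A y] at this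

lemma jacksonDiff_saalWeight_contiguous (hq : ‖q‖ < 1) {p A B C : ℂ} (hp : p ≠ 0)
    (hA : NoPole q p A) (hB : NoPole q p B) (hC : NoPole q p C) :
    (1 - A) * (1 - p * A) * jacksonDiff q p (saalWeight q p A B C) =
      (1 - p * A * B) * (1 - p * A * C) * jacksonDiff q p (saalWeight q p (A * q) B C) := by
  have h1 := saalWeight_contiguous hq hp (y := 1) (A := A) (B := B) (C := C) (by simp)
    (hA.ne_one (.inl rfl)) (hB.ne_one (.inl rfl)) (hC.ne_one (.inl rfl))
  have h2 := saalWeight_contiguous hq hp (y := p) (A := A) (B := B) (C := C) (by simp [hp])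
    (hA.ne_one (.inr rfl)) (hB.ne_one (.inr rfl)) (hC.ne_one (.inr rfl))
  simp only [one_mul] at h1
  rw [jacksonDiff, jacksonDiff]
  linear_combination h1 - h2

/-- Along a geometric sequence `1 / (A x; q)_∞` is bounded, since it tends to `1`. -/
lemma exists_norm_inv_qPochInf_le (hq : ‖q‖ < 1) (A y : ℂ) :
    ∃ K : ℝ, ∀ m : ℕ, ‖(qPochInf (A * (y * q ^ m)) q)⁻¹‖ ≤ K := by
  have h1 : Tendsto (fun m : ℕ => (qPochInf (A * (y * q ^ m)) q)⁻¹) atTop (𝓝 1) := by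
    have : Tendsto (fun m : ℕ => qPochInf (A * (y * q ^ m)) q) atTop (𝓝 1) := by
      rw [← qPochInf_zero q]
      refine ((continuous_qPochInf hq).tendsto 0).comp ?_
      simpa using (tendsto_mul_pow_zero hq y).const_mul A
    simpa using this.inv₀ one_ne_zero
  obtain ⟨K, hK⟩ := h1.norm.bddAbove_range
  exact ⟨K, fun m => hK ⟨m, rfl⟩⟩

lemma tendsto_tsum_saalWeight (hq : ‖q‖ < 1) (p A B C y : ℂ) :
    Tendsto (fun N : ℕ => ∑' n : ℕ, saalWeight q p (A * q ^ N) B C (y * q ^ n)) atTop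
      (𝓝 (∑' n : ℕ, saalWeight q p 0 B C (y * q ^ n))) := by
  have hc := continuous_qPochInf hq
  obtain ⟨K, hK⟩ := exists_norm_inv_qPochInf_le hq A y
  obtain ⟨M, hM0, hM⟩ := exists_norm_qPochInf_le hq (‖p * A * B * C * y‖)
  have hK0 : 0 ≤ K := (norm_nonneg _).trans (hK 0)
  have hbase : Summable fun n : ℕ => ‖saalWeight q p 0 B C (y * q ^ n)‖ :=
    (summable_saalWeight hq p 0 B C y).norm
  have hfac : ∀ (N n : ℕ), saalWeight q p (A * q ^ N) B C (y * q ^ n) =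
      saalWeight q p 0 B C (y * q ^ n) * (qPochInf (p * A * B * C * y * q ^ (N + n)) q *
        (qPochInf (A * (y * q ^ (N + n))) q)⁻¹) := fun N n => by
    simp only [saalWeight, mul_zero, zero_mul, qPochInf_zero, mul_one, one_mul, div_eq_mul_inv,
      mul_inv]
    rw [show p * (A * q ^ N) * B * C * (y * q ^ n) = p * A * B * C * y * q ^ (N + n) by ring,
      show A * q ^ N * (y * q ^ n) = A * (y * q ^ (N + n)) by ring]
    ring
  refine tendsto_tsum_of_dominated_convergence (hbase.mul_right (M * K)) (fun n => ?_)
    (Eventually.of_forall fun N n => ?_)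
  · simp only [hfac]
    have h1 : Tendsto (fun N : ℕ => qPochInf (p * A * B * C * y * q ^ (N + n)) q) atTop (𝓝 1) := by
      rw [← qPochInf_zero q]
      exact (hc.tendsto 0).comp ((tendsto_mul_pow_zero hq _).comp (tendsto_add_atTop_nat n))
    have h2 : Tendsto (fun N : ℕ => qPochInf (A * (y * q ^ (N + n))) q) atTop (𝓝 1) := by
      rw [← qPochInf_zero q]
      refine (hc.tendsto 0).comp ?_
      simpa using ((tendsto_mul_pow_zero hq y).comp (tendsto_add_atTop_nat n)).const_mul A
    simpa using (h1.mul (h2.inv₀ one_ne_zero)).const_mul (saalWeight q p 0 B C (y * q ^ n))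
  · rw [hfac, norm_mul, norm_mul]
    gcongr
    · apply hM
      rw [norm_mul _ (q ^ _), norm_pow]
      exact mul_le_of_le_one_right (norm_nonneg _) (pow_le_one₀ (norm_nonneg _) hq.le)
    · exact hK _

/-- Iterating the contiguous relation moves the parameter `A` to `0`. -/
lemma jacksonDiff_saalWeight_eq_zero_left (hq : ‖q‖ < 1) {p A B C : ℂ} (hp : p ≠ 0)
    (hA : NoPole q p A) (hB : NoPole q p B) (hC : NoPole q p C) :
    qPochInf A q * qPochInf (p * A) q * jacksonDiff q p (saalWeight q p A B C) =
      qPochInf (p * A * B) q * qPochInf (p * A * C) q *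
        jacksonDiff q p (saalWeight q p 0 B C) := by
  have hiter : ∀ N : ℕ, qPoch A q N * qPoch (p * A) q N * jacksonDiff q p (saalWeight q p A B C) =
      qPoch (p * A * B) q N * qPoch (p * A * C) q N *
        jacksonDiff q p (saalWeight q p (A * q ^ N) B C) := by
    intro N
    induction N with
    | zero => simp
    | succ N ih =>
      have := jacksonDiff_saalWeight_contiguous hq hp (hA.mul_pow N) hB hC
      rw [mul_assoc A, ← pow_succ] at this
      simp only [qPoch_succ]
      linear_combination (1 - A * q ^ N) * (1 - p * A * q ^ N) * ih +
        qPoch (p * A * B) q N * qPoch (p * A * C) q N * this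
  have hlim : Tendsto (fun N : ℕ => jacksonDiff q p (saalWeight q p (A * q ^ N) B C)) atTop
      (𝓝 (jacksonDiff q p (saalWeight q p 0 B C))) := by
    have h1 := tendsto_tsum_saalWeight hq p A B C 1
    have h2 := tendsto_tsum_saalWeight hq p A B C p
    simp only [one_mul] at h1
    exact h1.sub h2
  refine tendsto_nhds_unique (((tendsto_qPoch hq _).mul (tendsto_qPoch hq _)).mul_const _) ?_
  exact (((tendsto_qPoch hq _).mul (tendsto_qPoch hq _)).mul hlim).congr fun N => (hiter N).symm

lemma saalWeight_swap (q p A B C : ℂ) : saalWeight q p A B C = saalWeight q p B A C := by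
  funext x
  simp only [saalWeight]
  ring_nf

lemma saalWeight_rotate (q p A B C : ℂ) : saalWeight q p A B C = saalWeight q p C A B := by
  funext x
  simp only [saalWeight]
  ring_nf

/-- The total mass of the weight `x (q x, q x / p; q)_∞`. Dividing the weight by `(q x / p; q)_∞`
makes the sums telescope, unless `p = q ^ (k + 1)`, when the two sequences overlap. -/
lemma jacksonDiff_saalWeight_zero (hq : ‖q‖ < 1) {p : ℂ} (hp : p ≠ 0) :
    jacksonDiff q p (saalWeight q p 0 0 0) =
      qPochInf q q * qPochInf (q / p) q * qPochInf p q := by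
  by_cases hD : ∃ k : ℕ, q / p * q ^ k = 1
  · obtain ⟨k, hk⟩ := hD
    have hpk : p = q ^ (k + 1) := by
      field_simp at hk
      rw [← hk]; ring
    rw [qPochInf_eq_zero hq hk, jacksonDiff]
    have hs : Summable fun n : ℕ => saalWeight q p 0 0 0 (q ^ n) := by
      simpa using summable_saalWeight hq p 0 0 0 1
    rw [← hs.sum_add_tsum_nat_add (k + 1)]
    have h0 : ∑ n ∈ Finset.range (k + 1), saalWeight q p 0 0 0 (q ^ n) = 0 := by
      refine Finset.sum_eq_zero fun n hn => ?_
      have hn' : n ≤ k := Nat.lt_succ_iff.1 (Finset.mem_range.1 hn)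
      have : qPochInf (q / p * q ^ n) q = 0 := by
        refine qPochInf_eq_zero hq (k := k - n) ?_
        rw [mul_assoc, ← pow_add, Nat.add_sub_cancel' hn', hk]
      simp [saalWeight, this]
    rw [h0]
    simp only [hpk, ← pow_add]
    simp [add_comm]
  · push Not at hD
    have hDp : NoPole q p (q / p) := fun n => ⟨hD n, by
      rw [mul_div_cancel₀ _ hp]
      exact mul_pow_ne_one_of_norm_lt_one hq hq n⟩
    have h1 := jacksonDiff_saalWeight_eq_zero_left hq hp hDp (NoPole.zero q p) (NoPole.zero q p)
    have hw : ∀ y : ℂ, (y = 1 ∨ y = p) →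
        ∑' n : ℕ, saalWeight q p (q / p) 0 0 (y * q ^ n) = 1 - qPochInf y q := fun y hy => by
      have hterm : ∀ n : ℕ, saalWeight q p (q / p) 0 0 (y * q ^ n) =
          -(qPochInf (y * q ^ n) q - qPochInf (y * q ^ (n + 1)) q) := fun n => by
        have := hDp.qPochInf_ne_zero hq hy n
        simp only [saalWeight, mul_zero, zero_mul, qPochInf_zero, mul_one]
        rw [mul_div_cancel_right₀ _ this, qPochInf_step hq (y * q ^ n)]
        ring_nf
      have hs := (summable_saalWeight hq p (q / p) 0 0 y)
      simp only [hterm] at hs ⊢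
      rw [tsum_neg, (hasSum_sub_comp_mul_pow hq (continuous_qPochInf hq).continuousAt y
        (by simpa using hs.neg)).tsum_eq, qPochInf_zero]
      ring
    have h2 : jacksonDiff q p (saalWeight q p (q / p) 0 0) = qPochInf p q := by
      have e1 := hw 1 (.inl rfl)
      have e2 := hw p (.inr rfl)
      simp only [one_mul] at e1
      rw [jacksonDiff, e1, e2, qPochInf_eq_zero hq (a := 1) (k := 0) (by simp)]
      ring
    rw [h2, mul_div_cancel₀ _ hp] at h1
    simp only [mul_zero, qPochInf_zero, one_mul] at h1
    rw [← h1]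
    ring

/-- The nonterminating `q`-Saalschütz sum. -/
theorem jacksonDiff_saalWeight (hq : ‖q‖ < 1) {p A B C : ℂ} (hp : p ≠ 0)
    (hA : NoPole q p A) (hB : NoPole q p B) (hC : NoPole q p C) :
    jacksonDiff q p (saalWeight q p A B C) =
      qPochInf q q * qPochInf (q / p) q * qPochInf p q *
        (qPochInf (p * B * C) q * qPochInf (p * A * C) q * qPochInf (p * A * B) q) /
        (qPochInf A q * qPochInf B q * qPochInf C q *
          (qPochInf (p * A) q * qPochInf (p * B) q * qPochInf (p * C) q)) := by
  have ne : ∀ {X : ℂ}, NoPole q p X → qPochInf X q ≠ 0 ∧ qPochInf (p * X) q ≠ 0 := fun {X} hX =>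
    ⟨qPochInf_ne_zero hq fun k => (hX k).1, qPochInf_ne_zero hq fun k => (hX k).2⟩
  have h1 := jacksonDiff_saalWeight_eq_zero_left hq hp hA hB hC
  have h2 := jacksonDiff_saalWeight_eq_zero_left hq hp hB (NoPole.zero q p) hC
  have h3 := jacksonDiff_saalWeight_eq_zero_left hq hp hC (NoPole.zero q p) (NoPole.zero q p)
  rw [saalWeight_swap q p 0 B C] at h1
  rw [saalWeight_rotate q p 0 0 C] at h2
  rw [jacksonDiff_saalWeight_zero hq hp] at h3
  simp only [mul_zero, qPochInf_zero, one_mul] at h2 h3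
  obtain ⟨a1, a2⟩ := ne hA
  obtain ⟨b1, b2⟩ := ne hB
  obtain ⟨c1, c2⟩ := ne hC
  rw [eq_div_iff (by positivity)]
  linear_combination (qPochInf B q * qPochInf C q * (qPochInf (p * B) q * qPochInf (p * C) q)) * h1
    + (qPochInf (p * A * B) q * qPochInf (p * A * C) q * qPochInf C q * qPochInf (p * C) q) * h2
    + (qPochInf (p * A * B) q * qPochInf (p * A * C) q * qPochInf (p * B * C) q) * h3

end Saalschutz

/-! ### The Cauchy operator applied to the `q`-Saalschütz sum -/

section Cauchy

variable {q : ℂ}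

/-- The coefficients `t ^ j (β; q)_j (A β t q ^ j; q)_∞ / ((q; q)_j (A s q ^ j; q)_∞)`. -/
noncomputable def cauchyCoeff (q s t β A : ℂ) (j : ℕ) : ℂ :=
  t ^ j * qPoch β q j / qPoch q q j * (qPochInf (A * β * t * q ^ j) q / qPochInf (A * s * q ^ j) q)

/-- `(A t; q)_∞ / (q; q)_k` times the `k`-th `q`-derivative with respect to `A` of
`(A β t; q)_∞ / (A s, A t; q)_∞`, in the form given by the `q`-Leibniz rule. -/
noncomputable def cauchyDeriv (q s t β A : ℂ) (k : ℕ) : ℂ :=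
  ∑ x ∈ Finset.HasAntidiagonal.antidiagonal k, s ^ x.2 / qPoch q q x.2 * cauchyCoeff q s t β A x.1

lemma cauchyDeriv_zero (q s t β A : ℂ) :
    cauchyDeriv q s t β A 0 = qPochInf (A * β * t) q / qPochInf (A * s) q := by
  simp [cauchyDeriv, cauchyCoeff]

/-- The defining recursion of the `q`-derivatives,
`D f (A) = (f A - f (A q)) / A`. -/
lemma cauchyDeriv_succ (hq : ‖q‖ < 1) {s t β A : ℂ} (h : ∀ j : ℕ, A * s * q ^ j ≠ 1) (k : ℕ) :
    (1 - q ^ (k + 1)) * A * cauchyDeriv q s t β A (k + 1) =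
      cauchyDeriv q s t β A k - (1 - A * t) * cauchyDeriv q s t β (A * q) k := by
  set r : ℕ → ℂ := fun m => s ^ m / qPoch q q m with hr
  set w : ℕ → ℂ := fun j => t ^ j * qPoch β q j / qPoch q q j with hw
  set a : ℕ → ℂ := fun j => qPochInf (A * β * t * q ^ j) q / qPochInf (A * s * q ^ j) q with ha
  have hq1 : ∀ n : ℕ, 1 - q * q ^ n ≠ 0 := fun n hn =>
    mul_pow_ne_one_of_norm_lt_one hq hq n (by linear_combination -hn)
  have hr1 : ∀ m, (1 - q ^ (m + 1)) * r (m + 1) = s * r m := fun m => by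
    have h1 := qPoch_self_ne_zero hq m
    have h2 := hq1 m
    simp only [hr]
    rw [qPoch_succ, pow_succ' q, pow_succ' s]
    field_simp
  have hw1 : ∀ j, (1 - q ^ (j + 1)) * w (j + 1) = t * (1 - β * q ^ j) * w j := fun j => by
    have h1 := qPoch_self_ne_zero hq j
    have h2 := hq1 j
    simp only [hw]
    rw [qPoch_succ, qPoch_succ, pow_succ' q, pow_succ' t]
    field_simp
  have ha1 : ∀ j, (1 - A * s * q ^ j) * a j = (1 - A * β * t * q ^ j) * a (j + 1) := fun j => by
    have h1 : qPochInf (A * s * q ^ j) q ≠ 0 := qPochInf_ne_zero hq fun i => by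
      rw [mul_assoc _ (q ^ j), ← pow_add]; exact h _
    simp only [ha]
    rw [qPochInf_step hq (A * s * q ^ j)] at h1 ⊢
    rw [qPochInf_step hq (A * β * t * q ^ j), mul_assoc _ _ q, mul_assoc _ _ q, ← pow_succ] at *
    have h2 := left_ne_zero_of_mul h1
    have h3 := right_ne_zero_of_mul h1
    generalize qPochInf (A * s * q ^ (j + 1)) q = P at *
    generalize 1 - A * s * q ^ j = b at *
    field_simp
  have e0 : ∀ k, cauchyDeriv q s t β A k =
      ∑ x ∈ Finset.HasAntidiagonal.antidiagonal k, r x.2 * (w x.1 * a x.1) := fun k => rfl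
  have e1 : ∀ k, cauchyDeriv q s t β (A * q) k =
      ∑ x ∈ Finset.HasAntidiagonal.antidiagonal k, r x.2 * (w x.1 * a (x.1 + 1)) := fun k => by
    refine Finset.sum_congr rfl fun x _ => ?_
    simp only [hr, hw, ha, cauchyCoeff]
    ring_nf
  have p1 : ∑ x ∈ Finset.HasAntidiagonal.antidiagonal (k + 1),
        q ^ x.1 * (1 - q ^ x.2) * r x.2 * (w x.1 * a x.1)
      = ∑ x ∈ Finset.HasAntidiagonal.antidiagonal k, q ^ x.1 * (s * r x.2) * (w x.1 * a x.1) := by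
    rw [Finset.Nat.sum_antidiagonal_succ']
    simp only [pow_zero, sub_self, mul_zero, zero_mul, zero_add]
    refine Finset.sum_congr rfl fun x _ => ?_
    rw [← hr1]; ring
  have p2 : ∑ x ∈ Finset.HasAntidiagonal.antidiagonal (k + 1),
        (1 - q ^ x.1) * r x.2 * (w x.1 * a x.1)
      = ∑ x ∈ Finset.HasAntidiagonal.antidiagonal k,
        r x.2 * (t * (1 - β * q ^ x.1) * w x.1 * a (x.1 + 1)) := by
    rw [Finset.Nat.sum_antidiagonal_succ]
    simp only [pow_zero, sub_self, zero_mul, zero_add]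
    refine Finset.sum_congr rfl fun x _ => ?_
    rw [← hw1]; ring
  -- `1 - q ^ (k + 1) = q ^ j (1 - q ^ m) + (1 - q ^ j)` for `j + m = k + 1`
  have p3 : (1 - q ^ (k + 1)) * cauchyDeriv q s t β A (k + 1) =
      ∑ x ∈ Finset.HasAntidiagonal.antidiagonal k, q ^ x.1 * (s * r x.2) * (w x.1 * a x.1) +
      ∑ x ∈ Finset.HasAntidiagonal.antidiagonal k,
        r x.2 * (t * (1 - β * q ^ x.1) * w x.1 * a (x.1 + 1)) := by
    rw [← p1, ← p2, ← Finset.sum_add_distrib, e0, Finset.mul_sum]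
    refine Finset.sum_congr rfl fun x hx => ?_
    rw [← Finset.HasAntidiagonal.mem_antidiagonal.1 hx, pow_add]
    ring
  rw [mul_right_comm, p3, e0, e1, Finset.mul_sum, ← Finset.sum_sub_distrib,
    ← Finset.sum_add_distrib, Finset.sum_mul]
  refine Finset.sum_congr rfl fun x _ => ?_
  linear_combination -(r x.2 * w x.1) * ha1 x.1

lemma exists_norm_cauchyCoeff_le (hq : ‖q‖ < 1) (r K : ℝ) :
    ∃ M : ℝ, 0 < M ∧ ∀ s t β A : ℂ, ‖β‖ ≤ r → ‖A * β * t‖ ≤ r →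
      (∀ j : ℕ, ‖(qPochInf (A * s * q ^ j) q)⁻¹‖ ≤ K) →
      ∀ j, ‖cauchyCoeff q s t β A j‖ ≤ M * ‖t‖ ^ j := by
  obtain ⟨M₁, p₁, h₁⟩ := exists_norm_qPoch_le hq r
  obtain ⟨M₂, p₂, h₂⟩ := exists_norm_inv_qPoch_self_le hq
  obtain ⟨M₃, p₃, h₃⟩ := exists_norm_qPochInf_le hq r
  refine ⟨M₁ * M₂ * (M₃ * max K 1), by positivity, fun s t β A hβ hAβ hs j => ?_⟩
  rw [cauchyCoeff, div_eq_mul_inv, div_eq_mul_inv]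
  simp only [norm_mul, norm_pow]
  have b1 := h₁ β hβ j
  have b2 := h₂ j
  have b3 : ‖qPochInf (A * β * t * q ^ j) q‖ ≤ M₃ := by
    apply h₃
    rw [norm_mul _ (q ^ j), norm_pow]
    exact (mul_le_of_le_one_right (norm_nonneg _) (pow_le_one₀ (norm_nonneg _) hq.le)).trans hAβ
  have b4 := (hs j).trans (le_max_left K 1)
  calc ‖t‖ ^ j * ‖qPoch β q j‖ * ‖(qPoch q q j)⁻¹‖ *
        (‖qPochInf (A * β * t * q ^ j) q‖ * ‖(qPochInf (A * s * q ^ j) q)⁻¹‖)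
      ≤ ‖t‖ ^ j * M₁ * M₂ * (M₃ * max K 1) := by gcongr
    _ = _ := by ring

/-- The series `∑ (E; q)_k F ^ k / (q; q)_k D ^ k` in the `q`-derivative, applied to
`(A β t; q)_∞ / (A s, A t; q)_∞` and multiplied by `(A t; q)_∞`, sums by the
`q`-binomial theorem in the inner index. -/
lemma hasSum_cauchyDeriv (hq : ‖q‖ < 1) {E F s t β A : ℂ} (hs : ‖F * s‖ < 1) (ht : ‖F * t‖ < 1) :
    HasSum (fun k => qPoch E q k * F ^ k * cauchyDeriv q s t β A k)
      ((qPochInf (F * s) q)⁻¹ *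
        ∑' j, qPoch E q j * F ^ j * cauchyCoeff q s t β A j * qPochInf (E * F * s * q ^ j) q) := by
  obtain ⟨K, hK⟩ := exists_norm_inv_qPochInf_le hq A s
  obtain ⟨M, pM, hM⟩ := exists_norm_cauchyCoeff_le hq (max ‖β‖ ‖A * β * t‖) K
  have hb := hM s t β A (le_max_left _ _) (le_max_right _ _) fun j => by
    rw [mul_assoc]; exact hK j
  obtain ⟨M₁, p₁, h₁⟩ := exists_norm_qPoch_le hq ‖E‖
  obtain ⟨M₂, p₂, h₂⟩ := exists_norm_inv_qPoch_self_le hq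
  set f : ℕ × ℕ → ℂ := fun x => qPoch E q (x.1 + x.2) * F ^ (x.1 + x.2) *
    (s ^ x.2 / qPoch q q x.2 * cauchyCoeff q s t β A x.1) with hf
  have hfs : Summable f := by
    have g1 := (summable_geometric_of_lt_one (norm_nonneg _) ht).mul_left (M₁ * M₂ * M)
    have g2 := summable_geometric_of_lt_one (norm_nonneg _) hs
    refine (g1.mul_of_nonneg g2 (fun _ => by positivity) (fun _ => by positivity)).of_norm_bounded
      fun x => ?_
    simp only [hf, div_eq_mul_inv, norm_mul, norm_pow]
    calc _ ≤ M₁ * ‖F‖ ^ (x.1 + x.2) * (‖s‖ ^ x.2 * M₂ * (M * ‖t‖ ^ x.1)) := by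
          gcongr
          · exact h₁ E le_rfl _
          · exact h₂ _
          · exact hb _
      _ = _ := by ring
  have h1 : HasSum (fun k => ∑ x ∈ Finset.HasAntidiagonal.antidiagonal k, f x) (∑' x, f x) := by
    have := (Finset.HasAntidiagonal.sigmaAntidiagonalEquivProd.hasSum_iff.2 hfs.hasSum).sigma
      fun k => hasSum_fintype _
    convert this using 2 with k
    rw [← Finset.sum_coe_sort]
    rfl
  have h2 : ∑' x, f x = (qPochInf (F * s) q)⁻¹ *
      ∑' j, qPoch E q j * F ^ j * cauchyCoeff q s t β A j * qPochInf (E * F * s * q ^ j) q := by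
    rw [hfs.tsum_prod, ← tsum_mul_left]
    refine tsum_congr fun j => ?_
    have hb := (hasSum_qBinomial hq (E * q ^ j) hs).mul_left
      (qPoch E q j * F ^ j * cauchyCoeff q s t β A j)
    rw [show E * q ^ j * (F * s) = E * F * s * q ^ j by ring] at hb
    calc ∑' m, f (j, m) = ∑' m, qPoch E q j * F ^ j * cauchyCoeff q s t β A j *
          (qPoch (E * q ^ j) q m / qPoch q q m * (F * s) ^ m) := by
          refine tsum_congr fun m => ?_
          simp only [hf]
          rw [qPoch_add, pow_add, mul_pow]
          ring
      _ = _ := by rw [hb.tsum_eq]; ring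
  rw [← h2]
  refine h1.congr_fun fun k => ?_
  rw [cauchyDeriv, Finset.mul_sum]
  refine Finset.sum_congr rfl fun x hx => ?_
  simp only [hf]
  rw [Finset.HasAntidiagonal.mem_antidiagonal.1 hx]

/-- The part of the integrand independent of the variable in which the Cauchy operator acts. -/
noncomputable def baseWeight (q p B C x : ℂ) : ℂ :=
  x * (qPochInf (q * x) q * qPochInf (q / p * x) q / (qPochInf (B * x) q * qPochInf (C * x) q))

/-- `A`-side of the extended sum: the image of the `q`-Saalschütz weight under the Cauchy
operator. -/
noncomputable def extWeight (q p A B C E F x : ℂ) : ℂ :=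
  baseWeight q p B C x * ((qPochInf (F * x) q)⁻¹ *
    ∑' j, qPoch E q j * F ^ j * cauchyCoeff q x (p * C) (B * x) A j *
      qPochInf (E * F * x * q ^ j) q)

/-- Uniform bound that allows the interchange of the sum over the points `y q ^ n` with the
Cauchy operator. -/
lemma exists_norm_baseWeight_mul_cauchyDeriv_le (hq : ‖q‖ < 1) {p A B C F y : ℂ}
    (hy : ‖F * y‖ < 1) (hF : ‖F * (p * C)‖ < 1) :
    ∃ M ρ : ℝ, 0 ≤ ρ ∧ ρ < 1 ∧ ∀ n k : ℕ, ‖baseWeight q p B C (y * q ^ n) *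
      (F ^ k * cauchyDeriv q (y * q ^ n) (p * C) (B * (y * q ^ n)) A k)‖ ≤
        M * ‖q‖ ^ n * ((k + 1) * ρ ^ k) := by
  have hpow : ∀ n : ℕ, ‖q‖ ^ n ≤ 1 := fun n => pow_le_one₀ (norm_nonneg _) hq.le
  have hle : ∀ (a : ℂ) (n : ℕ), ‖a * q ^ n‖ ≤ ‖a‖ := fun a n => by
    rw [norm_mul, norm_pow]
    exact mul_le_of_le_one_right (norm_nonneg _) (hpow n)
  obtain ⟨K, hK⟩ := exists_norm_inv_qPochInf_le hq A y
  obtain ⟨KB, hKB⟩ := exists_norm_inv_qPochInf_le hq B y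
  obtain ⟨KC, hKC⟩ := exists_norm_inv_qPochInf_le hq C y
  obtain ⟨M, pM, hM⟩ := exists_norm_cauchyCoeff_le hq (max ‖B * y‖ ‖A * (B * y) * (p * C)‖) K
  obtain ⟨M₂, p₂, h₂⟩ := exists_norm_inv_qPoch_self_le hq
  obtain ⟨M₃, p₃, h₃⟩ := exists_norm_qPochInf_le hq (max ‖q * y‖ ‖q / p * y‖)
  have hKB0 := (norm_nonneg _).trans (hKB 0)
  have hKC0 := (norm_nonneg _).trans (hKC 0)
  set ρ := max ‖F * y‖ ‖F * (p * C)‖ with hρ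
  have hρ0 : 0 ≤ ρ := (norm_nonneg _).trans (le_max_left _ _)
  refine ⟨‖y‖ * (M₃ * M₃ * (KB * KC)) * (M₂ * M), ρ, hρ0, max_lt hy hF, fun n k => ?_⟩
  have hb := hM (y * q ^ n) (p * C) (B * (y * q ^ n)) A
    (by rw [← mul_assoc]; exact (hle _ _).trans (le_max_left _ _))
    (by rw [show A * (B * (y * q ^ n)) * (p * C) = A * (B * y) * (p * C) * q ^ n by ring]
        exact (hle _ _).trans (le_max_right _ _))
    (fun j => by
      rw [show A * (y * q ^ n) * q ^ j = A * (y * q ^ (n + j)) by ring]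
      exact hK _)
  have hbase : ‖baseWeight q p B C (y * q ^ n)‖ ≤ ‖y‖ * (M₃ * M₃ * (KB * KC)) * ‖q‖ ^ n := by
    rw [baseWeight, div_eq_mul_inv, mul_inv]
    simp only [norm_mul, norm_pow]
    have a1 : ‖qPochInf (q * (y * q ^ n)) q‖ ≤ M₃ := h₃ _ (by
      rw [← mul_assoc]; exact (hle _ _).trans (le_max_left _ _))
    have a2 : ‖qPochInf (q / p * (y * q ^ n)) q‖ ≤ M₃ := h₃ _ (by
      rw [← mul_assoc]; exact (hle _ _).trans (le_max_right _ _))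
    calc _ ≤ ‖y‖ * ‖q‖ ^ n * (M₃ * M₃ * (KB * KC)) := by
          gcongr
          · exact hKB n
          · exact hKC n
      _ = _ := by ring
  have hder : ‖F ^ k * cauchyDeriv q (y * q ^ n) (p * C) (B * (y * q ^ n)) A k‖ ≤
      M₂ * M * ((k + 1) * ρ ^ k) := by
    rw [cauchyDeriv, Finset.mul_sum]
    refine (norm_sum_le_of_le (n := fun _ => M₂ * M * ρ ^ k) _ fun x hx => ?_).trans ?_
    · have hx' := Finset.HasAntidiagonal.mem_antidiagonal.1 hx
      rw [← hx', pow_add F]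
      simp only [div_eq_mul_inv, norm_mul, norm_pow]
      calc _ ≤ ‖F‖ ^ x.1 * ‖F‖ ^ x.2 * ((‖y‖ * 1) ^ x.2 * M₂ * (M * ‖p * C‖ ^ x.1)) := by
            gcongr
            · exact hpow n
            · exact h₂ _
            · exact hb _
        _ = M₂ * M * (‖F * (p * C)‖ ^ x.1 * ‖F * y‖ ^ x.2) := by
            rw [norm_mul F, norm_mul F]; ring
        _ ≤ M₂ * M * (ρ ^ x.1 * ρ ^ x.2) := by
            gcongr
            · exact le_max_right _ _
            · exact le_max_left _ _
        _ = _ := by rw [← pow_add]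
    · simp [Finset.Nat.card_antidiagonal]
      exact le_of_eq (by ring)
  rw [norm_mul]
  calc _ ≤ ‖y‖ * (M₃ * M₃ * (KB * KC)) * ‖q‖ ^ n * (M₂ * M * ((k + 1) * ρ ^ k)) := by gcongr
    _ = _ := by ring

lemma summable_succ_mul_geometric {ρ : ℝ} (h0 : 0 ≤ ρ) (h1 : ρ < 1) :
    Summable fun k : ℕ => ((k : ℝ) + 1) * ρ ^ k := by
  have a := summable_pow_mul_geometric_of_norm_lt_one 1
    (r := ρ) (by rwa [Real.norm_of_nonneg h0])
  refine (a.add (summable_geometric_of_lt_one h0 h1)).congr fun k => ?_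
  ring

lemma summable_baseWeight_mul_cauchyDeriv (hq : ‖q‖ < 1) (p A B C y : ℂ) (k : ℕ) :
    Summable fun n : ℕ => baseWeight q p B C (y * q ^ n) *
      cauchyDeriv q (y * q ^ n) (p * C) (B * (y * q ^ n)) A k := by
  -- a nonzero `F` so small that the uniform bound applies
  obtain ⟨δ, hδ, hδ'⟩ : ∃ δ : ℝ, 0 < δ ∧ δ * (‖y‖ + ‖p * C‖ + 1) = 1 / 2 :=
    ⟨1 / 2 / (‖y‖ + ‖p * C‖ + 1), by positivity, by field_simp⟩
  have hδn : ‖(δ : ℂ)‖ = δ := by simp [abs_of_pos hδ]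
  have hb : ∀ z : ℂ, ‖z‖ ≤ ‖y‖ + ‖p * C‖ + 1 → ‖(δ : ℂ) * z‖ < 1 := fun z hz => by
    rw [norm_mul, hδn]
    nlinarith
  obtain ⟨M, ρ, -, -, h⟩ := exists_norm_baseWeight_mul_cauchyDeriv_le hq (p := p) (A := A) (B := B)
    (C := C) (F := (δ : ℂ)) (y := y) (hb y (by linarith [norm_nonneg (p * C)]))
    (hb (p * C) (by linarith [norm_nonneg y]))
  have hs : Summable fun n : ℕ => baseWeight q p B C (y * q ^ n) *
      ((δ : ℂ) ^ k * cauchyDeriv q (y * q ^ n) (p * C) (B * (y * q ^ n)) A k) :=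
    (((summable_geometric_of_lt_one (norm_nonneg _) hq).mul_left M).mul_right
      (((k : ℝ) + 1) * ρ ^ k)).of_norm_bounded fun n => h n k
  refine (hs.mul_left ((δ : ℂ) ^ k)⁻¹).congr fun n => ?_
  have : (δ : ℂ) ^ k ≠ 0 := by
    have : (δ : ℂ) ≠ 0 := by exact_mod_cast hδ.ne'
    positivity
  field_simp

/-- The sum of the extended weight along one geometric sequence, with the Cauchy operator taken
out. -/
lemma hasSum_extWeight (hq : ‖q‖ < 1) {p A B C E F y : ℂ}
    (hy : ‖F * y‖ < 1) (hF : ‖F * (p * C)‖ < 1) :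
    Summable (fun n : ℕ => extWeight q p A B C E F (y * q ^ n)) ∧
    HasSum (fun k : ℕ => qPoch E q k * F ^ k * ∑' n : ℕ, baseWeight q p B C (y * q ^ n) *
      cauchyDeriv q (y * q ^ n) (p * C) (B * (y * q ^ n)) A k)
      (∑' n : ℕ, extWeight q p A B C E F (y * q ^ n)) := by
  obtain ⟨M, ρ, hρ0, hρ1, h⟩ := exists_norm_baseWeight_mul_cauchyDeriv_le hq (p := p) (A := A)
    (B := B) (C := C) hy hF
  obtain ⟨M₁, p₁, h₁⟩ := exists_norm_qPoch_le hq ‖E‖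
  set f : ℕ × ℕ → ℂ := fun x => baseWeight q p B C (y * q ^ x.1) * (qPoch E q x.2 * F ^ x.2 *
    cauchyDeriv q (y * q ^ x.1) (p * C) (B * (y * q ^ x.1)) A x.2) with hf
  have hM0 : 0 ≤ M := by
    have := (norm_nonneg _).trans (h 0 0)
    simpa using this
  have hfs : Summable f := by
    have g1 := (summable_geometric_of_lt_one (norm_nonneg _) hq).mul_left (M₁ * M)
    have g2 := summable_succ_mul_geometric hρ0 hρ1
    refine (g1.mul_of_nonneg g2 (fun _ => by positivity) (fun _ => by positivity)).of_norm_bounded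
      fun x => ?_
    have e : f x = qPoch E q x.2 * (baseWeight q p B C (y * q ^ x.1) * (F ^ x.2 *
      cauchyDeriv q (y * q ^ x.1) (p * C) (B * (y * q ^ x.1)) A x.2)) := by
      simp only [hf]; ring
    rw [e, norm_mul]
    calc _ ≤ M₁ * (M * ‖q‖ ^ x.1 * ((x.2 + 1) * ρ ^ x.2)) := by
          gcongr
          · exact h₁ E le_rfl _
          · exact h _ _
      _ = _ := by ring
  have hinner : ∀ n : ℕ, ∑' k, f (n, k) = extWeight q p A B C E F (y * q ^ n) := fun n => by
    have hyn : ‖F * (y * q ^ n)‖ < 1 := by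
      rw [← mul_assoc, norm_mul, norm_pow]
      exact (mul_le_of_le_one_right (norm_nonneg _)
        (pow_le_one₀ (norm_nonneg _) hq.le)).trans_lt hy
    exact ((hasSum_cauchyDeriv hq (E := E) (β := B * (y * q ^ n)) (A := A) hyn hF).mul_left
      (baseWeight q p B C (y * q ^ n))).tsum_eq
  have hsum := hfs.hasSum.prod_fiberwise fun n => (hfs.prod_factor n).hasSum
  simp only [hinner] at hsum
  refine ⟨hsum.summable, ?_⟩
  rw [hsum.tsum_eq]
  have h2 := ((Equiv.prodComm ℕ ℕ).hasSum_iff.2 hfs.hasSum)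
  have h3 := h2.prod_fiberwise fun k => (h2.summable.prod_factor k).hasSum
  refine h3.congr_fun fun k => ?_
  rw [← tsum_mul_left]
  refine tsum_congr fun n => ?_
  simp only [hf, Function.comp, Equiv.prodComm_apply, Prod.swap]
  ring

/-- Both sides of the `q`-Saalschütz sum have the same `q`-derivatives in `A`. -/
lemma jacksonDiff_baseWeight_mul_cauchyDeriv (hq : ‖q‖ < 1) (hq0 : q ≠ 0) {p B C : ℂ} (hp : p ≠ 0)
    (hB : NoPole q p B) (hC : NoPole q p C) (k : ℕ) : ∀ A : ℂ, A ≠ 0 → NoPole q p A →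
    jacksonDiff q p (fun x => baseWeight q p B C x * cauchyDeriv q x (p * C) (B * x) A k) =
      qPochInf q q * qPochInf (q / p) q * qPochInf p q * qPochInf (p * B * C) q *
        qPochInf (p * A * C) q /
        (qPochInf B q * qPochInf C q * qPochInf (p * B) q * qPochInf (p * C) q *
          qPochInf (p * A) q) * cauchyDeriv q 1 p B A k := by
  induction k with
  | zero =>
    intro A _ hA
    have h := jacksonDiff_saalWeight hq hp hA hB hC
    have e : saalWeight q p A B C =
        fun x => baseWeight q p B C x * cauchyDeriv q x (p * C) (B * x) A 0 := by
      funext x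
      rw [cauchyDeriv_zero, saalWeight, baseWeight,
        show A * (B * x) * (p * C) = p * A * B * C * x by ring]
      simp only [div_eq_mul_inv, mul_inv]
      ring
    rw [← e, h, cauchyDeriv_zero, mul_one, show A * B * p = p * A * B by ring]
    simp only [div_eq_mul_inv, mul_inv]
    ring
  | succ k ih =>
    intro A hA0 hA
    have hAq : NoPole q p (A * q) := by simpa using hA.mul_pow 1
    have i1 := ih A hA0 hA
    have i2 := ih (A * q) (mul_ne_zero hA0 hq0) hAq
    have hk : 1 - q ^ (k + 1) ≠ 0 := fun hk =>
      mul_pow_ne_one_of_norm_lt_one hq hq k (by rw [← pow_succ']; linear_combination -hk)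
    have hfac : (1 - q ^ (k + 1)) * A ≠ 0 := mul_ne_zero hk hA0
    have r1 := cauchyDeriv_succ hq (s := 1) (t := p) (β := B) (A := A)
      (fun j => by simpa using (hA j).1) k
    have hL : (1 - q ^ (k + 1)) * A * jacksonDiff q p
        (fun x => baseWeight q p B C x * cauchyDeriv q x (p * C) (B * x) A (k + 1)) =
        jacksonDiff q p (fun x => baseWeight q p B C x * cauchyDeriv q x (p * C) (B * x) A k) -
        (1 - p * A * C) * jacksonDiff q p
          (fun x => baseWeight q p B C x * cauchyDeriv q x (p * C) (B * x) (A * q) k) := by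
      have hy : ∀ y : ℂ, (y = 1 ∨ y = p) → (1 - q ^ (k + 1)) * A * ∑' n : ℕ,
          baseWeight q p B C (y * q ^ n) *
            cauchyDeriv q (y * q ^ n) (p * C) (B * (y * q ^ n)) A (k + 1) =
          ∑' n : ℕ, baseWeight q p B C (y * q ^ n) *
            cauchyDeriv q (y * q ^ n) (p * C) (B * (y * q ^ n)) A k -
          (1 - p * A * C) * ∑' n : ℕ, baseWeight q p B C (y * q ^ n) *
            cauchyDeriv q (y * q ^ n) (p * C) (B * (y * q ^ n)) (A * q) k := fun y hy => by
        rw [← tsum_mul_left, ← tsum_mul_left,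
          ← (summable_baseWeight_mul_cauchyDeriv hq p A B C y k).tsum_sub
            ((summable_baseWeight_mul_cauchyDeriv hq p (A * q) B C y k).mul_left _)]
        refine tsum_congr fun n => ?_
        have := cauchyDeriv_succ hq (s := y * q ^ n) (t := p * C) (β := B * (y * q ^ n)) (A := A)
          (fun j => by
            have := hA.ne_one hy (n + j)
            rwa [pow_add, ← mul_assoc, mul_assoc A y] at this) k
        linear_combination baseWeight q p B C (y * q ^ n) * this
      have h1 := hy 1 (.inl rfl)
      have h2 := hy p (.inr rfl)
      simp only [one_mul] at h1
      simp only [jacksonDiff]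
      linear_combination h1 - h2
    refine mul_left_cancel₀ hfac ?_
    rw [hL, i1, i2, mul_left_comm (_ * A), r1]
    have hpA : qPochInf (p * A) q ≠ 0 := qPochInf_ne_zero hq fun n => (hA n).2
    have s1 := qPochInf_step hq (p * A)
    have s2 := qPochInf_step hq (p * A * C)
    rw [s1] at hpA
    rw [s1, s2, show p * (A * q) = p * A * q by ring, show p * A * q * C = p * A * C * q by ring]
    have n1 := left_ne_zero_of_mul hpA
    have n2 := right_ne_zero_of_mul hpA
    have b1 : qPochInf B q ≠ 0 := qPochInf_ne_zero hq fun n => (hB n).1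
    have b2 : qPochInf (p * B) q ≠ 0 := qPochInf_ne_zero hq fun n => (hB n).2
    have c1 : qPochInf C q ≠ 0 := qPochInf_ne_zero hq fun n => (hC n).1
    have c2 : qPochInf (p * C) q ≠ 0 := qPochInf_ne_zero hq fun n => (hC n).2
    generalize qPochInf (p * A * q) q = P at *
    generalize hpa : 1 - p * A = a at *
    rw [show A * p = p * A by ring, hpa]
    field_simp

/-- The extended nonterminating `q`-Saalschütz sum. -/
theorem jacksonDiff_extWeight (hq : ‖q‖ < 1) (hq0 : q ≠ 0) {p A B C E F : ℂ} (hp : p ≠ 0)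
    (hA0 : A ≠ 0) (hA : NoPole q p A) (hB : NoPole q p B) (hC : NoPole q p C)
    (hF : ‖F‖ < 1) (hFp : ‖F * p‖ < 1) (hFC : ‖F * (p * C)‖ < 1) :
    jacksonDiff q p (extWeight q p A B C E F) =
      qPochInf q q * qPochInf (q / p) q * qPochInf p q * qPochInf (p * B * C) q *
        qPochInf (p * A * C) q /
        (qPochInf B q * qPochInf C q * qPochInf (p * B) q * qPochInf (p * C) q *
          qPochInf (p * A) q) * ((qPochInf F q)⁻¹ *
        ∑' j, qPoch E q j * F ^ j * cauchyCoeff q 1 p B A j * qPochInf (E * F * q ^ j) q) := by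
  have h1 := (hasSum_extWeight hq (p := p) (A := A) (B := B) (E := E) (y := 1) (by simpa) hFC).2
  have h2 := (hasSum_extWeight hq (p := p) (A := A) (B := B) (E := E) (y := p) hFp hFC).2
  simp only [one_mul] at h1
  have h3 := h1.sub h2
  have h4 := (hasSum_cauchyDeriv hq (E := E) (F := F) (s := 1) (t := p) (β := B) (A := A)
    (by simpa) hFp).mul_left (qPochInf q q * qPochInf (q / p) q * qPochInf p q *
      qPochInf (p * B * C) q * qPochInf (p * A * C) q /
        (qPochInf B q * qPochInf C q * qPochInf (p * B) q * qPochInf (p * C) q *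
          qPochInf (p * A) q))
  simp only [mul_one] at h4
  refine h3.unique (h4.congr_fun fun k => ?_)
  have := jacksonDiff_baseWeight_mul_cauchyDeriv hq hq0 hp hB hC k A hA0 hA
  rw [mul_left_comm, ← this, jacksonDiff]
  ring

end Cauchy

/-! ### The integrand as a function of `q ^ s` -/

section IntegrandSeries

variable {q : ℂ}

/-- The entire function of `x` obtained from the `₃φ₂` series in the integrand by multiplication
with the denominators `(S x, H x; q)_∞`. -/
noncomputable def extSeries (q A B E S H z x : ℂ) : ℂ :=
  ∑' j : ℕ, qPoch E q j * qPoch (A * x) q j * qPoch (B * x) q j / qPoch q q j *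
    (qPochInf (S * x * q ^ j) q * qPochInf (H * x * q ^ j) q) * z ^ j

lemma differentiable_qPoch (q : ℂ) (n : ℕ) : Differentiable ℂ fun a => qPoch a q n := by
  unfold qPoch
  fun_prop

lemma differentiable_extSeries (hq : ‖q‖ < 1) (A B E S H : ℂ) {z : ℂ} (hz : ‖z‖ < 1) :
    Differentiable ℂ (extSeries q A B E S H z) := by
  intro x₀
  set r := ‖x₀‖ + 1
  have hx₀ : x₀ ∈ Metric.ball (0 : ℂ) r := by simp [r]
  obtain ⟨M₁, p₁, h₁⟩ := exists_norm_qPoch_le hq (max ‖E‖ (max (‖A‖ * r) (‖B‖ * r)))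
  obtain ⟨M₂, p₂, h₂⟩ := exists_norm_inv_qPoch_self_le hq
  obtain ⟨M₃, p₃, h₃⟩ := exists_norm_qPochInf_le hq (max (‖S‖ * r) (‖H‖ * r))
  have hle : ∀ (a : ℂ) (n : ℕ), ‖a * q ^ n‖ ≤ ‖a‖ := fun a n => by
    rw [norm_mul, norm_pow]
    exact mul_le_of_le_one_right (norm_nonneg _) (pow_le_one₀ (norm_nonneg _) hq.le)
  have hd := differentiable_qPochInf hq
  refine DifferentiableOn.differentiableAt (s := Metric.ball (0 : ℂ) r) ?_
    (Metric.isOpen_ball.mem_nhds hx₀)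
  refine Complex.differentiableOn_tsum_of_summable_norm
    (u := fun j => M₁ * M₁ * M₁ * M₂ * (M₃ * M₃) * ‖z‖ ^ j)
    ((summable_geometric_of_lt_one (norm_nonneg _) hz).mul_left _) (fun j => ?_)
    Metric.isOpen_ball fun j x hx => ?_
  · have e1 : Differentiable ℂ fun x : ℂ => qPoch (A * x) q j :=
      (differentiable_qPoch q j).comp (differentiable_id.const_mul A)
    have e2 : Differentiable ℂ fun x : ℂ => qPoch (B * x) q j :=
      (differentiable_qPoch q j).comp (differentiable_id.const_mul B)
    have e3 : Differentiable ℂ fun x : ℂ => qPochInf (S * x * q ^ j) q :=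
      hd.comp ((differentiable_id.const_mul S).mul_const _)
    have e4 : Differentiable ℂ fun x : ℂ => qPochInf (H * x * q ^ j) q :=
      hd.comp ((differentiable_id.const_mul H).mul_const _)
    exact ((((e1.const_mul _).mul e2).div_const _ |>.mul (e3.mul e4)).mul_const _).differentiableOn
  · have hxr : ‖x‖ ≤ r := (mem_ball_zero_iff.1 hx).le
    have hm : ∀ a : ℂ, ‖a * x‖ ≤ ‖a‖ * r := fun a => by
      rw [norm_mul]; gcongr
    rw [div_eq_mul_inv]
    simp only [norm_mul, norm_pow]
    gcongr
    · exact h₁ _ (le_max_left _ _) _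
    · exact h₁ _ ((hm A).trans ((le_max_left _ _).trans (le_max_right _ _))) _
    · exact h₁ _ ((hm B).trans ((le_max_right _ _).trans (le_max_right _ _))) _
    · exact h₂ _
    · exact h₃ _ ((hle _ _).trans ((hm S).trans (le_max_left _ _)))
    · exact h₃ _ ((hle _ _).trans ((hm H).trans (le_max_right _ _)))

lemma basicHypergeometric_three_two (a₁ a₂ a₃ b₁ b₂ q z : ℂ) :
    basicHypergeometric [a₁, a₂, a₃] [b₁, b₂] q z = ∑' k : ℕ, qPoch a₁ q k * qPoch a₂ q k *
      qPoch a₃ q k / (qPoch q q k * qPoch b₁ q k * qPoch b₂ q k) * z ^ k := by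
  simp [basicHypergeometric, qPochs, mul_assoc]

/-- Where the `₃φ₂` series has no vanishing denominators, `extSeries` is its product with
`(S x, H x; q)_∞`. -/
lemma mul_basicHypergeometric (hq : ‖q‖ < 1) (A B E z x : ℂ) {S H : ℂ}
    (hS : ∀ k : ℕ, S * x * q ^ k ≠ 1) (hH : ∀ k : ℕ, H * x * q ^ k ≠ 1) :
    qPochInf (S * x) q * qPochInf (H * x) q *
      basicHypergeometric [E, A * x, B * x] [H * x, S * x] q z = extSeries q A B E S H z x := by
  rw [basicHypergeometric_three_two, extSeries, ← tsum_mul_left]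
  refine tsum_congr fun j => ?_
  rw [qPochInf_eq_qPoch_mul hq (S * x) j, qPochInf_eq_qPoch_mul hq (H * x) j]
  have h1 := qPoch_ne_zero hS j
  have h2 := qPoch_ne_zero hH j
  have h3 := qPoch_self_ne_zero hq j
  generalize qPoch (S * x) q j = P at *
  generalize qPoch (H * x) q j = R at *
  field_simp

/-- The denominator of the integrand as a function of `x = q ^ s`. -/
noncomputable def poleProduct (q A B C F x : ℂ) : ℂ :=
  qPochInf (A * x) q * qPochInf (B * x) q * qPochInf (C * x) q * qPochInf (F * x) q

/-- The integrand without the two cosecants, the factor `x = q ^ s` and the zeros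
`(q x, q ^ d x; q)_∞` that cancel poles of the cosecants. -/
noncomputable def extKernel (q A B C E F S z x : ℂ) : ℂ :=
  extSeries q A B E S (E * F) z x / poleProduct q A B C F x

lemma extWeight_eq (hq : ‖q‖ < 1) (p A B C E F x : ℂ) (hA : ∀ k : ℕ, A * x * q ^ k ≠ 1) :
    extWeight q p A B C E F x = x * (qPochInf (q * x) q * qPochInf (q / p * x) q) *
      extKernel q A B C E F (p * A * B * C) (p * C * F) x := by
  have h : ∑' j, qPoch E q j * F ^ j * cauchyCoeff q x (p * C) (B * x) A j *
      qPochInf (E * F * x * q ^ j) q = (qPochInf (A * x) q)⁻¹ *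
        extSeries q A B E (p * A * B * C) (E * F) (p * C * F) x := by
    rw [extSeries, ← tsum_mul_left]
    refine tsum_congr fun j => ?_
    have h0 := qPochInf_ne_zero hq hA
    rw [qPochInf_eq_qPoch_mul hq (A * x) j] at h0 ⊢
    have h1 := left_ne_zero_of_mul h0
    have h2 := right_ne_zero_of_mul h0
    rw [cauchyCoeff, show A * (B * x) * (p * C) * q ^ j = p * A * B * C * x * q ^ j by ring]
    simp only [mul_pow]
    generalize qPochInf (A * x * q ^ j) q = P at *
    generalize qPoch (A * x) q j = R at *
    field_simp
  rw [extWeight, h, baseWeight, extKernel, poleProduct]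
  simp only [div_eq_mul_inv, mul_inv]
  ring

/-- The extended `q`-Saalschütz sum with the right-hand side in its final form. -/
theorem jacksonDiff_extKernel (hq : ‖q‖ < 1) (hq0 : q ≠ 0) {p A B C E F : ℂ} (hp : p ≠ 0)
    (hA0 : A ≠ 0) (hA : NoPole q p A) (hB : NoPole q p B) (hC : NoPole q p C)
    (hF : ‖F‖ < 1) (hFp : ‖p * F‖ < 1) (hFC : ‖p * C * F‖ < 1)
    (hEF : ∀ k : ℕ, E * F * q ^ k ≠ 1) (hAB : ∀ k : ℕ, p * A * B * q ^ k ≠ 1) :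
    jacksonDiff q p (fun x => x * (qPochInf (q * x) q * qPochInf (q / p * x) q) *
      extKernel q A B C E F (p * A * B * C) (p * C * F) x) =
      qPochInfs [q, q / p, p, p * B * C, p * A * C, p * A * B, E * F] q /
        qPochInfs [A, B, C, F, p * A, p * B, p * C] q *
        basicHypergeometric [A, B, E] [E * F, p * A * B] q (p * F) := by
  have h := jacksonDiff_extWeight hq hq0 (E := E) hp hA0 hA hB hC hF
    (by rwa [mul_comm]) (by rwa [mul_comm])
  have e : jacksonDiff q p (extWeight q p A B C E F) =
      jacksonDiff q p (fun x => x * (qPochInf (q * x) q * qPochInf (q / p * x) q) *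
      extKernel q A B C E F (p * A * B * C) (p * C * F) x) := by
    rw [jacksonDiff, jacksonDiff]
    congr 1
    · refine tsum_congr fun n => extWeight_eq hq _ _ _ _ _ _ _ fun k => ?_
      rw [mul_assoc, ← pow_add]
      exact (hA _).1
    · refine tsum_congr fun n => extWeight_eq hq _ _ _ _ _ _ _ fun k => ?_
      rw [← mul_assoc, mul_assoc, ← pow_add, mul_comm A]
      exact (hA _).2
  have hser : ∑' j, qPoch E q j * F ^ j * cauchyCoeff q 1 p B A j * qPochInf (E * F * q ^ j) q =
      (qPochInf (A * 1) q)⁻¹ * (qPochInf (p * A * B * 1) q * qPochInf (E * F * 1) q *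
        basicHypergeometric [E, A * 1, B * 1] [E * F * 1, p * A * B * 1] q (p * F)) := by
    rw [mul_basicHypergeometric hq A B E _ 1 (by simpa using hAB) (by simpa using hEF), extSeries,
      ← tsum_mul_left]
    refine tsum_congr fun j => ?_
    have h0 : qPochInf A q ≠ 0 := qPochInf_ne_zero hq fun n => (hA n).1
    rw [mul_one, mul_one, mul_one, mul_one]
    rw [qPochInf_eq_qPoch_mul hq A j] at h0 ⊢
    have h1 := left_ne_zero_of_mul h0
    have h2 := right_ne_zero_of_mul h0
    rw [cauchyCoeff, mul_pow, mul_one, show A * B * p * q ^ j = p * A * B * q ^ j by ring]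
    generalize qPochInf (A * q ^ j) q = P at *
    field_simp
  have hperm : basicHypergeometric [E, A, B] [E * F, p * A * B] q (p * F) =
      basicHypergeometric [A, B, E] [E * F, p * A * B] q (p * F) := by
    rw [basicHypergeometric_three_two, basicHypergeometric_three_two]
    refine tsum_congr fun j => ?_
    ring
  rw [← e, h, hser]
  simp only [mul_one, hperm, qPochInfs, List.map_cons, List.map_nil, List.prod_cons, List.prod_nil,
    div_eq_mul_inv, mul_inv]
  ring

end IntegrandSeries

/-! ### Integrals along contours and the index -/

section Contour

open Complex MeasureTheory Set

lemma intervalIntegrable_mul_deriv {c : ℝ → ℂ} (hb : ∃ C : ℝ, ∀ t, ‖deriv c t‖ ≤ C) {f : ℝ → ℂ}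
    {a b : ℝ} (hf : ContinuousOn f (uIcc a b)) :
    IntervalIntegrable (fun t => f t * deriv c t) volume a b := by
  obtain ⟨C, hC⟩ := hb
  refine IntervalIntegrable.continuousOn_mul ?_ hf
  rw [intervalIntegrable_iff]
  exact Measure.integrableOn_of_bounded (M := C) measure_Ioc_lt_top.ne
    (measurable_deriv c).aestronglyMeasurable (Eventually.of_forall hC)

/-- The integral of a function with a primitive along a piecewise differentiable path. -/
lemma integral_comp_mul_deriv_of_primitive {c : ℝ → ℂ} (hc : Continuous c)
    (hd : ∃ S : Finset ℝ, ∀ t ∉ S, DifferentiableAt ℝ c t) (hb : ∃ C : ℝ, ∀ t, ‖deriv c t‖ ≤ C)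
    {U : Set ℂ} (hU : IsOpen U) {h G : ℂ → ℂ} (hG : ∀ z ∈ U, HasDerivAt G (h z) z) {a b : ℝ}
    (hcU : ∀ t ∈ uIcc a b, c t ∈ U) :
    ∫ t in a..b, h (c t) * deriv c t = G (c b) - G (c a) := by
  obtain ⟨S, hS⟩ := hd
  have hGd : DifferentiableOn ℂ G U := fun z hz => (hG z hz).differentiableAt.differentiableWithinAt
  have hh : ContinuousOn h U := (hGd.deriv hU).continuousOn.congr fun z hz => (hG z hz).deriv.symm
  refine integral_eq_of_hasDerivAt_off_countable (fun t => G (c t)) _ (s := S) S.countable_toSet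
    (hGd.continuousOn.comp hc.continuousOn hcU) (fun t ht => ?_)
    (intervalIntegrable_mul_deriv hb (hh.comp hc.continuousOn hcU))
  have h1 := hG (c t) (hcU t (Ioo_subset_Icc_self ht.1))
  have h2 := (hS t (by simpa using ht.2)).hasDerivAt
  exact h1.comp_of_eq t h2 rfl

lemma IsVerticalContour.differentiableAt {γ : ℝ → ℂ} (hγ : IsVerticalContour γ) :
    ∃ S : Finset ℝ, ∀ t ∉ S, DifferentiableAt ℝ γ t := by
  obtain ⟨S, hS⟩ := hγ.contDiffAt
  exact ⟨S, fun t ht => (hS t ht).differentiableAt one_ne_zero⟩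

/-- The contour `γ` coincides with the vertical lines `Re s = σ₁` and `Re s = σ₂` for parameters
below `-T₀` and above `T₀`, respectively. -/
structure HasEnds (γ : ℝ → ℂ) (σ₁ σ₂ T₀ : ℝ) : Prop where
  pos : 0 < T₀
  upper : ∀ t ≥ T₀, γ t = (σ₂ : ℂ) + (t : ℂ) * I
  upper_deriv : ∀ t ≥ T₀, deriv γ t = I
  lower : ∀ t ≤ -T₀, γ t = (σ₁ : ℂ) + (t : ℂ) * I
  lower_deriv : ∀ t ≤ -T₀, deriv γ t = I

lemma hasDerivAt_verticalLine (σ t : ℝ) :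
    HasDerivAt (fun t : ℝ => (σ : ℂ) + (t : ℂ) * I) I t := by
  simpa using ((hasDerivAt_id t).ofReal_comp.mul_const I).const_add (σ : ℂ)

lemma IsVerticalContour.exists_hasEnds {γ : ℝ → ℂ} (hγ : IsVerticalContour γ) :
    ∃ σ₁ σ₂ T₁ : ℝ, ∀ T₀ ≥ T₁, HasEnds γ σ₁ σ₂ T₀ := by
  obtain ⟨σ₂, Tu, hu⟩ := hγ.upper_end
  obtain ⟨σ₁, Tl, hl⟩ := hγ.lower_end
  refine ⟨σ₁, σ₂, |Tu| + |Tl| + 1, fun T₀ hT => ?_⟩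
  have a1 := abs_nonneg Tu
  have a2 := abs_nonneg Tl
  have a3 := le_abs_self Tu
  have a4 := neg_abs_le Tl
  refine ⟨by linarith, fun t ht => hu t (by linarith), fun t ht => ?_,
    fun t ht => hl t (by linarith), fun t ht => ?_⟩
  · have : γ =ᶠ[𝓝 t] fun t : ℝ => (σ₂ : ℂ) + (t : ℂ) * I :=
      (eventually_gt_nhds (show Tu < t by linarith)).mono fun s hs => hu s hs.le
    rw [this.deriv_eq, (hasDerivAt_verticalLine σ₂ t).deriv]
  · have : γ =ᶠ[𝓝 t] fun t : ℝ => (σ₁ : ℂ) + (t : ℂ) * I :=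
      (eventually_lt_nhds (show t < Tl by linarith)).mono fun s hs => hl s hs.le
    rw [this.deriv_eq, (hasDerivAt_verticalLine σ₁ t).deriv]

lemma isVerticalContour_verticalLine (σ : ℝ) :
    IsVerticalContour fun t : ℝ => (σ : ℂ) + (t : ℂ) * I where
  continuous := by fun_prop
  contDiffAt := ⟨∅, fun t _ => by
    exact (contDiff_const.add (ofRealCLM.contDiff.mul contDiff_const)).contDiffAt⟩
  bounded_deriv := ⟨1, fun t => by rw [(hasDerivAt_verticalLine σ t).deriv]; simp⟩
  upper_end := ⟨σ, 0, fun _ _ => rfl⟩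
  lower_end := ⟨σ, 0, fun _ _ => rfl⟩

lemma tendsto_log_sub_log (w₁ w₂ : ℂ) :
    Tendsto (fun T : ℝ => log (w₂ + T * I) - log (w₁ - T * I)) atTop (𝓝 (Real.pi * I)) := by
  have h0 : ∀ w : ℂ, Tendsto (fun T : ℝ => w / (T : ℂ)) atTop (𝓝 0) := fun w => by
    rw [tendsto_zero_iff_norm_tendsto_zero]
    have : Tendsto (fun T : ℝ => ‖w‖ / |T|) atTop (𝓝 0) :=
      tendsto_const_nhds.div_atTop tendsto_abs_atTop_atTop
    simpa using this
  have h1 : Tendsto (fun T : ℝ => log (w₂ / T + I)) atTop (𝓝 (log I)) :=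
    ((continuousAt_clog (by simp [mem_slitPlane_iff])).tendsto).comp (by
      simpa using (h0 w₂).add_const I)
  have h2 : Tendsto (fun T : ℝ => log (w₁ / T + -I)) atTop (𝓝 (log (-I))) :=
    ((continuousAt_clog (by simp [mem_slitPlane_iff])).tendsto).comp (by
      simpa using (h0 w₁).add_const (-I))
  have h3 := h1.sub h2
  rw [log_I, log_neg_I, show (Real.pi / 2 * I - -(Real.pi / 2) * I : ℂ) = Real.pi * I by ring] at h3
  refine h3.congr' ?_
  have n1 : ∀ᶠ T : ℝ in atTop, w₂ / T + I ≠ 0 := by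
    have : Tendsto (fun T : ℝ => w₂ / (T : ℂ) + I) atTop (𝓝 (0 + I)) := (h0 w₂).add_const I
    exact this.eventually_ne (by simp)
  have n2 : ∀ᶠ T : ℝ in atTop, w₁ / T + -I ≠ 0 := by
    have : Tendsto (fun T : ℝ => w₁ / (T : ℂ) + -I) atTop (𝓝 (0 + -I)) := (h0 w₁).add_const (-I)
    exact this.eventually_ne (by simp)
  filter_upwards [n1, n2, eventually_gt_atTop 0] with T e1 e2 hT
  have hT' : (T : ℂ) ≠ 0 := by exact_mod_cast hT.ne'
  have f1 : w₂ + T * I = (T : ℂ) * (w₂ / T + I) := by field_simp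
  have f2 : w₁ - T * I = (T : ℂ) * (w₁ / T + -I) := by field_simp; ring
  rw [f1, f2, log_ofReal_mul hT e1, log_ofReal_mul hT e2]
  ring

lemma truncatedIndex_eq (γ : ℝ → ℂ) (p : ℂ) (T : ℝ) :
    truncatedIndex γ p T = 1 / (2 * (Real.pi : ℂ) * I) *
      ∫ t in (-T)..T, (γ t - p)⁻¹ * deriv γ t := by
  rw [truncatedIndex]
  congr 2
  funext t
  rw [div_eq_inv_mul]

/-- If the horizontal ray from `p` to the left misses the contour, then `p` has index `1 / 2`. -/
lemma tendsto_truncatedIndex_of_left_ray {γ : ℝ → ℂ} (hγ : IsVerticalContour γ) {p : ℂ}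
    (hp : ∀ t, γ t - p ∈ slitPlane) :
    Tendsto (truncatedIndex γ p) atTop (𝓝 (1 / 2)) := by
  obtain ⟨σ₁, σ₂, T₁, hE⟩ := hγ.exists_hasEnds
  have hU : IsOpen {z : ℂ | z - p ∈ slitPlane} :=
    isOpen_slitPlane.preimage (continuous_id.sub continuous_const)
  have h := ((tendsto_log_sub_log (σ₁ - p) (σ₂ - p)).const_mul (1 / (2 * (Real.pi : ℂ) * I)))
  have hpi : (Real.pi : ℂ) ≠ 0 := by exact_mod_cast Real.pi_ne_zero
  rw [show 1 / (2 * (Real.pi : ℂ) * I) * (Real.pi * I) = 1 / 2 by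
    field_simp [I_ne_zero]] at h
  refine h.congr' ?_
  filter_upwards [eventually_ge_atTop T₁] with T hT
  have hE' := hE T hT
  rw [truncatedIndex_eq, integral_comp_mul_deriv_of_primitive hγ.continuous hγ.differentiableAt
    hγ.bounded_deriv hU (h := fun z => (z - p)⁻¹) (G := fun z => log (z - p)) (fun z hz => by
      simpa using ((hasDerivAt_id z).sub_const p).clog hz) (fun t _ => hp t),
    hE'.upper T le_rfl, hE'.lower (-T) le_rfl]
  push_cast
  ring_nf

/-- If the horizontal ray from `p` to the right misses the contour, then `p` has index `-1 / 2`. -/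
lemma tendsto_truncatedIndex_of_right_ray {γ : ℝ → ℂ} (hγ : IsVerticalContour γ) {p : ℂ}
    (hp : ∀ t, p - γ t ∈ slitPlane) :
    Tendsto (truncatedIndex γ p) atTop (𝓝 (-1 / 2)) := by
  obtain ⟨σ₁, σ₂, T₁, hE⟩ := hγ.exists_hasEnds
  have hU : IsOpen {z : ℂ | p - z ∈ slitPlane} :=
    isOpen_slitPlane.preimage (continuous_const.sub continuous_id)
  have h := ((tendsto_log_sub_log (p - σ₂) (p - σ₁)).const_mul (-(1 / (2 * (Real.pi : ℂ) * I))))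
  have hpi : (Real.pi : ℂ) ≠ 0 := by exact_mod_cast Real.pi_ne_zero
  rw [show -(1 / (2 * (Real.pi : ℂ) * I)) * (Real.pi * I) = -1 / 2 by
    field_simp [I_ne_zero]] at h
  refine h.congr' ?_
  filter_upwards [eventually_ge_atTop T₁] with T hT
  have hE' := hE T hT
  rw [truncatedIndex_eq, integral_comp_mul_deriv_of_primitive hγ.continuous hγ.differentiableAt
    hγ.bounded_deriv hU (h := fun z => (z - p)⁻¹) (G := fun z => log (p - z)) (fun z hz => by
      have := ((hasDerivAt_id z).const_sub p).clog hz
      have e : (z - p)⁻¹ = -1 / (p - z) := by rw [← neg_sub, ← one_div, div_neg, neg_div]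
      rw [e]
      exact this) (fun t _ => hp t),
    hE'.upper T le_rfl, hE'.lower (-T) le_rfl]
  push_cast
  ring_nf

/-- Points far up to the right of the upper half-line, and points far down to the right of the
lower half-line, have index `-1 / 2`. -/
lemma HasEnds.exists_tendsto_truncatedIndex {γ : ℝ → ℂ} (hγ : IsVerticalContour γ)
    {σ₁ σ₂ T₀ : ℝ} (hE : HasEnds γ σ₁ σ₂ T₀) :
    ∃ B : ℝ, ∀ p : ℂ, (B ≤ p.im ∧ σ₂ < p.re) ∨ (p.im ≤ -B ∧ σ₁ < p.re) →
      Tendsto (truncatedIndex γ p) atTop (𝓝 (-1 / 2)) := by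
  obtain ⟨B, hB⟩ := (isCompact_Icc (a := -T₀) (b := T₀)).exists_bound_of_continuousOn
    hγ.continuous.continuousOn
  refine ⟨|B| + T₀ + 1, fun p hp => tendsto_truncatedIndex_of_right_ray hγ fun t => ?_⟩
  rw [mem_slitPlane_iff]
  by_contra! hcon
  obtain ⟨h1, h2⟩ := hcon
  rw [sub_im, sub_eq_zero] at h2
  rw [sub_re] at h1
  have hT := hE.pos
  have hB0 := abs_nonneg B
  have hcases : t ≤ -T₀ ∨ t ∈ Icc (-T₀) T₀ ∨ T₀ ≤ t := by
    rcases le_total t (-T₀) with h | h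
    · exact .inl h
    · rcases le_total t T₀ with h' | h'
      · exact .inr (.inl ⟨h, h'⟩)
      · exact .inr (.inr h')
  rcases hcases with h | h | h
  · have e := hE.lower t h
    rw [e] at h1 h2
    simp at h1 h2
    rcases hp with hp | hp <;> linarith [hp.1, hp.2]
  · have e := (abs_im_le_norm (γ t)).trans ((hB t h).trans (le_abs_self B))
    rw [← h2, abs_le] at e
    rcases hp with hp | hp <;> linarith [hp.1, hp.2]
  · have e := hE.upper t h
    rw [e] at h1 h2
    simp at h1 h2
    rcases hp with hp | hp <;> linarith [hp.1, hp.2]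

/-- The integral of `h` over the closed path which follows `γ` from parameter `-T` to `T`, then the
horizontal line to `R + i T`, the vertical line down to `R - i T`, and the horizontal line back. -/
noncomputable def closedIntegral (γ : ℝ → ℂ) (σ₁ σ₂ R : ℝ) (h : ℂ → ℂ) (T : ℝ) : ℂ :=
  (∫ t in (-T)..T, h (γ t) * deriv γ t) + (∫ x in σ₂..R, h ((x : ℂ) + (T : ℂ) * I)) -
    I * (∫ y in (-T)..T, h ((R : ℂ) + (y : ℂ) * I)) -
    ∫ x in σ₁..R, h ((x : ℂ) + ((-T : ℝ) : ℂ) * I)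

lemma hasDerivAt_horizontalLine (w : ℂ) (x : ℝ) : HasDerivAt (fun x : ℝ => (x : ℂ) + w) 1 x := by
  simpa using (hasDerivAt_id x).ofReal_comp.add_const w

lemma integral_horizontal_of_primitive {U : Set ℂ} (hU : IsOpen U) {h G : ℂ → ℂ}
    (hG : ∀ z ∈ U, HasDerivAt G (h z) z) {a b : ℝ} {w : ℂ}
    (hw : ∀ x ∈ uIcc a b, (x : ℂ) + w ∈ U) :
    ∫ x in a..b, h ((x : ℂ) + w) = G (b + w) - G (a + w) := by
  have := integral_comp_mul_deriv_of_primitive (c := fun x : ℝ => (x : ℂ) + w) (by fun_prop)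
    ⟨∅, fun t _ => (hasDerivAt_horizontalLine w t).differentiableAt⟩
    ⟨1, fun t => by rw [(hasDerivAt_horizontalLine w t).deriv]; simp⟩ hU hG hw
  rw [← this]
  refine intervalIntegral.integral_congr fun x _ => ?_
  simp only [(hasDerivAt_horizontalLine w x).deriv, mul_one]

lemma integral_vertical_of_primitive {U : Set ℂ} (hU : IsOpen U) {h G : ℂ → ℂ}
    (hG : ∀ z ∈ U, HasDerivAt G (h z) z) {a b R : ℝ}
    (hw : ∀ y ∈ uIcc a b, (R : ℂ) + (y : ℂ) * I ∈ U) :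
    I * ∫ y in a..b, h ((R : ℂ) + (y : ℂ) * I) = G (R + b * I) - G (R + a * I) := by
  have hv := isVerticalContour_verticalLine R
  have := integral_comp_mul_deriv_of_primitive hv.continuous hv.differentiableAt
    hv.bounded_deriv hU hG hw
  rw [← this, ← intervalIntegral.integral_const_mul]
  refine intervalIntegral.integral_congr fun y _ => ?_
  simp only [(hasDerivAt_verticalLine R y).deriv]
  ring

/-- The path of `closedIntegral`, as a set. -/
def closedPath (γ : ℝ → ℂ) (σ₁ σ₂ R T : ℝ) : Set ℂ :=
  γ '' uIcc (-T) T ∪ (fun x : ℝ => (x : ℂ) + (T : ℂ) * I) '' uIcc σ₂ R ∪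
    (fun y : ℝ => (R : ℂ) + (y : ℂ) * I) '' uIcc (-T) T ∪
    (fun x : ℝ => (x : ℂ) + ((-T : ℝ) : ℂ) * I) '' uIcc σ₁ R

lemma isCompact_closedPath {γ : ℝ → ℂ} (hγ : Continuous γ) (σ₁ σ₂ R T : ℝ) :
    IsCompact (closedPath γ σ₁ σ₂ R T) := by
  refine ((IsCompact.union ?_ ?_).union ?_).union ?_ <;>
    exact isCompact_uIcc.image (by fun_prop)

lemma closedIntegral_of_primitive {γ : ℝ → ℂ} (hγ : IsVerticalContour γ) {σ₁ σ₂ T : ℝ} (R : ℝ)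
    (hE : HasEnds γ σ₁ σ₂ T) {U : Set ℂ} (hU : IsOpen U) {h G : ℂ → ℂ}
    (hG : ∀ z ∈ U, HasDerivAt G (h z) z) (hsub : closedPath γ σ₁ σ₂ R T ⊆ U) :
    closedIntegral γ σ₁ σ₂ R h T = 0 := by
  rw [closedIntegral, integral_comp_mul_deriv_of_primitive hγ.continuous hγ.differentiableAt
    hγ.bounded_deriv hU hG fun t ht => hsub (.inl (.inl (.inl ⟨t, ht, rfl⟩))),
    integral_horizontal_of_primitive hU hG fun x hx => hsub (.inl (.inl (.inr ⟨x, hx, rfl⟩))),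
    integral_vertical_of_primitive hU hG fun x hx => hsub (.inl (.inr ⟨x, hx, rfl⟩)),
    integral_horizontal_of_primitive hU hG fun x hx => hsub (.inr ⟨x, hx, rfl⟩),
    hE.upper T le_rfl, hE.lower (-T) le_rfl]
  ring

/-- Truncation at a larger height does not change the closed integral of a function which is
holomorphic between the ends of `γ` and the line `Re s = R`. -/
lemma closedIntegral_eq_of_le {γ : ℝ → ℂ} (hγ : IsVerticalContour γ) {σ₁ σ₂ T₀ R : ℝ}
    (hE : HasEnds γ σ₁ σ₂ T₀) (h₁ : σ₁ ≤ R) (h₂ : σ₂ ≤ R) {h : ℂ → ℂ}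
    (hup : ∀ z : ℂ, σ₂ ≤ z.re → T₀ ≤ z.im → DifferentiableAt ℂ h z)
    (hlow : ∀ z : ℂ, σ₁ ≤ z.re → z.im ≤ -T₀ → DifferentiableAt ℂ h z)
    (hcont : ∀ t, ContinuousAt h (γ t)) (hR : ∀ t : ℝ, ContinuousAt h (R + t * I)) {T : ℝ}
    (hT : T₀ ≤ T) :
    closedIntegral γ σ₁ σ₂ R h T = closedIntegral γ σ₁ σ₂ R h T₀ := by
  have hTp := hE.pos
  have i1 : ∀ a b, IntervalIntegrable (fun t => h (γ t) * deriv γ t) volume a b := fun a b =>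
    intervalIntegrable_mul_deriv hγ.bounded_deriv (continuousOn_of_forall_continuousAt fun t _ =>
      (hcont t).comp hγ.continuous.continuousAt)
  have i2 : ∀ a b, IntervalIntegrable (fun y : ℝ => h ((R : ℂ) + (y : ℂ) * I)) volume a b :=
    fun a b => (continuousOn_of_forall_continuousAt fun t _ =>
      ContinuousAt.comp (f := fun y : ℝ => (R : ℂ) + (y : ℂ) * I) (hR t)
        (by fun_prop)).intervalIntegrable
  have s1 : ∫ t in (-T)..T, h (γ t) * deriv γ t = (∫ t in (-T)..(-T₀), h (γ t) * deriv γ t) +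
      (∫ t in (-T₀)..T₀, h (γ t) * deriv γ t) + ∫ t in T₀..T, h (γ t) * deriv γ t := by
    rw [intervalIntegral.integral_add_adjacent_intervals (i1 _ _) (i1 _ _),
      intervalIntegral.integral_add_adjacent_intervals (i1 _ _) (i1 _ _)]
  have s2 : ∫ y in (-T)..T, h ((R : ℂ) + (y : ℂ) * I) =
      (∫ y in (-T)..(-T₀), h ((R : ℂ) + (y : ℂ) * I)) +
      (∫ y in (-T₀)..T₀, h ((R : ℂ) + (y : ℂ) * I)) + ∫ y in T₀..T, h ((R : ℂ) + (y : ℂ) * I) := by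
    rw [intervalIntegral.integral_add_adjacent_intervals (i2 _ _) (i2 _ _),
      intervalIntegral.integral_add_adjacent_intervals (i2 _ _) (i2 _ _)]
  have u1 : ∫ t in T₀..T, h (γ t) * deriv γ t =
      I * ∫ y in T₀..T, h ((σ₂ : ℂ) + (y : ℂ) * I) := by
    rw [← intervalIntegral.integral_const_mul]
    refine intervalIntegral.integral_congr fun t ht => ?_
    rw [uIcc_of_le hT] at ht
    simp only [hE.upper t ht.1, hE.upper_deriv t ht.1, mul_comm]
  have l1 : ∫ t in (-T)..(-T₀), h (γ t) * deriv γ t =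
      I * ∫ y in (-T)..(-T₀), h ((σ₁ : ℂ) + (y : ℂ) * I) := by
    rw [← intervalIntegral.integral_const_mul]
    refine intervalIntegral.integral_congr fun t ht => ?_
    rw [uIcc_of_le (by linarith)] at ht
    simp only [hE.lower t ht.2, hE.lower_deriv t ht.2, mul_comm]
  have r1 := integral_boundary_rect_eq_zero_of_differentiableOn h ⟨σ₂, T₀⟩ ⟨R, T⟩ (fun z hz => by
    rw [mem_reProdIm, uIcc_of_le h₂, uIcc_of_le hT] at hz
    exact (hup z hz.1.1 hz.2.1).differentiableWithinAt)
  have r2 := integral_boundary_rect_eq_zero_of_differentiableOn h ⟨σ₁, -T⟩ ⟨R, -T₀⟩ (fun z hz => by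
    rw [mem_reProdIm, uIcc_of_le h₁, uIcc_of_le (show -T ≤ -T₀ by linarith)] at hz
    exact (hlow z hz.1.1 hz.2.2).differentiableWithinAt)
  simp only [smul_eq_mul] at r1 r2
  rw [closedIntegral, closedIntegral, s1, s2, u1, l1]
  linear_combination -r1 - r2

end Contour

/-! ### Residues and the comparison with a vertical line -/

section Residue

open Complex MeasureTheory Set

/-- The principal part `Q` of a function at a pole `p`, as a function whose only obstruction to a
primitive `V` is a multiple of `1 / (z - p)`. -/
lemma exists_principalPart_of_analyticAt (p : ℂ) (n : ℕ) : ∀ f : ℂ → ℂ, AnalyticAt ℂ f p →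
    ∃ (Q V g : ℂ → ℂ) (c : ℂ), (∀ z, z ≠ p → AnalyticAt ℂ Q z) ∧
      (∀ z, z ≠ p → HasDerivAt V (Q z - c / (z - p)) z) ∧ AnalyticAt ℂ g p ∧
      ∀ z, z ≠ p → f z / (z - p) ^ n = Q z + g z := by
  induction n with
  | zero =>
    intro f hf
    exact ⟨0, 0, f, 0, fun z _ => analyticAt_const, fun z _ => by
      simp, hf, fun z _ => by simp⟩
  | succ n ih =>
    intro f hf
    have hds : AnalyticAt ℂ (dslope f p) p := by
      obtain ⟨s, hs⟩ := hf
      exact ⟨_, hs.has_fpower_series_dslope_fslope⟩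
    obtain ⟨Q, V, g, c, hQ, hV, hg, heq⟩ := ih _ hds
    have hsub : ∀ z : ℂ, z ≠ p → z - p ≠ 0 := fun z hz => sub_ne_zero.2 hz
    have heq' : ∀ z, z ≠ p → f z / (z - p) ^ (n + 1) = (Q z + f p / (z - p) ^ (n + 1)) + g z := by
      intro z hz
      have h1 : (z - p) * dslope f p z = f z - f p := by
        simpa using sub_smul_dslope f p z
      have h2 := heq z hz
      have h3 := hsub z hz
      have h4 : f z / (z - p) ^ (n + 1) = dslope f p z / (z - p) ^ n + f p / (z - p) ^ (n + 1) := by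
        rw [pow_succ]
        field_simp
        linear_combination -h1
      rw [h4, h2]; ring
    have hQ' : ∀ z, z ≠ p → AnalyticAt ℂ (fun z => Q z + f p / (z - p) ^ (n + 1)) z := fun z hz =>
      (hQ z hz).add (analyticAt_const.div ((analyticAt_id.sub analyticAt_const).pow _)
        (pow_ne_zero _ (hsub z hz)))
    rcases Nat.eq_zero_or_pos n with hn | hn
    · subst hn
      refine ⟨_, V, g, c + f p, hQ', fun z hz => ?_, hg, heq'⟩
      convert hV z hz using 1
      simp only [zero_add, pow_one]
      ring
    · refine ⟨_, fun z => V z - f p / n * ((z - p) ^ n)⁻¹, g, c, hQ', fun z hz => ?_, hg, heq'⟩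
      have h3 := hsub z hz
      have h5 : HasDerivAt (fun z : ℂ => (z - p) ^ n) (n * (z - p) ^ (n - 1) * 1) z :=
        ((hasDerivAt_id z).sub_const p).pow n
      have h6 := (h5.inv (pow_ne_zero _ h3)).const_mul (f p / n)
      refine ((hV z hz).sub h6).congr_deriv ?_
      obtain ⟨m, rfl⟩ : ∃ m, n = m + 1 := ⟨n - 1, by omega⟩
      have hm : ((m + 1 : ℕ) : ℂ) ≠ 0 := Nat.cast_ne_zero.2 (Nat.succ_ne_zero m)
      simp only [Nat.add_sub_cancel]
      generalize ((m + 1 : ℕ) : ℂ) = k at *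
      generalize z - p = w at *
      rw [show w ^ (m + 1 + 1) = w ^ m * w * w by ring, show w ^ (m + 1) = w ^ m * w by ring]
      field_simp
      ring

lemma exists_principalPart {h : ℂ → ℂ} {p : ℂ} (hm : MeromorphicAt h p) :
    ∃ (Q V g : ℂ → ℂ) (c : ℂ), (∀ z, z ≠ p → AnalyticAt ℂ Q z) ∧
      (∀ z, z ≠ p → HasDerivAt V (Q z - c / (z - p)) z) ∧ AnalyticAt ℂ g p ∧
      (∀ᶠ z in 𝓝[≠] p, h z = Q z + g z) ∧
      ∀ L, Tendsto (fun z => (z - p) * h z) (𝓝[≠] p) (𝓝 L) → c = L := by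
  by_cases hL : ∃ L, Tendsto (fun z => (z - p) * h z) (𝓝[≠] p) (𝓝 L)
  · obtain ⟨L, hL⟩ := hL
    set F : ℂ → ℂ := Function.update (fun z => (z - p) * h z) p L with hF
    have hFm : MeromorphicAt F p := by
      refine (MeromorphicAt.mul (f := fun z : ℂ => z - p) (by fun_prop) hm).congr ?_
      filter_upwards [self_mem_nhdsWithin] with z hz
      simp [hF, Function.update_of_ne (show z ≠ p from hz)]
    have hFc : ContinuousAt F p := continuousAt_update_same.2 hL
    have hFa : AnalyticAt ℂ F p := hFm.analyticAt hFc
    have hds : AnalyticAt ℂ (dslope F p) p := by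
      obtain ⟨s, hs⟩ := hFa
      exact ⟨_, hs.has_fpower_series_dslope_fslope⟩
    refine ⟨fun z => L / (z - p), 0, dslope F p, L, fun z hz => analyticAt_const.div
      (analyticAt_id.sub analyticAt_const) (sub_ne_zero.2 hz), fun z _ => by
        simp, hds, ?_, fun L' hL' => tendsto_nhds_unique hL hL'⟩
    filter_upwards [self_mem_nhdsWithin] with z hz
    have hz' : z ≠ p := hz
    have h3 : z - p ≠ 0 := sub_ne_zero.2 hz'
    have h1 : (z - p) * dslope F p z = F z - F p := by simpa using sub_smul_dslope F p z
    have h2 : F z = (z - p) * h z := by simp [hF, Function.update_of_ne hz']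
    have h4 : F p = L := by simp [hF]
    rw [h2, h4] at h1
    field_simp
    linear_combination -h1
  · obtain ⟨n, hn⟩ := hm
    obtain ⟨Q, V, g, c, hQ, hV, hg, heq⟩ := exists_principalPart_of_analyticAt p n _ hn
    refine ⟨Q, V, g, c, hQ, hV, hg, ?_, fun L hL' => (hL ⟨L, hL'⟩).elim⟩
    filter_upwards [self_mem_nhdsWithin] with z hz
    have h3 : z - p ≠ 0 := sub_ne_zero.2 hz
    rw [← heq z hz, smul_eq_mul, mul_div_cancel_left₀ _ (pow_ne_zero _ h3)]

/-- On a disc, a function meromorphic with finitely many poles has a primitive up to simple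
fractions, whose coefficients at simple poles and removable singularities are the residues. -/
lemma exists_primitive_sub_sum_simple_fractions {x₀ : ℂ} {r : ℝ} (P : Finset ℂ) : ∀ h : ℂ → ℂ,
    (∀ z ∈ Metric.ball x₀ r, z ∉ P → DifferentiableAt ℂ h z) → (∀ p ∈ P, MeromorphicAt h p) →
    ∃ c G : ℂ → ℂ,
      (∀ p ∈ P, ∀ L, Tendsto (fun z => (z - p) * h z) (𝓝[≠] p) (𝓝 L) → c p = L) ∧
      ∀ z ∈ Metric.ball x₀ r, z ∉ P → HasDerivAt G (h z - ∑ p ∈ P, c p * (z - p)⁻¹) z := by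
  classical
  induction P using Finset.induction_on with
  | empty =>
    intro h hd _
    obtain ⟨G, hG⟩ := DifferentiableOn.isExactOn_ball (c := x₀) (r := r) (f := h) fun z hz =>
      (hd z hz (by simp)).differentiableWithinAt
    exact ⟨0, G, by simp, fun z hz _ => by simpa using hG z hz⟩
  | insert p P hp ih =>
    intro h hd hm
    obtain ⟨Q, V, g, c₀, hQ, hV, hg, heq, hc₀⟩ := exists_principalPart (hm p (by simp))
    -- subtracting the principal part at `p` leaves a function with poles in the smaller set
    set h₁ : ℂ → ℂ := Function.update (fun z => h z - Q z) p (g p) with hh₁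
    have hne : ∀ z, z ≠ p → h₁ =ᶠ[𝓝 z] fun z => h z - Q z := fun z hz => by
      filter_upwards [isOpen_ne.mem_nhds hz] with w hw
      simp [hh₁, Function.update_of_ne (show w ≠ p from hw)]
    have hpg : h₁ =ᶠ[𝓝 p] g := by
      rw [eventually_nhdsWithin_iff] at heq
      filter_upwards [heq] with w hw
      by_cases hwp : w = p
      · simp [hh₁, hwp]
      · simp [hh₁, Function.update_of_ne hwp, hw hwp]
    obtain ⟨c, G, hc, hG⟩ := ih h₁ (fun z hz hzP => by
        by_cases hzp : z = p
        · subst hzp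
          exact (hg.congr hpg.symm).differentiableAt
        · exact ((hd z hz (by simp [hzp, hzP])).sub
            (hQ z hzp).differentiableAt).congr_of_eventuallyEq
            (hne z hzp))
      (fun p' hp' => by
        have hpp : p' ≠ p := fun e => hp (e ▸ hp')
        exact ((hm p' (by simp [hp'])).sub (hQ p' hpp).meromorphicAt).congr
          ((hne p' hpp).symm.filter_mono nhdsWithin_le_nhds))
    refine ⟨Function.update c p c₀, fun z => G z + V z, fun p' hp' L hL => ?_,
      fun z hz hzP => ?_⟩
    · rcases Finset.mem_insert.1 hp' with rfl | hp'
      · simpa using hc₀ L hL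
      · have hpp : p' ≠ p := fun e => hp (e ▸ hp')
        rw [Function.update_of_ne hpp]
        refine hc p' hp' L ?_
        have h0 : Tendsto (fun z => (z - p') * Q z) (𝓝[≠] p') (𝓝 0) := by
          have : ContinuousAt (fun z => (z - p') * Q z) p' :=
            ContinuousAt.mul (by fun_prop) (hQ p' hpp).continuousAt
          have h2 := this.tendsto
          simp only [sub_self, zero_mul] at h2
          exact h2.mono_left nhdsWithin_le_nhds
        have h1 := hL.sub h0
        rw [sub_zero] at h1
        refine h1.congr' (((hne p' hpp).filter_mono nhdsWithin_le_nhds).mono fun z hz => ?_)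
        have hz' : h₁ z = h z - Q z := hz
        simp only [hz']
        ring
    · simp only [Finset.mem_insert, not_or] at hzP
      have h1 := (hG z hz hzP.2).add (hV z hzP.1)
      refine h1.congr_deriv ?_
      rw [Finset.sum_insert hp, Function.update_self]
      have e : ∑ x ∈ P, Function.update c p c₀ x * (z - x)⁻¹ = ∑ x ∈ P, c x * (z - x)⁻¹ :=
        Finset.sum_congr rfl fun x hx => by
          rw [Function.update_of_ne (ne_of_mem_of_not_mem hx hp)]
      rw [e, (hne z hzP.1).eq_of_nhds]
      ring

/-- The four pieces of the closed path: the integrand is integrable on each of them. -/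
lemma closedIntegral_intervalIntegrable {γ : ℝ → ℂ} (hγ : IsVerticalContour γ) {σ₁ σ₂ R T : ℝ}
    {h : ℂ → ℂ} (hh : ContinuousOn h (closedPath γ σ₁ σ₂ R T)) :
    IntervalIntegrable (fun t => h (γ t) * deriv γ t) volume (-T) T ∧
    IntervalIntegrable (fun x : ℝ => h ((x : ℂ) + (T : ℂ) * I)) volume σ₂ R ∧
    IntervalIntegrable (fun y : ℝ => h ((R : ℂ) + (y : ℂ) * I)) volume (-T) T ∧
    IntervalIntegrable (fun x : ℝ => h ((x : ℂ) + ((-T : ℝ) : ℂ) * I)) volume σ₁ R := by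
  refine ⟨intervalIntegrable_mul_deriv hγ.bounded_deriv (hh.comp hγ.continuous.continuousOn
    fun t ht => .inl (.inl (.inl ⟨t, ht, rfl⟩))), ContinuousOn.intervalIntegrable ?_,
    ContinuousOn.intervalIntegrable ?_, ContinuousOn.intervalIntegrable ?_⟩
  · exact hh.comp (f := fun x : ℝ => (x : ℂ) + (T : ℂ) * I) (by fun_prop)
      fun x hx => .inl (.inl (.inr ⟨x, hx, rfl⟩))
  · exact hh.comp (f := fun y : ℝ => (R : ℂ) + (y : ℂ) * I) (by fun_prop)
      fun x hx => .inl (.inr ⟨x, hx, rfl⟩)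
  · exact hh.comp (f := fun x : ℝ => (x : ℂ) + ((-T : ℝ) : ℂ) * I) (by fun_prop)
      fun x hx => .inr ⟨x, hx, rfl⟩

lemma closedIntegral_sub {γ : ℝ → ℂ} (hγ : IsVerticalContour γ) {σ₁ σ₂ R T : ℝ}
    {h k : ℂ → ℂ} (hh : ContinuousOn h (closedPath γ σ₁ σ₂ R T))
    (hk : ContinuousOn k (closedPath γ σ₁ σ₂ R T)) :
    closedIntegral γ σ₁ σ₂ R (fun z => h z - k z) T =
      closedIntegral γ σ₁ σ₂ R h T - closedIntegral γ σ₁ σ₂ R k T := by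
  obtain ⟨a1, a2, a3, a4⟩ := closedIntegral_intervalIntegrable hγ hh
  obtain ⟨b1, b2, b3, b4⟩ := closedIntegral_intervalIntegrable hγ hk
  simp only [closedIntegral, sub_mul]
  rw [intervalIntegral.integral_sub a1 b1, intervalIntegral.integral_sub a2 b2,
    intervalIntegral.integral_sub a3 b3, intervalIntegral.integral_sub a4 b4]
  ring

lemma closedIntegral_sum {γ : ℝ → ℂ} (hγ : IsVerticalContour γ) {σ₁ σ₂ R T : ℝ}
    (P : Finset ℂ) {k : ℂ → ℂ → ℂ}
    (hk : ∀ p ∈ P, ContinuousOn (k p) (closedPath γ σ₁ σ₂ R T)) :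
    closedIntegral γ σ₁ σ₂ R (fun z => ∑ p ∈ P, k p z) T =
      ∑ p ∈ P, closedIntegral γ σ₁ σ₂ R (k p) T := by
  have b := fun p hp => closedIntegral_intervalIntegrable hγ (hk p hp)
  simp only [closedIntegral, Finset.sum_mul]
  rw [intervalIntegral.integral_finsetSum fun p hp => (b p hp).1,
    intervalIntegral.integral_finsetSum fun p hp => (b p hp).2.1,
    intervalIntegral.integral_finsetSum fun p hp => (b p hp).2.2.1,
    intervalIntegral.integral_finsetSum fun p hp => (b p hp).2.2.2]
  simp only [Finset.sum_sub_distrib, Finset.sum_add_distrib, Finset.mul_sum]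

lemma closedIntegral_const_mul (γ : ℝ → ℂ) (σ₁ σ₂ R T : ℝ) (c : ℂ) (h : ℂ → ℂ) :
    closedIntegral γ σ₁ σ₂ R (fun z => c * h z) T = c * closedIntegral γ σ₁ σ₂ R h T := by
  simp only [closedIntegral, mul_assoc, intervalIntegral.integral_const_mul]
  ring

lemma tendsto_integral_horizontal {h : ℝ → ℝ → ℂ} {b : ℝ → ℝ} (hb : Tendsto b atTop (𝓝 0))
    {σ R : ℝ} (hh : ∀ᶠ T in atTop, ∀ x ∈ uIcc σ R, ‖h T x‖ ≤ b T) :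
    Tendsto (fun T => ∫ x in σ..R, h T x) atTop (𝓝 0) := by
  have h0 : Tendsto (fun T => b T * |R - σ|) atTop (𝓝 0) := by
    simpa using hb.mul_const |R - σ|
  refine squeeze_zero_norm' (hh.mono fun T hT => ?_) h0
  exact intervalIntegral.norm_integral_le_of_norm_le_const fun x hx =>
    hT x (uIoc_subset_uIcc hx)

/-- The closed integral of `1 / (z - p)` is determined by the indices about `p` of `γ` and of the
line `Re s = R`. -/
lemma closedIntegral_inv_sub {γ : ℝ → ℂ} (hγ : IsVerticalContour γ) {σ₁ σ₂ T₀ R : ℝ}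
    (hE : HasEnds γ σ₁ σ₂ T₀) (h₁ : σ₁ ≤ R) (h₂ : σ₂ ≤ R) {p : ℂ}
    (hp : (p.re < σ₁ ∧ p.re < σ₂) ∨ |p.im| < T₀) (hpγ : p ∉ range γ) (hpR : p.re ≠ R) {w : ℂ}
    (hw : Tendsto (truncatedIndex γ p) atTop (𝓝 w)) :
    closedIntegral γ σ₁ σ₂ R (fun z => (z - p)⁻¹) T₀ =
      2 * Real.pi * I * (w - if p.re < R then 1 / 2 else -1 / 2) := by
  have hline := isVerticalContour_verticalLine R
  have hpi : (Real.pi : ℂ) ≠ 0 := by exact_mod_cast Real.pi_ne_zero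
  have hda : ∀ z : ℂ, z ≠ p → DifferentiableAt ℂ (fun z => (z - p)⁻¹) z := fun z hz =>
    (differentiableAt_id.sub_const p).inv (sub_ne_zero.2 hz)
  have hconst : ∀ T, T₀ ≤ T → closedIntegral γ σ₁ σ₂ R (fun z => (z - p)⁻¹) T =
      closedIntegral γ σ₁ σ₂ R (fun z => (z - p)⁻¹) T₀ := fun T hT => by
    refine closedIntegral_eq_of_le hγ hE h₁ h₂ (fun z hz1 hz2 => hda z ?_)
      (fun z hz1 hz2 => hda z ?_) (fun t => (hda _ ?_).continuousAt)
      (fun t => (hda _ ?_).continuousAt) hT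
    · rintro rfl
      rcases hp with hp | hp
      · linarith [hp.2]
      · linarith [le_abs_self z.im]
    · rintro rfl
      rcases hp with hp | hp
      · linarith [hp.1]
      · linarith [neg_abs_le z.im]
    · rintro rfl
      exact hpγ ⟨t, rfl⟩
    · rintro rfl
      simp at hpR
  have hlineIdx : Tendsto (truncatedIndex (fun t : ℝ => (R : ℂ) + (t : ℂ) * I) p) atTop
      (𝓝 (if p.re < R then 1 / 2 else -1 / 2)) := by
    split_ifs with hlt
    · refine tendsto_truncatedIndex_of_left_ray hline fun t => ?_
      rw [mem_slitPlane_iff]; left; simpa using hlt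
    · refine tendsto_truncatedIndex_of_right_ray hline fun t => ?_
      rw [mem_slitPlane_iff]; left
      simpa using lt_of_le_of_ne (not_lt.1 hlt) hpR.symm
  have hb : Tendsto (fun T : ℝ => (T - |p.im|)⁻¹) atTop (𝓝 0) :=
    tendsto_inv_atTop_zero.comp (tendsto_atTop_add_const_right _ _ tendsto_id)
  have hU : Tendsto (fun T : ℝ => ∫ x in σ₂..R, ((x : ℂ) + (T : ℂ) * I - p)⁻¹) atTop (𝓝 0) := by
    refine tendsto_integral_horizontal hb ?_
    filter_upwards [eventually_gt_atTop |p.im|] with T hT x _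
    rw [norm_inv]
    refine inv_anti₀ (by linarith) ?_
    have := abs_im_le_norm ((x : ℂ) + (T : ℂ) * I - p)
    simp only [sub_im, add_im, ofReal_im, mul_im, ofReal_re, I_re, I_im, mul_one, mul_zero,
      zero_add, add_zero] at this
    linarith [le_abs_self (T - p.im), le_abs_self p.im]
  have hL : Tendsto (fun T : ℝ => ∫ x in σ₁..R, ((x : ℂ) + ((-T : ℝ) : ℂ) * I - p)⁻¹) atTop
      (𝓝 0) := by
    refine tendsto_integral_horizontal hb ?_
    filter_upwards [eventually_gt_atTop |p.im|] with T hT x _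
    rw [norm_inv]
    refine inv_anti₀ (by linarith) ?_
    have := abs_im_le_norm ((x : ℂ) + ((-T : ℝ) : ℂ) * I - p)
    simp only [sub_im, add_im, ofReal_im, mul_im, ofReal_re, I_re, I_im, mul_one, mul_zero,
      zero_add, add_zero] at this
    linarith [neg_abs_le (-T - p.im), neg_abs_le p.im]
  have hlim := (((hw.sub hlineIdx).const_mul (2 * Real.pi * I)).add hU).sub hL
  rw [add_zero, sub_zero] at hlim
  refine tendsto_nhds_unique (tendsto_const_nhds.congr' ?_) hlim
  filter_upwards [eventually_ge_atTop T₀] with T hT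
  rw [← hconst T hT, closedIntegral, truncatedIndex_eq, truncatedIndex_eq]
  have e : ∫ t in (-T)..T, ((R : ℂ) + (t : ℂ) * I - p)⁻¹ *
      deriv (fun t : ℝ => (R : ℂ) + (t : ℂ) * I) t =
      I * ∫ t in (-T)..T, ((R : ℂ) + (t : ℂ) * I - p)⁻¹ := by
    rw [← intervalIntegral.integral_const_mul]
    refine intervalIntegral.integral_congr fun y _ => ?_
    simp only [(hasDerivAt_verticalLine R y).deriv]
    ring
  rw [e]
  field_simp [I_ne_zero]
  ring

/-- Moving a contour to the line `Re s = R`: only the poles to the right of the contour and to the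
left of the line contribute. The poles in `D` may be of any order and may accumulate at `± i ∞`;
those in `J` are simple. -/
theorem integral_contour_sub_integral_line {γ : ℝ → ℂ} (hγ : IsVerticalContour γ)
    {σ₁ σ₂ T₁ R B : ℝ} (hE : ∀ T₀ ≥ T₁, HasEnds γ σ₁ σ₂ T₀) (h₁ : σ₁ ≤ R) (h₂ : σ₂ ≤ R)
    {h ρ : ℂ → ℂ} {D J : Set ℂ} (hd : ∀ z, z ∉ D ∪ J → DifferentiableAt ℂ h z)
    (hm : ∀ z, MeromorphicAt h z) (hfin : ∀ r : ℝ, ((D ∪ J) ∩ Metric.closedBall 0 r).Finite)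
    (hD : ∀ p ∈ D, p.re < σ₁ ∧ p.re < σ₂ ∧ LiesLeftOf γ p)
    (hJ : ∀ p ∈ J, |p.im| ≤ B ∧ p.re ≠ R ∧ LiesRightOf γ p)
    (hρ : ∀ p ∈ J, Tendsto (fun z => (z - p) * h z) (𝓝[≠] p) (𝓝 (ρ p)))
    (PR : Finset ℂ) (hPR : ∀ p, p ∈ PR ↔ p ∈ J ∧ p.re < R)
    (hU : Tendsto (fun T : ℝ => ∫ x in σ₂..R, h ((x : ℂ) + (T : ℂ) * I)) atTop (𝓝 0))
    (hL : Tendsto (fun T : ℝ => ∫ x in σ₁..R, h ((x : ℂ) + ((-T : ℝ) : ℂ) * I)) atTop (𝓝 0))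
    (hiγ : Integrable fun t => h (γ t) * deriv γ t)
    (hiR : Integrable fun y : ℝ => h ((R : ℂ) + (y : ℂ) * I)) :
    (∫ t, h (γ t) * deriv γ t) - I * ∫ y : ℝ, h ((R : ℂ) + (y : ℂ) * I) =
      -(2 * Real.pi * I) * ∑ p ∈ PR, ρ p := by
  classical
  set T₀ := max T₁ (B + 1) with hT₀
  have hE₀ := hE T₀ (le_max_left _ _)
  have hBT : B < T₀ := lt_of_lt_of_le (by linarith) (le_max_right _ _)
  have hγn : ∀ t, γ t ∉ D ∪ J := fun t ht => by
    rcases ht with ht | ht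
    · exact (hD _ ht).2.2.1 ⟨t, rfl⟩
    · exact (hJ _ ht).2.2.1 ⟨t, rfl⟩
  have hRn : ∀ y : ℝ, (R : ℂ) + (y : ℂ) * I ∉ D ∪ J := fun y hy => by
    rcases hy with hy | hy
    · have := (hD _ hy).1
      simp at this
      linarith
    · have := (hJ _ hy).2.1
      simp at this
  have hupn : ∀ z : ℂ, σ₂ ≤ z.re → T₀ ≤ z.im → z ∉ D ∪ J := fun z hz1 hz2 hz => by
    rcases hz with hz | hz
    · linarith [(hD _ hz).2.1]
    · linarith [(hJ _ hz).1, le_abs_self z.im]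
  have hlown : ∀ z : ℂ, σ₁ ≤ z.re → z.im ≤ -T₀ → z ∉ D ∪ J := fun z hz1 hz2 hz => by
    rcases hz with hz | hz
    · linarith [(hD _ hz).1]
    · linarith [(hJ _ hz).1, neg_abs_le z.im]
  have hpath : ∀ z ∈ closedPath γ σ₁ σ₂ R T₀, z ∉ D ∪ J := by
    rintro z (((⟨t, -, rfl⟩ | ⟨x, hx, rfl⟩) | ⟨y, -, rfl⟩) | ⟨x, hx, rfl⟩)
    · exact hγn t
    · rw [uIcc_of_le h₂] at hx
      exact hupn _ (by simpa using hx.1) (by simp)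
    · exact hRn y
    · rw [uIcc_of_le h₁] at hx
      exact hlown _ (by simpa using hx.1) (by simp)
  -- the value of the closed integral as the limit over increasing heights
  have hval : closedIntegral γ σ₁ σ₂ R h T₀ =
      (∫ t, h (γ t) * deriv γ t) - I * ∫ y : ℝ, h ((R : ℂ) + (y : ℂ) * I) := by
    have l1 := intervalIntegral_tendsto_integral hiγ tendsto_neg_atTop_atBot tendsto_id
    have l2 := intervalIntegral_tendsto_integral hiR tendsto_neg_atTop_atBot tendsto_id
    have hlim := ((l1.add hU).sub (l2.const_mul I)).sub hL
    rw [add_zero, sub_zero] at hlim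
    refine tendsto_nhds_unique (tendsto_const_nhds.congr' ?_) hlim
    filter_upwards [eventually_ge_atTop T₀] with T hT
    rw [← closedIntegral_eq_of_le hγ hE₀ h₁ h₂ (fun z hz1 hz2 => hd z (hupn z hz1 hz2))
      (fun z hz1 hz2 => hd z (hlown z hz1 hz2)) (fun t => (hd _ (hγn t)).continuousAt)
      (fun t => (hd _ (hRn t)).continuousAt) hT]
    rfl
  -- a disc containing the closed path and the poles that contribute; on it, `h` minus finitely many
  -- simple fractions has a primitive
  obtain ⟨r₁, hr₁⟩ := (isCompact_closedPath hγ.continuous σ₁ σ₂ R T₀).isBounded.subset_ball 0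
  obtain ⟨r₂, hr₂⟩ := PR.finite_toSet.isBounded.subset_ball (0 : ℂ)
  set r := max r₁ r₂
  set P := (hfin r).toFinset with hP
  have hPmem : ∀ p, p ∈ P ↔ p ∈ D ∪ J ∧ p ∈ Metric.closedBall (0 : ℂ) r := fun p => by
    rw [hP, Set.Finite.mem_toFinset]; rfl
  obtain ⟨c, G, hc, hG⟩ := exists_primitive_sub_sum_simple_fractions (x₀ := 0) (r := r) P h
    (fun z hz hzP => hd z fun hz' => hzP ((hPmem z).2 ⟨hz', Metric.ball_subset_closedBall hz⟩))
    (fun p _ => hm p)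
  have hcontinv : ∀ p ∈ P, ContinuousOn (fun z => c p * (z - p)⁻¹) (closedPath γ σ₁ σ₂ R T₀) :=
    fun p hp => continuousOn_const.mul (ContinuousOn.inv₀ (by fun_prop) fun z hz => by
      rw [sub_ne_zero]
      rintro rfl
      exact hpath z hz ((hPmem z).1 hp).1)
  have hzero := closedIntegral_of_primitive hγ R hE₀ (U := Metric.ball 0 r \ P)
    (Metric.isOpen_ball.sdiff P.finite_toSet.isClosed)
    (h := fun z => h z - ∑ p ∈ P, c p * (z - p)⁻¹)
    (fun z hz => hG z hz.1 (by simpa using hz.2)) (fun z hz =>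
      ⟨Metric.ball_subset_ball (le_max_left _ _) (hr₁ hz), fun hzP =>
        hpath z hz ((hPmem z).1 (by simpa using hzP)).1⟩)
  rw [closedIntegral_sub hγ (fun z hz => (hd z (hpath z hz)).continuousAt.continuousWithinAt)
    (continuousOn_finsetSum _ hcontinv), closedIntegral_sum hγ P hcontinv, sub_eq_zero] at hzero
  rw [← hval, hzero]
  have hterm : ∀ p ∈ P, closedIntegral γ σ₁ σ₂ R (fun z => c p * (z - p)⁻¹) T₀ =
      if p ∈ PR then -(2 * Real.pi * I) * ρ p else 0 := fun p hp => by
    rw [closedIntegral_const_mul]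
    rcases ((hPmem p).1 hp).1 with hpD | hpJ
    -- poles in `D` are to the left of both `γ` and the line, so the two indices cancel
    · obtain ⟨d1, d2, d3, d4⟩ := hD p hpD
      have hnot : p ∉ PR := fun hpR => by
        have := (hJ p ((hPR p).1 hpR).1).2.2.2
        have h3 := tendsto_nhds_unique d4 this
        norm_num at h3
      rw [closedIntegral_inv_sub hγ hE₀ h₁ h₂ (.inl ⟨d1, d2⟩) d3 (by linarith) d4,
        if_pos (by linarith), if_neg hnot]
      ring
    · obtain ⟨j1, j2, j3, j4⟩ := hJ p hpJ
      rw [closedIntegral_inv_sub hγ hE₀ h₁ h₂ (.inr (by linarith)) j3 j2 j4,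
        hc p hp _ (hρ p hpJ)]
      by_cases hlt : p.re < R
      · rw [if_pos hlt, if_pos ((hPR p).2 ⟨hpJ, hlt⟩)]
        ring
      · rw [if_neg hlt, if_neg fun h => hlt ((hPR p).1 h).2]
        ring
  rw [Finset.sum_congr rfl hterm, ← Finset.sum_filter, Finset.mul_sum]
  refine Finset.sum_congr ?_ fun _ _ => rfl
  ext p
  rw [Finset.mem_filter, hPmem]
  refine ⟨fun h => h.2, fun h => ⟨⟨.inr ((hPR p).1 h).1, ?_⟩, h⟩⟩
  exact Metric.ball_subset_closedBall (Metric.ball_subset_ball (le_max_right _ _) (hr₂ h))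

end Residue

/-! ### Zeros of entire functions, bounds for the sine, removal of singularities -/

section Entire

open Complex Set

lemma finite_zeros_inter_closedBall {N : ℂ → ℂ} (hN : Differentiable ℂ N) {z₀ : ℂ} (hz₀ : N z₀ ≠ 0)
    (r : ℝ) : ({z | N z = 0} ∩ Metric.closedBall 0 r).Finite := by
  have hA : AnalyticOnNhd ℂ N univ := fun z _ => hN.analyticAt z
  have hev : ∀ z, ∀ᶠ w in 𝓝[≠] z, N w ≠ 0 := fun z => by
    rcases (hA z (mem_univ z)).eventually_eq_zero_or_eventually_ne_zero with h | h
    · exact absurd (hA.eqOn_zero_of_preconnected_of_eventuallyEq_zero isPreconnected_univ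
        (mem_univ z) h (mem_univ z₀)) hz₀
    · exact h
  have hcod : {z | N z ≠ 0} ∈ codiscreteWithin (Metric.closedBall (0 : ℂ) r) := by
    rw [mem_codiscreteWithin]
    intro z _
    rw [disjoint_principal_right]
    filter_upwards [hev z] with w hw
    simp [hw]
  have := (isCompact_closedBall (0 : ℂ) r).finite_sdiff_of_mem_codiscreteWithin hcod
  refine this.subset fun z hz => ⟨hz.2, by simpa using hz.1⟩

lemma countable_zeros {N : ℂ → ℂ} (hN : Differentiable ℂ N) {z₀ : ℂ} (hz₀ : N z₀ ≠ 0) :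
    {z | N z = 0}.Countable := by
  have : {z | N z = 0} = ⋃ n : ℕ, {z | N z = 0} ∩ Metric.closedBall 0 (n : ℝ) := by
    rw [← inter_iUnion, Metric.iUnion_closedBall_nat, inter_univ]
  rw [this]
  exact countable_iUnion fun n => (finite_zeros_inter_closedBall hN hz₀ _).countable

lemma differentiable_dslope {N : ℂ → ℂ} (hN : Differentiable ℂ N) (p : ℂ) :
    Differentiable ℂ (dslope N p) := by
  rw [← differentiableOn_univ] at hN ⊢
  exact (Complex.differentiableOn_dslope univ_mem).2 hN

/-- The quotient of two functions, with the value given by l'Hôpital's rule at zeros of the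
denominator. -/
noncomputable def fillQuot (N D : ℂ → ℂ) (z : ℂ) : ℂ :=
  open Classical in if D z = 0 then deriv N z / deriv D z else N z / D z

lemma fillQuot_of_ne {N D : ℂ → ℂ} {z : ℂ} (h : D z ≠ 0) : fillQuot N D z = N z / D z :=
  if_neg h

lemma eventually_ne_of_deriv_ne {D : ℂ → ℂ} (hD : Differentiable ℂ D) {p : ℂ}
    (hp' : deriv D p ≠ 0) : ∀ᶠ z in 𝓝[≠] p, D z ≠ 0 := by
  have := (hD p).hasDerivAt.eventually_ne (c := 0) hp'
  exact this

lemma differentiableAt_fillQuot {N D : ℂ → ℂ} (hN : Differentiable ℂ N) (hD : Differentiable ℂ D)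
    {p : ℂ} (hp : D p = 0 → N p = 0 ∧ deriv D p ≠ 0) : DifferentiableAt ℂ (fillQuot N D) p := by
  by_cases h0 : D p = 0
  · obtain ⟨hNp, hDp⟩ := hp h0
    have hd : DifferentiableAt ℂ (fun z => dslope N p z / dslope D p z) p :=
      (differentiable_dslope hN p p).div (differentiable_dslope hD p p) (by rwa [dslope_same])
    refine hd.congr_of_eventuallyEq ?_
    have hev := eventually_ne_of_deriv_ne hD hDp
    rw [eventually_nhdsWithin_iff] at hev
    filter_upwards [hev] with z hz
    by_cases hzp : z = p
    · subst hzp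
      rw [fillQuot, if_pos h0, dslope_same, dslope_same]
    · have h1 := sub_smul_dslope_of_zero hNp z
      have h2 := sub_smul_dslope_of_zero h0 z
      have h3 : z - p ≠ 0 := sub_ne_zero.2 hzp
      rw [fillQuot_of_ne (hz hzp), ← h1, ← h2, smul_eq_mul, smul_eq_mul,
        mul_div_mul_left _ _ h3]
  · refine ((hN p).div (hD p) h0).congr_of_eventuallyEq ?_
    filter_upwards [(hD p).continuousAt.eventually_ne h0] with z hz
    exact fillQuot_of_ne hz

lemma tendsto_sub_mul_fillQuot {N D : ℂ → ℂ} (hN : Differentiable ℂ N) (hD : Differentiable ℂ D)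
    {p : ℂ} (h0 : D p = 0) (hp' : deriv D p ≠ 0) :
    Tendsto (fun z => (z - p) * fillQuot N D z) (𝓝[≠] p) (𝓝 (N p / deriv D p)) := by
  have hc : Tendsto (fun z => N z / dslope D p z) (𝓝[≠] p) (𝓝 (N p / dslope D p p)) :=
    (((hN p).continuousAt.div (differentiable_dslope hD p p).continuousAt
      (by rwa [dslope_same])).tendsto).mono_left nhdsWithin_le_nhds
  rw [dslope_same] at hc
  refine hc.congr' ?_
  filter_upwards [eventually_ne_of_deriv_ne hD hp', self_mem_nhdsWithin] with z hz hzp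
  have h3 : z - p ≠ 0 := sub_ne_zero.2 hzp
  have h2 := sub_smul_dslope_of_zero h0 z
  rw [smul_eq_mul] at h2
  rw [fillQuot_of_ne hz, ← h2]
  rw [← h2] at hz
  field_simp

lemma meromorphicAt_fillQuot {N D : ℂ → ℂ} (hN : Differentiable ℂ N) (hD : Differentiable ℂ D)
    {p : ℂ} (hp : D p = 0 → deriv D p ≠ 0) : MeromorphicAt (fillQuot N D) p := by
  refine ((hN.analyticAt p).meromorphicAt.div (hD.analyticAt p).meromorphicAt).congr ?_
  have : ∀ᶠ z in 𝓝[≠] p, D z ≠ 0 := by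
    by_cases h0 : D p = 0
    · exact eventually_ne_of_deriv_ne hD (hp h0)
    · exact ((hD p).continuousAt.eventually_ne h0).filter_mono nhdsWithin_le_nhds
  filter_upwards [this] with z hz
  exact (fillQuot_of_ne hz).symm

lemma sin_re_eq (z : ℂ) : (sin z).re = Real.sin z.re * Real.cosh z.im := by
  rw [Complex.sin_eq z, ← ofReal_sin, ← ofReal_cos, ← ofReal_cosh, ← ofReal_sinh]
  simp only [add_re, mul_re, ofReal_re, ofReal_im, I_re, I_im, mul_im]
  ring

lemma sin_im_eq (z : ℂ) : (sin z).im = Real.cos z.re * Real.sinh z.im := by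
  rw [Complex.sin_eq z, ← ofReal_sin, ← ofReal_cos, ← ofReal_cosh, ← ofReal_sinh]
  simp only [add_im, mul_re, ofReal_re, ofReal_im, I_re, I_im, mul_im]
  ring

lemma abs_sin_re_mul_cosh_le (z : ℂ) : |Real.sin z.re| * Real.cosh z.im ≤ ‖sin z‖ := by
  have h := abs_re_le_norm (sin z)
  rwa [sin_re_eq, abs_mul, abs_of_pos (Real.cosh_pos _)] at h

lemma abs_im_le_norm_sin (z : ℂ) : |z.im| ≤ ‖sin z‖ := by
  have hs : |z.im| ≤ |Real.sinh z.im| := by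
    rcases le_total 0 z.im with h | h
    · rw [abs_of_nonneg h, abs_of_nonneg (Real.sinh_nonneg_iff.2 h)]
      exact Real.self_le_sinh_iff.2 h
    · rw [abs_of_nonpos h, abs_of_nonpos (Real.sinh_nonpos_iff.2 h)]
      exact neg_le_neg (Real.sinh_le_self_iff.2 h)
  refine hs.trans ?_
  have h1 : ‖sin z‖ ^ 2 = Real.sin z.re ^ 2 + Real.sinh z.im ^ 2 := by
    rw [← Complex.normSq_eq_norm_sq, Complex.normSq_apply, sin_re_eq, sin_im_eq]
    have h2 := Real.sin_sq_add_cos_sq z.re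
    have h3 := Real.cosh_sq z.im
    linear_combination Real.sin z.re ^ 2 * h3 + Real.sinh z.im ^ 2 * h2
  rw [← abs_of_nonneg (norm_nonneg (sin z))]
  refine sq_le_sq.1 ?_
  rw [h1]
  linarith [sq_nonneg (Real.sin z.re)]

end Entire

/-! ### The integrand with its removable singularities filled -/

section Regularised

open Complex Set

variable {q : ℝ}

lemma norm_ofReal_lt_one (hq0 : 0 < q) (hq1 : q < 1) : ‖(q : ℂ)‖ < 1 := by
  simpa [abs_of_pos hq0] using hq1

lemma ofReal_ne_zero_of_pos (hq0 : 0 < q) : (q : ℂ) ≠ 0 := by exact_mod_cast hq0.ne'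

lemma norm_cpow (hq0 : 0 < q) (s : ℂ) : ‖(q : ℂ) ^ s‖ = q ^ s.re :=
  norm_cpow_eq_rpow_re_of_pos hq0 s

lemma differentiable_cpow (hq0 : 0 < q) : Differentiable ℂ fun s : ℂ => (q : ℂ) ^ s := fun _ =>
  (hasStrictDerivAt_const_cpow (.inl (ofReal_ne_zero_of_pos hq0))).hasDerivAt.differentiableAt

/-- The function `(q ^ (1 + s); q)_∞`, which cancels the poles of `1 / sin (π s)` at the negative
integers. -/
noncomputable def sinZeros (q : ℝ) (s : ℂ) : ℂ := qPochInf ((q : ℂ) ^ (1 + s)) q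

/-- `(q ^ (1 + s); q)_∞ / sin (π s)`, continued analytically to the negative integers. -/
noncomputable def sinRatio (q : ℝ) : ℂ → ℂ :=
  fillQuot (sinZeros q) fun s => sin ((Real.pi : ℂ) * s)

lemma differentiable_sinZeros (hq0 : 0 < q) (hq1 : q < 1) : Differentiable ℂ (sinZeros q) :=
  (differentiable_qPochInf (norm_ofReal_lt_one hq0 hq1)).comp
    ((differentiable_cpow hq0).comp (differentiable_id.const_add 1))

lemma hasDerivAt_sin_pi_mul (s : ℂ) :
    HasDerivAt (fun s : ℂ => sin ((Real.pi : ℂ) * s)) (cos (Real.pi * s) * Real.pi) s := by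
  simpa using ((hasDerivAt_id s).const_mul (Real.pi : ℂ)).csin

lemma differentiable_sin_pi_mul : Differentiable ℂ fun s : ℂ => sin ((Real.pi : ℂ) * s) :=
  fun s => (hasDerivAt_sin_pi_mul s).differentiableAt

lemma sin_pi_mul_eq_zero_iff (s : ℂ) : sin ((Real.pi : ℂ) * s) = 0 ↔ ∃ k : ℤ, s = k := by
  have hpi : (Real.pi : ℂ) ≠ 0 := by exact_mod_cast Real.pi_ne_zero
  rw [Complex.sin_eq_zero_iff]
  refine exists_congr fun k => ?_
  rw [mul_comm (k : ℂ), mul_right_inj' hpi]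

lemma deriv_sin_pi_mul_ne_zero {s : ℂ} (h : sin ((Real.pi : ℂ) * s) = 0) :
    deriv (fun s : ℂ => sin ((Real.pi : ℂ) * s)) s ≠ 0 := by
  have hpi : (Real.pi : ℂ) ≠ 0 := by exact_mod_cast Real.pi_ne_zero
  rw [(hasDerivAt_sin_pi_mul s).deriv]
  refine mul_ne_zero (fun hc => ?_) hpi
  have := Complex.sin_sq_add_cos_sq (Real.pi * s)
  rw [h, hc] at this
  norm_num at this

lemma sinZeros_eq_zero (hq0 : 0 < q) (hq1 : q < 1) (n : ℕ) : sinZeros q (-(n + 1 : ℂ)) = 0 := by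
  refine qPochInf_eq_zero (norm_ofReal_lt_one hq0 hq1) (k := n) ?_
  rw [← cpow_natCast, ← cpow_add _ _ (ofReal_ne_zero_of_pos hq0)]
  rw [show (1 + -((n : ℂ) + 1) + n) = 0 by ring, cpow_zero]

lemma sinRatio_of_ne {s : ℂ} (h : sin ((Real.pi : ℂ) * s) ≠ 0) :
    sinRatio q s = sinZeros q s / sin ((Real.pi : ℂ) * s) :=
  fillQuot_of_ne h

lemma differentiableAt_sinRatio (hq0 : 0 < q) (hq1 : q < 1) {s : ℂ} (hs : ∀ n : ℕ, s ≠ n) :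
    DifferentiableAt ℂ (sinRatio q) s := by
  refine differentiableAt_fillQuot (differentiable_sinZeros hq0 hq1) differentiable_sin_pi_mul
    fun h => ⟨?_, deriv_sin_pi_mul_ne_zero h⟩
  obtain ⟨k, hk⟩ := (sin_pi_mul_eq_zero_iff s).1 h
  cases k with
  | ofNat n => exact (hs n (by simpa using hk)).elim
  | negSucc n =>
    rw [hk, Int.cast_negSucc]
    push_cast
    exact sinZeros_eq_zero hq0 hq1 n

lemma meromorphicAt_sinRatio (hq0 : 0 < q) (hq1 : q < 1) (s : ℂ) :
    MeromorphicAt (sinRatio q) s :=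
  meromorphicAt_fillQuot (differentiable_sinZeros hq0 hq1) differentiable_sin_pi_mul
    deriv_sin_pi_mul_ne_zero

lemma sin_pi_mul_nat (n : ℕ) : sin ((Real.pi : ℂ) * n) = 0 :=
  (sin_pi_mul_eq_zero_iff n).2 ⟨n, by simp⟩

lemma cos_pi_mul_nat_sq (n : ℕ) : cos ((Real.pi : ℂ) * n) ^ 2 = 1 := by
  have := Complex.sin_sq_add_cos_sq (Real.pi * n)
  rw [sin_pi_mul_nat] at this
  simpa using this

lemma tendsto_sub_mul_sinRatio (hq0 : 0 < q) (hq1 : q < 1) (n : ℕ) :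
    Tendsto (fun s => (s - n) * sinRatio q s) (𝓝[≠] (n : ℂ))
      (𝓝 (sinZeros q n / (cos (Real.pi * n) * Real.pi))) := by
  have := tendsto_sub_mul_fillQuot (differentiable_sinZeros hq0 hq1) differentiable_sin_pi_mul
    (sin_pi_mul_nat n) (deriv_sin_pi_mul_ne_zero (sin_pi_mul_nat n))
  rwa [(hasDerivAt_sin_pi_mul _).deriv] at this

/-- The function `π q ^ s (q ^ (1 + s), q ^ (d + s); q)_∞ K(q ^ s) / (sin π s sin π(d + s))`,
continued analytically to the zeros of the sines that the zeros of `(q ^ (1 + s), q ^ (d + s); q)_∞`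
cancel. The second cosecant is that of `π(s + d - 1)`, up to sign, so that both quotients are
`sinRatio`. -/
noncomputable def regIntegrand (q : ℝ) (d : ℂ) (K : ℂ → ℂ) (s : ℂ) : ℂ :=
  -(Real.pi * sinRatio q s * sinRatio q (s + d - 1) * (q : ℂ) ^ s * K ((q : ℂ) ^ s))

/-- The summand of the two series of residues. -/
noncomputable def residueWeight (q : ℝ) (d : ℂ) (K : ℂ → ℂ) (x : ℂ) : ℂ :=
  x * (qPochInf (q * x) q * qPochInf ((q : ℂ) ^ d * x) q) * K x

lemma sin_pi_mul_shift (d s : ℂ) :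
    sin ((Real.pi : ℂ) * (s + d - 1)) = -sin ((Real.pi : ℂ) * (d + s)) := by
  rw [← Complex.sin_sub_pi]
  ring_nf

lemma sinZeros_eq (hq0 : 0 < q) (s : ℂ) : sinZeros q s = qPochInf (q * (q : ℂ) ^ s) q := by
  rw [sinZeros, cpow_add _ _ (ofReal_ne_zero_of_pos hq0), cpow_one]

lemma sinZeros_shift (hq0 : 0 < q) (d s : ℂ) :
    sinZeros q (s + d - 1) = qPochInf ((q : ℂ) ^ d * (q : ℂ) ^ s) q := by
  rw [sinZeros, ← cpow_add _ _ (ofReal_ne_zero_of_pos hq0)]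
  ring_nf

lemma regIntegrand_of_ne (hq0 : 0 < q) {d s : ℂ} (K : ℂ → ℂ) (h1 : sin ((Real.pi : ℂ) * s) ≠ 0)
    (h2 : sin ((Real.pi : ℂ) * (d + s)) ≠ 0) :
    regIntegrand q d K s = Real.pi * residueWeight q d K ((q : ℂ) ^ s) /
      (sin ((Real.pi : ℂ) * s) * sin ((Real.pi : ℂ) * (d + s))) := by
  have h3 : sin ((Real.pi : ℂ) * (s + d - 1)) ≠ 0 := by
    rw [sin_pi_mul_shift]; exact neg_ne_zero.2 h2
  rw [regIntegrand, sinRatio_of_ne h1, sinRatio_of_ne h3, sinZeros_shift hq0, sinZeros_eq hq0,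
    sin_pi_mul_shift, residueWeight]
  field_simp

lemma differentiableAt_regIntegrand (hq0 : 0 < q) (hq1 : q < 1) {d s : ℂ} {K : ℂ → ℂ}
    (hs : s ∉ increasingPoles d) (hK : DifferentiableAt ℂ K ((q : ℂ) ^ s)) :
    DifferentiableAt ℂ (regIntegrand q d K) s := by
  have h1 : DifferentiableAt ℂ (sinRatio q) s := differentiableAt_sinRatio hq0 hq1 fun n hn =>
    hs ⟨n, .inl hn⟩
  have h2 : DifferentiableAt ℂ (sinRatio q) (s + d - 1) := differentiableAt_sinRatio hq0 hq1
    fun n hn => hs ⟨n, .inr (by linear_combination hn)⟩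
  have h3 : DifferentiableAt ℂ (fun s => sinRatio q (s + d - 1)) s :=
    DifferentiableAt.comp s h2 (by fun_prop)
  have h4 : DifferentiableAt ℂ (fun s : ℂ => K ((q : ℂ) ^ s)) s :=
    DifferentiableAt.comp s hK (differentiable_cpow hq0 s)
  exact ((((h1.const_mul _).mul h3).mul (differentiable_cpow hq0 s)).mul h4).neg

lemma meromorphicAt_regIntegrand (hq0 : 0 < q) (hq1 : q < 1) (d s : ℂ) {K : ℂ → ℂ}
    (hK : MeromorphicAt (fun s : ℂ => K ((q : ℂ) ^ s)) s) :
    MeromorphicAt (regIntegrand q d K) s := by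
  have h2 : MeromorphicAt (fun s => sinRatio q (s + d - 1)) s :=
    (meromorphicAt_sinRatio hq0 hq1 (s + d - 1)).comp_analyticAt
      (f := sinRatio q) (g := fun s => s + d - 1) (by fun_prop)
  have h3 : MeromorphicAt (fun s : ℂ => (q : ℂ) ^ s) s :=
    ((differentiable_cpow hq0).analyticAt s).meromorphicAt
  exact (((((MeromorphicAt.const _ s).mul (meromorphicAt_sinRatio hq0 hq1 s)).mul h2).mul h3).mul
    hK).neg

lemma sin_pi_mul_ne_zero_of_ne_int {d : ℂ} (hd : ∀ n : ℤ, d ≠ n) : sin ((Real.pi : ℂ) * d) ≠ 0 :=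
  fun h => by
    obtain ⟨k, hk⟩ := (sin_pi_mul_eq_zero_iff d).1 h
    exact hd k hk

lemma tendsto_sub_mul_regIntegrand_nat (hq0 : 0 < q) (hq1 : q < 1) {d : ℂ} (hd : ∀ n : ℤ, d ≠ n)
    {K : ℂ → ℂ} (n : ℕ) (hK : ContinuousAt K ((q : ℂ) ^ (n : ℂ))) :
    Tendsto (fun s => (s - n) * regIntegrand q d K s) (𝓝[≠] (n : ℂ))
      (𝓝 (residueWeight q d K ((q : ℂ) ^ (n : ℂ)) / sin (Real.pi * d))) := by
  have hpi : (Real.pi : ℂ) ≠ 0 := by exact_mod_cast Real.pi_ne_zero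
  have hsd := sin_pi_mul_ne_zero_of_ne_int hd
  have hsin : sin ((Real.pi : ℂ) * (d + n)) = sin (Real.pi * d) * cos (Real.pi * n) := by
    rw [mul_add, Complex.sin_add, sin_pi_mul_nat]; ring
  have hc2 := cos_pi_mul_nat_sq n
  have hc0 : cos ((Real.pi : ℂ) * n) ≠ 0 := fun h => by rw [h] at hc2; norm_num at hc2
  have hne : sin ((Real.pi : ℂ) * (n + d - 1)) ≠ 0 := by
    rw [sin_pi_mul_shift, hsin]
    exact neg_ne_zero.2 (mul_ne_zero hsd hc0)
  have c1 : ContinuousAt (fun s => sinRatio q (s + d - 1)) (n : ℂ) := by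
    refine ContinuousAt.comp (f := fun s : ℂ => s + d - 1) (g := sinRatio q)
      (differentiableAt_sinRatio hq0 hq1 fun m hm => ?_).continuousAt (by fun_prop)
    exact hd (m - n + 1) (by push_cast; linear_combination hm)
  have c2 : ContinuousAt (fun s : ℂ => (q : ℂ) ^ s) (n : ℂ) :=
    (differentiable_cpow hq0 _).continuousAt
  have c3 : ContinuousAt (fun s : ℂ => K ((q : ℂ) ^ s)) (n : ℂ) := ContinuousAt.comp hK c2
  have c := (((c1.tendsto.mul c2.tendsto).mul c3.tendsto).mono_left
    (nhdsWithin_le_nhds (s := {(n : ℂ)}ᶜ)))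
  have lim := ((tendsto_sub_mul_sinRatio hq0 hq1 n).mul c).const_mul (-(Real.pi : ℂ))
  refine (lim.congr fun s => ?_).trans (le_of_eq ?_)
  · simp only [regIntegrand]; ring
  · congr 1
    rw [sinRatio_of_ne hne, sin_pi_mul_shift, hsin, sinZeros_shift hq0, sinZeros_eq hq0,
      residueWeight]
    generalize cos ((Real.pi : ℂ) * n) = c at *
    generalize qPochInf (↑q ^ d * ↑q ^ (n : ℂ)) ↑q = P
    generalize qPochInf (↑q * ↑q ^ (n : ℂ)) ↑q = R
    field_simp
    linear_combination -(↑q ^ (n : ℂ) * R * P * K (↑q ^ (n : ℂ))) * hc2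

lemma tendsto_sub_mul_regIntegrand_shift (hq0 : 0 < q) (hq1 : q < 1) {d : ℂ}
    (hd : ∀ n : ℤ, d ≠ n) {K : ℂ → ℂ} (n : ℕ) (hK : ContinuousAt K ((q : ℂ) ^ (1 - d + n))) :
    Tendsto (fun s => (s - (1 - d + n)) * regIntegrand q d K s) (𝓝[≠] (1 - d + n))
      (𝓝 (-(residueWeight q d K ((q : ℂ) ^ (1 - d + n)) / sin (Real.pi * d)))) := by
  have hpi : (Real.pi : ℂ) ≠ 0 := by exact_mod_cast Real.pi_ne_zero
  have hsd := sin_pi_mul_ne_zero_of_ne_int hd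
  have hsin : sin ((Real.pi : ℂ) * (1 - d + n)) = sin (Real.pi * d) * cos (Real.pi * n) := by
    rw [show (Real.pi : ℂ) * (1 - d + n) = Real.pi - (Real.pi * d - Real.pi * n) by ring,
      Complex.sin_pi_sub, Complex.sin_sub, sin_pi_mul_nat]; ring
  have hc2 := cos_pi_mul_nat_sq n
  have hc0 : cos ((Real.pi : ℂ) * n) ≠ 0 := fun h => by rw [h] at hc2; norm_num at hc2
  have hne : sin ((Real.pi : ℂ) * (1 - d + n)) ≠ 0 := by
    rw [hsin]
    exact mul_ne_zero hsd hc0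
  have c1 : ContinuousAt (sinRatio q) (1 - d + n) := by
    refine (differentiableAt_sinRatio hq0 hq1 fun m hm => ?_).continuousAt
    exact hd (1 + n - m) (by push_cast; linear_combination -hm)
  have c2 : ContinuousAt (fun s : ℂ => (q : ℂ) ^ s) (1 - d + n) :=
    (differentiable_cpow hq0 _).continuousAt
  have c3 : ContinuousAt (fun s : ℂ => K ((q : ℂ) ^ s)) (1 - d + n) :=
    ContinuousAt.comp (f := fun s : ℂ => (q : ℂ) ^ s) hK c2
  have c := (((c1.tendsto.mul c2.tendsto).mul c3.tendsto).mono_left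
    (nhdsWithin_le_nhds (s := {(1 - d + n : ℂ)}ᶜ)))
  have hsh : Tendsto (fun s : ℂ => s + d - 1) (𝓝[≠] (1 - d + n)) (𝓝[≠] (n : ℂ)) := by
    refine tendsto_nhdsWithin_of_tendsto_nhds_of_eventually_within _ ?_ ?_
    · have : ContinuousAt (fun s : ℂ => s + d - 1) (1 - d + n) := by fun_prop
      have h2 := this.tendsto
      rw [show (1 - d + n + d - 1 : ℂ) = n by ring] at h2
      exact h2.mono_left nhdsWithin_le_nhds
    · filter_upwards [self_mem_nhdsWithin] with s hs hs'
      have hs2 : s + d - 1 = (n : ℂ) := hs'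
      exact hs (show s = _ by linear_combination hs2)
  have lim := (((tendsto_sub_mul_sinRatio hq0 hq1 n).comp hsh).mul c).const_mul (-(Real.pi : ℂ))
  refine (lim.congr fun s => ?_).trans (le_of_eq ?_)
  · simp only [regIntegrand, Function.comp]; ring
  · congr 1
    rw [sinRatio_of_ne hne, hsin, residueWeight, ← sinZeros_eq hq0, ← sinZeros_shift hq0,
      show (1 - d + n + d - 1 : ℂ) = n by ring]
    generalize cos ((Real.pi : ℂ) * n) = c at *
    field_simp
    linear_combination (sinZeros q (1 - d + ↑n) * sinZeros q ↑n *
      ↑q ^ (1 - d + (n : ℂ)) * K (↑q ^ (1 - d + (n : ℂ)))) * hc2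

/-- The integrand decays at least as fast as the two cosecants times `q ^ s`. -/
lemma exists_norm_regIntegrand_le (hq0 : 0 < q) (hq1 : q < 1) (d : ℂ) {K : ℂ → ℂ} {σ : ℝ}
    (hK : ContinuousOn K (Metric.closedBall 0 (q ^ σ))) :
    ∃ M : ℝ, 0 < M ∧ ∀ s : ℂ, σ ≤ s.re → ∀ δ : ℝ, 0 < δ →
      δ ≤ ‖sin ((Real.pi : ℂ) * s)‖ * ‖sin ((Real.pi : ℂ) * (d + s))‖ →
      ‖regIntegrand q d K s‖ ≤ M * q ^ s.re / δ := by
  have hq := norm_ofReal_lt_one hq0 hq1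
  obtain ⟨M₁, hM₁⟩ := (isCompact_closedBall (0 : ℂ) (q ^ σ)).exists_bound_of_continuousOn hK
  obtain ⟨M₂, p₂, h₂⟩ := exists_norm_qPochInf_le hq (‖(q : ℂ)‖ * q ^ σ)
  obtain ⟨M₃, p₃, h₃⟩ := exists_norm_qPochInf_le hq (‖(q : ℂ) ^ d‖ * q ^ σ)
  refine ⟨Real.pi * (M₂ * M₃) * max M₁ 1, by positivity, fun s hs δ hδ hle => ?_⟩
  have hne : ‖sin ((Real.pi : ℂ) * s)‖ * ‖sin ((Real.pi : ℂ) * (d + s))‖ ≠ 0 := by linarith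
  have hx : ‖(q : ℂ) ^ s‖ ≤ q ^ σ := by
    rw [norm_cpow hq0]
    exact Real.rpow_le_rpow_of_exponent_ge hq0 hq1.le hs
  rw [regIntegrand_of_ne hq0 K (norm_ne_zero_iff.1 (left_ne_zero_of_mul hne))
    (norm_ne_zero_iff.1 (right_ne_zero_of_mul hne)), residueWeight, norm_div, norm_mul (sin _)]
  have b1 := (hM₁ ((q : ℂ) ^ s) (by simpa using hx)).trans (le_max_left M₁ 1)
  have b2 := h₂ (q * (q : ℂ) ^ s) (by rw [norm_mul]; gcongr)
  have b3 := h₃ ((q : ℂ) ^ d * (q : ℂ) ^ s) (by rw [norm_mul]; gcongr)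
  have hpi : ‖(Real.pi : ℂ)‖ = Real.pi := by simp [abs_of_pos Real.pi_pos]
  simp only [norm_mul, hpi]
  rw [← norm_cpow hq0]
  calc _ ≤ Real.pi * (‖(q : ℂ) ^ s‖ * (M₂ * M₃) * max M₁ 1) / δ := by gcongr
    _ = _ := by ring

end Regularised

/-! ### The integral as a sum of residues -/

section ResidueSum

open Complex MeasureTheory Set

variable {q : ℝ}

/-- Off the zeros of its derivative a path meets a countable set only in a null set of
parameters. -/
lemma ae_deriv_eq_zero_of_mem_countable {γ : ℝ → ℂ} {S : Set ℂ} (hS : S.Countable) :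
    ∀ᵐ t : ℝ, γ t ∈ S → deriv γ t = 0 := by
  have h : ∀ p ∈ S, ∀ᵐ t : ℝ, ¬(γ t = p ∧ deriv γ t ≠ 0) := fun p _ => by
    rw [ae_iff]
    refine measure_null_of_locally_null _ fun t ht => ⟨{t}, ?_, by simp⟩
    simp only [not_not, mem_ofPred_eq] at ht
    have hd : DifferentiableAt ℝ γ t := by
      by_contra hnd
      exact ht.2 (deriv_zero_of_not_differentiableAt hnd)
    have hev := hd.hasDerivAt.eventually_ne (c := p) ht.2
    rw [eventually_nhdsWithin_iff] at hev
    rw [mem_nhdsWithin_iff_eventually]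
    filter_upwards [hev] with u hu hu'
    simp only [not_not] at hu'
    by_contra hne
    exact hu hne hu'.1
  have h2 := (ae_ball_iff hS).2 h
  filter_upwards [h2] with t ht hmem
  by_contra hne
  exact ht (γ t) hmem ⟨rfl, hne⟩

/-- A set of points to the left of the contour which is invariant under translation by an imaginary
period lies to the left of both ends of the contour. -/
lemma re_lt_of_periodic {γ : ℝ → ℂ} (hγ : IsVerticalContour γ) {σ₁ σ₂ T₀ : ℝ}
    (hE : HasEnds γ σ₁ σ₂ T₀) {D : Set ℂ} {ω : ℝ} (hω : 0 < ω)
    (hper : ∀ p ∈ D, ∀ k : ℤ, p + ((k * ω : ℝ) : ℂ) * I ∈ D)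
    (hleft : ∀ p ∈ D, LiesLeftOf γ p) {p : ℂ} (hp : p ∈ D) : p.re < σ₁ ∧ p.re < σ₂ := by
  obtain ⟨B, hB⟩ := hE.exists_tendsto_truncatedIndex hγ
  have hcontra : ∀ p ∈ D, ¬ Tendsto (truncatedIndex γ p) atTop (𝓝 (-1 / 2)) := fun p hp h => by
    have := tendsto_nhds_unique (hleft p hp).2 h
    norm_num at this
  constructor
  · by_contra! hle
    obtain ⟨k, hk⟩ := exists_nat_gt ((max B T₀ + p.im) / ω)
    rw [div_lt_iff₀ hω] at hk
    have hm := hper p hp (-(k : ℤ))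
    set p' := p + (((-(k : ℤ) : ℤ) * ω : ℝ) : ℂ) * I with hp'
    have hre : p'.re = p.re := by simp [hp']
    have him : p'.im = p.im - k * ω := by simp [hp']; ring
    have hB1 := le_max_left B T₀
    have hB2 := le_max_right B T₀
    rcases hle.eq_or_lt with heq | hlt
    · refine (hleft p' hm).1 ⟨p'.im, ?_⟩
      rw [hE.lower _ (by linarith), heq, ← hre]
      exact re_add_im p'
    · exact hcontra p' hm (hB p' (.inr ⟨by linarith, by linarith⟩))
  · by_contra! hle
    obtain ⟨k, hk⟩ := exists_nat_gt ((max B T₀ - p.im) / ω)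
    rw [div_lt_iff₀ hω] at hk
    have hm := hper p hp (k : ℤ)
    set p' := p + ((((k : ℤ) : ℤ) * ω : ℝ) : ℂ) * I with hp'
    have hre : p'.re = p.re := by simp [hp']
    have him : p'.im = p.im + k * ω := by simp [hp']
    have hB1 := le_max_left B T₀
    have hB2 := le_max_right B T₀
    rcases hle.eq_or_lt with heq | hlt
    · refine (hleft p' hm).1 ⟨p'.im, ?_⟩
      rw [hE.upper _ (by linarith), heq, ← hre]
      exact re_add_im p'
    · exact hcontra p' hm (hB p' (.inl ⟨by linarith, by linarith⟩))

lemma integrable_const_mul_inv_one_add_sq (C : ℝ) :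
    Integrable fun t : ℝ => C * (1 + t ^ 2)⁻¹ :=
  integrable_inv_one_add_sq.const_mul C

lemma exists_norm_regIntegrand_le_of_im (hq0 : 0 < q) (hq1 : q < 1) (d : ℂ) {K : ℂ → ℂ} {σ : ℝ}
    (hK : ContinuousOn K (Metric.closedBall 0 (q ^ σ))) :
    ∃ C T : ℝ, 0 < C ∧ ∀ s : ℂ, σ ≤ s.re → T ≤ |s.im| →
      ‖regIntegrand q d K s‖ ≤ C * (1 + s.im ^ 2)⁻¹ := by
  obtain ⟨M, hM, h⟩ := exists_norm_regIntegrand_le hq0 hq1 d hK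
  refine ⟨4 * (M * q ^ σ), 2 * |d.im| + 1, by positivity, fun s hs him => ?_⟩
  have hd := abs_nonneg d.im
  have hpi := Real.pi_gt_three
  have b1 : |s.im| ≤ ‖sin ((Real.pi : ℂ) * s)‖ := by
    refine le_trans ?_ (abs_im_le_norm_sin _)
    rw [im_ofReal_mul, abs_mul, abs_of_pos Real.pi_pos]
    nlinarith
  have b2 : |s.im| / 2 ≤ ‖sin ((Real.pi : ℂ) * (d + s))‖ := by
    refine le_trans ?_ (abs_im_le_norm_sin _)
    rw [im_ofReal_mul, abs_mul, abs_of_pos Real.pi_pos, add_im]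
    have h1 : |s.im| - |d.im| ≤ |d.im + s.im| := by
      have := abs_sub_abs_le_abs_sub s.im (-d.im)
      rw [abs_neg, sub_neg_eq_add, add_comm s.im] at this
      exact this
    nlinarith
  have hsq : s.im ^ 2 = |s.im| ^ 2 := (sq_abs _).symm
  have hδ : (1 + s.im ^ 2) / 4 ≤ ‖sin ((Real.pi : ℂ) * s)‖ * ‖sin ((Real.pi : ℂ) * (d + s))‖ := by
    refine le_trans ?_ (mul_le_mul b1 b2 (by positivity) (by positivity))
    rw [hsq]
    nlinarith
  refine (h s hs _ (by positivity) hδ).trans ?_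
  have hqs : q ^ s.re ≤ q ^ σ := Real.rpow_le_rpow_of_exponent_ge hq0 hq1.le hs
  calc M * q ^ s.re / ((1 + s.im ^ 2) / 4) ≤ M * q ^ σ / ((1 + s.im ^ 2) / 4) := by gcongr
    _ = _ := by field_simp

lemma one_add_sq_le_cosh_pi_mul (y : ℝ) : 1 + y ^ 2 ≤ Real.cosh (Real.pi * y) := by
  have h1 : ∀ u : ℝ, u ^ 2 ≤ Real.sinh u ^ 2 := fun u => by
    rcases le_total 0 u with hu | hu
    · exact pow_le_pow_left₀ hu (Real.self_le_sinh_iff.2 hu) 2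
    · nlinarith [Real.sinh_le_self_iff.2 hu]
  have h2 := h1 (Real.pi * y / 2)
  have h3 : Real.cosh (Real.pi * y) = 1 + 2 * Real.sinh (Real.pi * y / 2) ^ 2 := by
    rw [show Real.pi * y = 2 * (Real.pi * y / 2) by ring, Real.cosh_two_mul, Real.cosh_sq]
    ring_nf
  have h4 := Real.pi_gt_three
  nlinarith [mul_nonneg (sq_nonneg y) (by nlinarith : (0 : ℝ) ≤ Real.pi ^ 2 - 2)]

lemma abs_sin_pi_mul_add_nat (x : ℝ) (k : ℕ) :
    |Real.sin (Real.pi * (x + k))| = |Real.sin (Real.pi * x)| := by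
  rw [mul_add, mul_comm Real.pi (k : ℝ), Real.sin_add_nat_mul_pi, abs_mul, abs_pow, abs_neg,
    abs_one, one_pow, one_mul]

/-- On the lines `Re s = R + k` the integrand is dominated by a fixed integrable function times
`q ^ (R + k)`. -/
lemma exists_norm_regIntegrand_line_le (hq0 : 0 < q) (hq1 : q < 1) (d : ℂ) {K : ℂ → ℂ} {σ R : ℝ}
    (hK : ContinuousOn K (Metric.closedBall 0 (q ^ σ))) (h1 : Real.sin (Real.pi * R) ≠ 0)
    (h2 : Real.sin (Real.pi * (R + d.re)) ≠ 0) :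
    ∃ C : ℝ, ∀ k : ℕ, σ ≤ R + k → ∀ y : ℝ,
      ‖regIntegrand q d K (((R + k : ℝ) : ℂ) + (y : ℂ) * I)‖ ≤
        C * q ^ (R + k) * (1 + y ^ 2)⁻¹ := by
  obtain ⟨M, hM, h⟩ := exists_norm_regIntegrand_le hq0 hq1 d hK
  have p1 := abs_pos.2 h1
  have p2 := abs_pos.2 h2
  refine ⟨M / (|Real.sin (Real.pi * R)| * |Real.sin (Real.pi * (R + d.re))|), fun k hk y => ?_⟩
  set s : ℂ := ((R + k : ℝ) : ℂ) + (y : ℂ) * I with hs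
  have hre : s.re = R + k := by simp [hs]
  have him : s.im = y := by simp [hs]
  have b1 : |Real.sin (Real.pi * R)| * (1 + y ^ 2) ≤ ‖sin ((Real.pi : ℂ) * s)‖ := by
    refine le_trans ?_ (abs_sin_re_mul_cosh_le _)
    rw [re_ofReal_mul, im_ofReal_mul, hre, him, abs_sin_pi_mul_add_nat]
    gcongr
    exact one_add_sq_le_cosh_pi_mul y
  have b2 : |Real.sin (Real.pi * (R + d.re))| ≤ ‖sin ((Real.pi : ℂ) * (d + s))‖ := by
    refine le_trans ?_ (abs_sin_re_mul_cosh_le _)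
    rw [re_ofReal_mul, add_re, hre, show d.re + (R + k) = R + d.re + k by ring,
      abs_sin_pi_mul_add_nat]
    exact le_mul_of_one_le_right (abs_nonneg _) (Real.one_le_cosh _)
  have := h s (by rw [hre]; exact hk) _ (by positivity)
    (mul_le_mul b1 b2 p2.le ((by positivity : (0 : ℝ) ≤ _).trans b1))
  refine this.trans (le_of_eq ?_)
  rw [hre]
  field_simp

/-- None of the lines `Re s = R + k` with `k ∈ ℤ` meets the zeros of the two sines, for suitable
`R`; here `x = Re d`. -/
lemma exists_line_avoiding (x : ℝ) :
    ∃ R : ℝ, (∀ n : ℤ, R ≠ n) ∧ ∀ n : ℤ, R + x ≠ n := by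
  have hc : (range (fun n : ℤ => (n : ℝ)) ∪ range (fun n : ℤ => (n : ℝ) - x)).Countable :=
    (countable_range _).union (countable_range _)
  obtain ⟨R, hR⟩ := (hc.dense_compl ℝ).nonempty
  simp only [mem_compl_iff, mem_union, mem_range, not_or, not_exists] at hR
  exact ⟨R, fun n hn => hR.1 n hn.symm, fun n hn => hR.2 n (by linarith)⟩

lemma sin_pi_mul_ne_zero_of_real {x : ℝ} (hx : ∀ n : ℤ, x ≠ n) : Real.sin (Real.pi * x) ≠ 0 :=
  fun h => by
    obtain ⟨n, hn⟩ := Real.sin_eq_zero_iff.1 h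
    rw [mul_comm, mul_right_inj' Real.pi_ne_zero] at hn
    exact hx n hn.symm

lemma tendsto_finset_atTop_of_eventually_mem {F : ℕ → Finset ℕ} (h : ∀ n, ∀ᶠ k in atTop, n ∈ F k) :
    Tendsto F atTop atTop :=
  tendsto_atTop.2 fun s =>
    ((eventually_all_finset s).2 fun n _ => h n).mono fun _ hk n hn => hk n hn

lemma tendsto_range_ceil (R : ℝ) :
    Tendsto (fun k : ℕ => Finset.range ⌈R + k⌉₊) atTop atTop := by
  refine tendsto_finset_atTop_of_eventually_mem fun n => ?_
  obtain ⟨m, hm⟩ := exists_nat_gt ((n : ℝ) - R)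
  filter_upwards [eventually_ge_atTop m] with k hk
  rw [Finset.mem_range, Nat.lt_ceil]
  have : (m : ℝ) ≤ k := by exact_mod_cast hk
  linarith

lemma summable_residueWeight (hq0 : 0 < q) (hq1 : q < 1) (d : ℂ) {K : ℂ → ℂ}
    (hK : ContinuousAt K 0) (y : ℂ) :
    Summable fun n : ℕ => residueWeight q d K (y * (q : ℂ) ^ n) := by
  have hq := norm_ofReal_lt_one hq0 hq1
  have hc : ∀ a : ℂ, ContinuousAt (fun x => qPochInf (a * x) q) 0 := fun a =>
    ((continuous_qPochInf hq).comp (continuous_const.mul continuous_id)).continuousAt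
  refine (summable_mul_comp_mul_pow hq
    (f := fun x => qPochInf (q * x) q * qPochInf ((q : ℂ) ^ d * x) q * K x)
    (((hc _).mul (hc _)).mul hK) y).congr fun n => ?_
  rw [residueWeight]
  ring

/-- The Barnes integral as the difference of two series of residues, for an arbitrary factor `K`
of the integrand that is analytic in `q ^ s` off a periodic set `D` of poles. -/
theorem integral_regIntegrand (hq0 : 0 < q) (hq1 : q < 1) {d : ℂ} (hd : ∀ n : ℤ, d ≠ n)
    {γ : ℝ → ℂ} (hγ : IsVerticalContour γ) {K : ℂ → ℂ} {D : Set ℂ} {ω : ℝ} (hω : 0 < ω)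
    (hper : ∀ p ∈ D, ∀ k : ℤ, p + ((k * ω : ℝ) : ℂ) * I ∈ D)
    (hfin : ∀ r : ℝ, (D ∩ Metric.closedBall 0 r).Finite)
    (hKd : ∀ s ∉ D, DifferentiableAt ℂ K ((q : ℂ) ^ s))
    (hKm : ∀ s, MeromorphicAt (fun s : ℂ => K ((q : ℂ) ^ s)) s)
    (hKb : ∀ σ : ℝ, (∀ p ∈ D, p.re < σ) → ContinuousOn K (Metric.closedBall 0 (q ^ σ)))
    (hleft : ∀ p ∈ D, LiesLeftOf γ p) (hright : ∀ p ∈ increasingPoles d, LiesRightOf γ p) :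
    Integrable (fun t => regIntegrand q d K (γ t) * deriv γ t) ∧
    1 / (2 * (Real.pi : ℂ) * I) * ∫ t, regIntegrand q d K (γ t) * deriv γ t =
      -(1 / sin ((Real.pi : ℂ) * d)) *
        jacksonDiff q ((q : ℂ) ^ (1 - d)) (residueWeight q d K) := by
  classical
  have hq := norm_ofReal_lt_one hq0 hq1
  have hqne := ofReal_ne_zero_of_pos hq0
  obtain ⟨σ₁, σ₂, T₁, hE⟩ := hγ.exists_hasEnds
  have hre : ∀ p ∈ D, p.re < σ₁ ∧ p.re < σ₂ := fun p hp =>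
    re_lt_of_periodic hγ (hE T₁ le_rfl) hω hper hleft hp
  set σ := min σ₁ σ₂ with hσ
  have hσ₁ : σ ≤ σ₁ := min_le_left _ _
  have hσ₂ : σ ≤ σ₂ := min_le_right _ _
  have hKσ := hKb σ fun p hp => lt_min (hre p hp).1 (hre p hp).2
  have hK0 : ContinuousAt K 0 :=
    hKσ.continuousAt (Metric.closedBall_mem_nhds _ (Real.rpow_pos_of_pos hq0 _))
  set h := regIntegrand q d K with hh
  have hdisj : ∀ p ∈ increasingPoles d, p ∉ D := fun p hp hpD => by
    have := tendsto_nhds_unique (hleft p hpD).2 (hright p hp).2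
    norm_num at this
  have hdiff : ∀ z, z ∉ D ∪ increasingPoles d → DifferentiableAt ℂ h z := fun z hz =>
    differentiableAt_regIntegrand hq0 hq1 (fun h => hz (.inr h)) (hKd z fun h => hz (.inl h))
  have hγn : ∀ t, γ t ∉ D ∪ increasingPoles d := fun t ht => by
    rcases ht with ht | ht
    · exact (hleft _ ht).1 ⟨t, rfl⟩
    · exact (hright _ ht).1 ⟨t, rfl⟩
  obtain ⟨C, T, hC, htail⟩ := exists_norm_regIntegrand_le_of_im hq0 hq1 d hKσ
  -- integrability along the contour
  have hhγ : Continuous fun t => h (γ t) := continuous_iff_continuousAt.2 fun t =>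
    ContinuousAt.comp (f := γ) (g := h) (hdiff _ (hγn t)).continuousAt hγ.continuous.continuousAt
  have hint : Integrable fun t => h (γ t) * deriv γ t := by
    obtain ⟨Cd, hCd⟩ := hγ.bounded_deriv
    set T' := max T₁ T with hT'
    have hT₁ := (hE T₁ le_rfl).pos
    obtain ⟨C', hC'⟩ := (isCompact_Icc (a := -T') (b := T')).exists_bound_of_continuousOn
      hhγ.continuousOn
    have hT1' : T₁ ≤ T' := le_max_left _ _
    have hT2' : T ≤ T' := le_max_right _ _
    have hCd0 : 0 ≤ Cd := (norm_nonneg _).trans (hCd 0)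
    have hC'0 : 0 ≤ C' := (norm_nonneg _).trans (hC' 0 ⟨by linarith, by linarith⟩)
    refine Integrable.mono' (integrable_const_mul_inv_one_add_sq ((C + C' * (1 + T' ^ 2)) * Cd))
      (hhγ.aestronglyMeasurable.mul (measurable_deriv γ).aestronglyMeasurable)
      (Eventually.of_forall fun t => ?_)
    have hb : ‖h (γ t)‖ ≤ (C + C' * (1 + T' ^ 2)) * (1 + t ^ 2)⁻¹ := by
      have hpos : 0 < (1 + t ^ 2)⁻¹ := by positivity
      have hn1 : 0 ≤ C' * (1 + T' ^ 2) * (1 + t ^ 2)⁻¹ := by positivity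
      rcases le_total t (-T') with ht | ht
      · have e := hE T₁ le_rfl |>.lower t (by linarith)
        have := htail (γ t) (by rw [e]; simpa using hσ₁) (by
          rw [e]; simp only [add_im, ofReal_im, mul_im, ofReal_re, I_re, I_im, mul_one, mul_zero,
            zero_add, add_zero]
          linarith [neg_le_abs t])
        rw [show (γ t).im = t by rw [e]; simp] at this
        linarith
      · rcases le_total T' t with ht' | ht'
        · have e := hE T₁ le_rfl |>.upper t (by linarith)
          have := htail (γ t) (by rw [e]; simpa using hσ₂) (by
            rw [e]; simp only [add_im, ofReal_im, mul_im, ofReal_re, I_re, I_im, mul_one, mul_zero,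
              zero_add, add_zero]
            linarith [le_abs_self t])
          rw [show (γ t).im = t by rw [e]; simp] at this
          linarith
        · have h1 := hC' t ⟨ht, ht'⟩
          have h2 : 1 ≤ (1 + T' ^ 2) * (1 + t ^ 2)⁻¹ := by
            rw [← div_eq_mul_inv, one_le_div (by positivity)]
            nlinarith
          have h3 : 0 ≤ C * (1 + t ^ 2)⁻¹ := by positivity
          nlinarith
    rw [norm_mul, mul_right_comm]
    exact mul_le_mul hb (hCd t) (norm_nonneg _) ((norm_nonneg _).trans hb)
  refine ⟨hint, ?_⟩
  obtain ⟨R, hR1, hR2⟩ := exists_line_avoiding d.re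
  obtain ⟨CR, hCR⟩ := exists_norm_regIntegrand_line_le hq0 hq1 d hKσ
    (sin_pi_mul_ne_zero_of_real hR1) (sin_pi_mul_ne_zero_of_real hR2)
  -- the residues
  set w := residueWeight q d K with hw
  set ρ : ℂ → ℂ := fun p => if ∃ n : ℕ, p = n then w ((q : ℂ) ^ p) / sin (Real.pi * d)
    else -(w ((q : ℂ) ^ p) / sin (Real.pi * d)) with hρ
  have hne : ∀ m n : ℕ, (1 - d + m : ℂ) ≠ n := fun m n hmn =>
    hd (1 + m - n) (by push_cast; linear_combination -hmn)
  have hρ1 : ∀ n : ℕ, ρ n = w ((q : ℂ) ^ (n : ℂ)) / sin (Real.pi * d) := fun n =>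
    if_pos ⟨n, rfl⟩
  have hρ2 : ∀ n : ℕ, ρ (1 - d + n) = -(w ((q : ℂ) ^ (1 - d + n)) / sin (Real.pi * d)) := fun n =>
    if_neg fun ⟨m, hm⟩ => hne n m hm
  have hres : ∀ p ∈ increasingPoles d, Tendsto (fun z => (z - p) * h z) (𝓝[≠] p) (𝓝 (ρ p)) := by
    intro p hp
    have hKp := (hKd p (hdisj p hp)).continuousAt
    obtain ⟨n, rfl | rfl⟩ := hp
    · rw [hρ1]
      exact tendsto_sub_mul_regIntegrand_nat hq0 hq1 hd n hKp
    · rw [hρ2]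
      exact tendsto_sub_mul_regIntegrand_shift hq0 hq1 hd n hKp
  have hfin' : ∀ r : ℝ, ((D ∪ increasingPoles d) ∩ Metric.closedBall 0 r).Finite := fun r => by
    have f1 := finite_zeros_inter_closedBall differentiable_sin_pi_mul (z₀ := d)
      (sin_pi_mul_ne_zero_of_ne_int hd) r
    have f2 := finite_zeros_inter_closedBall
      (N := fun s : ℂ => sin ((Real.pi : ℂ) * (s + d - 1))) (z₀ := 1)
      (differentiable_sin_pi_mul.comp (by fun_prop : Differentiable ℂ fun s : ℂ => s + d - 1))
      (by simpa using sin_pi_mul_ne_zero_of_ne_int hd) r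
    refine ((hfin r).union (f1.union f2)).subset fun z hz => ?_
    rcases hz.1 with hzD | ⟨n, rfl | rfl⟩
    · exact .inl ⟨hzD, hz.2⟩
    · exact .inr (.inl ⟨sin_pi_mul_nat n, hz.2⟩)
    · refine .inr (.inr ⟨?_, hz.2⟩)
      rw [mem_ofPred_eq, show (1 - d + n + d - 1 : ℂ) = n by ring]
      exact sin_pi_mul_nat n
  have hbt : Tendsto (fun T : ℝ => C * (1 + T ^ 2)⁻¹) atTop (𝓝 0) := by
    have : Tendsto (fun T : ℝ => (1 + T ^ 2)⁻¹) atTop (𝓝 0) :=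
      tendsto_inv_atTop_zero.comp
        (tendsto_atTop_add_const_left _ _ (tendsto_pow_atTop two_ne_zero))
    simpa using this.const_mul C
  have hqn : ∀ n : ℕ, (q : ℂ) ^ (n : ℂ) = (q : ℂ) ^ n := fun n => cpow_natCast _ _
  have hqd : ∀ n : ℕ, (q : ℂ) ^ (1 - d + n) = (q : ℂ) ^ (1 - d) * (q : ℂ) ^ n := fun n => by
    rw [cpow_add _ _ hqne, hqn]
  -- the contour integral compared with the line through `R + k`
  have hshift : ∀ᶠ k : ℕ in atTop, (∫ t, h (γ t) * deriv γ t) -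
      I * ∫ y : ℝ, h (((R + k : ℝ) : ℂ) + (y : ℂ) * I) = -(2 * Real.pi * I) *
        (1 / sin ((Real.pi : ℂ) * d) * (∑ n ∈ Finset.range ⌈R + k⌉₊, w ((q : ℂ) ^ n) -
          ∑ n ∈ Finset.range ⌈(R + d.re - 1) + k⌉₊, w ((q : ℂ) ^ (1 - d) * (q : ℂ) ^ n))) := by
    obtain ⟨k₀, hk₀⟩ := exists_nat_gt (max σ₁ σ₂ - R)
    filter_upwards [eventually_ge_atTop k₀] with k hk
    have hk' : (k₀ : ℝ) ≤ k := by exact_mod_cast hk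
    have hR₁ : σ₁ ≤ R + k := by linarith [le_max_left σ₁ σ₂]
    have hR₂ : σ₂ ≤ R + k := by linarith [le_max_right σ₁ σ₂]
    set PR : Finset ℂ := (Finset.range ⌈R + k⌉₊).image (fun n : ℕ => (n : ℂ)) ∪
      (Finset.range ⌈(R + d.re - 1) + k⌉₊).image (fun n : ℕ => (1 - d + n : ℂ)) with hPR
    have hmem : ∀ p, p ∈ PR ↔ p ∈ increasingPoles d ∧ p.re < R + k := fun p => by
      simp only [hPR, Finset.mem_union, Finset.mem_image, Finset.mem_range, Nat.lt_ceil,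
        increasingPoles, mem_ofPred_eq]
      constructor
      · rintro (⟨n, hn, rfl⟩ | ⟨n, hn, rfl⟩)
        · exact ⟨⟨n, .inl rfl⟩, by simpa using hn⟩
        · exact ⟨⟨n, .inr rfl⟩, by simp; linarith⟩
      · rintro ⟨⟨n, rfl | rfl⟩, hlt⟩
        · exact .inl ⟨n, by simpa using hlt, rfl⟩
        · refine .inr ⟨n, ?_, rfl⟩
          simp at hlt
          linarith
    have hiR : Integrable fun y : ℝ => h (((R + k : ℝ) : ℂ) + (y : ℂ) * I) := by
      refine Integrable.mono' (integrable_const_mul_inv_one_add_sq (CR * q ^ (R + k)))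
        (Continuous.aestronglyMeasurable (continuous_iff_continuousAt.2 fun y =>
          ContinuousAt.comp (f := fun y : ℝ => ((R + k : ℝ) : ℂ) + (y : ℂ) * I)
            (hdiff _ fun hy => ?_).continuousAt (by fun_prop)))
        (Eventually.of_forall fun y => hCR k (hσ₁.trans hR₁) y)
      rcases hy with hy | ⟨n, hy | hy⟩
      · have := (hre _ hy).1
        simp at this
        linarith
      · have := congrArg re hy
        simp at this
        exact hR1 (n - k) (by push_cast; linarith)
      · have := congrArg re hy
        simp at this
        exact hR2 (n - k + 1) (by push_cast; linarith)
    have main := integral_contour_sub_integral_line hγ (R := R + k) (B := |d.im|) hE hR₁ hR₂ hdiff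
      (fun z => meromorphicAt_regIntegrand hq0 hq1 d z (hKm z)) hfin'
      (fun p hp => ⟨(hre p hp).1, (hre p hp).2, hleft p hp⟩)
      (fun p hp => ⟨by obtain ⟨n, rfl | rfl⟩ := hp <;> simp, by
        obtain ⟨n, rfl | rfl⟩ := hp
        · intro e
          simp at e
          exact hR1 (n - k) (by push_cast; linarith)
        · intro e
          simp at e
          exact hR2 (n - k + 1) (by push_cast; linarith), hright p hp⟩) hres PR hmem
      (tendsto_integral_horizontal hbt (by
        filter_upwards [eventually_ge_atTop (max T 0)] with T' hT' x hx
        rw [uIcc_of_le hR₂] at hx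
        have := htail ((x : ℂ) + (T' : ℂ) * I) (by simpa using hσ₂.trans hx.1) (by
          simpa using (le_max_left T 0).trans (hT'.trans (le_abs_self T')))
        simpa using this))
      (tendsto_integral_horizontal hbt (by
        filter_upwards [eventually_ge_atTop (max T 0)] with T' hT' x hx
        rw [uIcc_of_le hR₁] at hx
        have := htail ((x : ℂ) + ((-T' : ℝ) : ℂ) * I) (by simpa using hσ₁.trans hx.1) (by
          simpa using (le_max_left T 0).trans (hT'.trans (le_abs_self T')))
        simpa using this)) hint hiR
    rw [main, hPR, Finset.sum_union, Finset.sum_image, Finset.sum_image]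
    · simp only [hρ1, hρ2, hqn, hqd]
      rw [Finset.sum_neg_distrib, ← Finset.sum_div, ← Finset.sum_div]
      ring
    · intro m _ n _ e
      simpa using e
    · intro m _ n _ e
      simpa using e
    · rw [Finset.disjoint_left]
      intro p hp hp'
      obtain ⟨m, -, rfl⟩ := Finset.mem_image.1 hp
      obtain ⟨n, -, hn⟩ := Finset.mem_image.1 hp'
      exact hne n m hn
  have hline : Tendsto (fun k : ℕ => ∫ y : ℝ, h (((R + k : ℝ) : ℂ) + (y : ℂ) * I)) atTop (𝓝 0) := by
    have hb : Tendsto (fun k : ℕ => CR * q ^ (R + k) * ∫ y : ℝ, (1 + y ^ 2)⁻¹) atTop (𝓝 0) := by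
      have : Tendsto (fun k : ℕ => CR * (q ^ R * q ^ k) * ∫ y : ℝ, (1 + y ^ 2)⁻¹) atTop
          (𝓝 (CR * (q ^ R * 0) * ∫ y : ℝ, (1 + y ^ 2)⁻¹)) :=
        (((tendsto_pow_atTop_nhds_zero_of_lt_one hq0.le hq1).const_mul _).const_mul _).mul_const _
      simp only [mul_zero, zero_mul] at this
      refine this.congr fun k => ?_
      rw [Real.rpow_add hq0, Real.rpow_natCast]
    refine squeeze_zero_norm' ?_ hb
    obtain ⟨k₀, hk₀⟩ := exists_nat_gt (σ - R)
    filter_upwards [eventually_ge_atTop k₀] with k hk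
    have hk' : (k₀ : ℝ) ≤ k := by exact_mod_cast hk
    rw [← integral_const_mul]
    exact norm_integral_le_of_norm_le (integrable_const_mul_inv_one_add_sq _)
      (Eventually.of_forall fun y => hCR k (by linarith) y)
  have s1 : HasSum (fun n : ℕ => w ((q : ℂ) ^ n)) (∑' n : ℕ, w ((q : ℂ) ^ n)) := by
    have := (summable_residueWeight hq0 hq1 d hK0 1).hasSum
    simpa using this
  have s2 := (summable_residueWeight hq0 hq1 d hK0 ((q : ℂ) ^ (1 - d))).hasSum
  have l1 := s1.comp (tendsto_range_ceil R)
  have l2 := s2.comp (tendsto_range_ceil (R + d.re - 1))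
  have lim1 := ((l1.sub l2).const_mul (1 / sin ((Real.pi : ℂ) * d))).const_mul
    (-(2 * (Real.pi : ℂ) * I))
  have lim2 := (tendsto_const_nhds (x := ∫ t, h (γ t) * deriv γ t)).sub (hline.const_mul I)
  rw [mul_zero, sub_zero] at lim2
  have hfinal := tendsto_nhds_unique lim2 (lim1.congr' (hshift.mono fun k hk => hk.symm))
  have hpi : (Real.pi : ℂ) ≠ 0 := by exact_mod_cast Real.pi_ne_zero
  rw [hfinal, jacksonDiff, ← hw]
  field_simp [I_ne_zero]

end ResidueSum

/-! ### The integrand as a quotient of entire functions of `q ^ s` -/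

section Assembly

open Complex MeasureTheory Set

variable {q : ℝ}

lemma exists_comp_cpow_ne_zero (hq0 : 0 < q) (hq1 : q < 1) {G : ℂ → ℂ} (hG : Differentiable ℂ G)
    (hG0 : G 0 ≠ 0) : ∃ z₀ : ℂ, G ((q : ℂ) ^ z₀) ≠ 0 := by
  have h := (hG.continuous.tendsto 0).comp
    (tendsto_pow_atTop_nhds_zero_of_norm_lt_one (norm_ofReal_lt_one hq0 hq1))
  obtain ⟨n, hn⟩ := (h.eventually_ne hG0).exists
  exact ⟨n, by simpa using hn⟩

lemma differentiable_comp_cpow (hq0 : 0 < q) {G : ℂ → ℂ} (hG : Differentiable ℂ G) :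
    Differentiable ℂ fun s : ℂ => G ((q : ℂ) ^ s) :=
  hG.comp (differentiable_cpow hq0)

lemma cpow_surjective (hq0 : 0 < q) (hq1 : q < 1) {x : ℂ} (hx : x ≠ 0) :
    ∃ s : ℂ, (q : ℂ) ^ s = x := by
  have hl : Complex.log q ≠ 0 := by
    rw [← ofReal_log hq0.le]
    exact_mod_cast (Real.log_neg hq0 hq1).ne
  refine ⟨Complex.log x / Complex.log q, ?_⟩
  rw [cpow_def_of_ne_zero (ofReal_ne_zero_of_pos hq0), mul_div_cancel₀ _ hl, exp_log hx]

lemma cpow_add_period (hq0 : 0 < q) (hq1 : q < 1) (s : ℂ) (k : ℤ) :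
    (q : ℂ) ^ (s + ((k * (-(2 * Real.pi) / Real.log q) : ℝ) : ℂ) * I) = (q : ℂ) ^ s := by
  have hl : (Real.log q : ℂ) ≠ 0 := by exact_mod_cast (Real.log_neg hq0 hq1).ne
  have hqne := ofReal_ne_zero_of_pos hq0
  rw [cpow_add _ _ hqne, cpow_def_of_ne_zero hqne (_ * I), ← ofReal_log hq0.le,
    show (Real.log q : ℂ) * (((k * (-(2 * Real.pi) / Real.log q) : ℝ) : ℂ) * I) =
      ((-k : ℤ) : ℂ) * (2 * Real.pi * I) by push_cast; field_simp,
    exp_int_mul_two_pi_mul_I, mul_one]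

/-- The Barnes integral as the difference of two series of residues, when the factor besides the
two cosecants and their cancelling zeros is a quotient of entire functions of `q ^ s`. -/
theorem integral_regIntegrand_div (hq0 : 0 < q) (hq1 : q < 1) {d : ℂ} (hd : ∀ n : ℤ, d ≠ n)
    {γ : ℝ → ℂ} (hγ : IsVerticalContour γ) {N G : ℂ → ℂ} (hN : Differentiable ℂ N)
    (hG : Differentiable ℂ G) (hG0 : G 0 ≠ 0)
    (hleft : ∀ p, G ((q : ℂ) ^ p) = 0 → LiesLeftOf γ p)
    (hright : ∀ p ∈ increasingPoles d, LiesRightOf γ p) :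
    Integrable (fun t => regIntegrand q d (fun x => N x / G x) (γ t) * deriv γ t) ∧
    1 / (2 * (Real.pi : ℂ) * I) * ∫ t, regIntegrand q d (fun x => N x / G x) (γ t) * deriv γ t =
      -(1 / sin ((Real.pi : ℂ) * d)) *
        jacksonDiff q ((q : ℂ) ^ (1 - d)) (residueWeight q d fun x => N x / G x) := by
  obtain ⟨z₀, hz₀⟩ := exists_comp_cpow_ne_zero hq0 hq1 hG hG0
  have hGq := differentiable_comp_cpow hq0 hG
  have hlog := Real.log_neg hq0 hq1
  refine integral_regIntegrand (D := {s | G ((q : ℂ) ^ s) = 0}) hq0 hq1 hd hγ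
    (div_pos_of_neg_of_neg (neg_lt_zero.2 Real.two_pi_pos) hlog) (fun p hp k => ?_)
    (finite_zeros_inter_closedBall hGq hz₀) (fun s hs => (hN _).div (hG _) hs) (fun s => ?_)
    (fun σ hσ => ?_) hleft hright
  · rw [mem_ofPred_eq, cpow_add_period hq0 hq1]
    exact hp
  · exact ((differentiable_comp_cpow hq0 hN).analyticAt s).meromorphicAt.div
      (hGq.analyticAt s).meromorphicAt
  · refine hN.continuous.continuousOn.div hG.continuous.continuousOn fun x hx h0 => ?_
    have hx0 : x ≠ 0 := fun h => hG0 (h ▸ h0)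
    obtain ⟨s, rfl⟩ := cpow_surjective hq0 hq1 hx0
    rw [mem_closedBall_zero_iff, norm_cpow hq0, Real.rpow_le_rpow_left_iff_of_base_lt_one hq0 hq1]
      at hx
    exact (hσ s h0).not_ge hx

lemma differentiable_poleProduct {q : ℂ} (hq : ‖q‖ < 1) (A B C F : ℂ) :
    Differentiable ℂ (poleProduct q A B C F) := by
  have h : ∀ X : ℂ, Differentiable ℂ fun x => qPochInf (X * x) q := fun X =>
    (differentiable_qPochInf hq).comp (differentiable_id.const_mul X)
  exact (((h A).mul (h B)).mul (h C)).mul (h F)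

lemma poleProduct_zero (q A B C F : ℂ) : poleProduct q A B C F 0 = 1 := by simp [poleProduct]

lemma qPochInf_cpow_eq_zero_iff (hq0 : 0 < q) (hq1 : q < 1) (x s : ℂ) :
    qPochInf ((q : ℂ) ^ x * (q : ℂ) ^ s) q = 0 ↔ ∃ n : ℕ, (q : ℂ) ^ (x + s + n) = 1 := by
  have hq := norm_ofReal_lt_one hq0 hq1
  have e : ∀ n : ℕ, (q : ℂ) ^ (x + s + n) = (q : ℂ) ^ x * (q : ℂ) ^ s * (q : ℂ) ^ n := fun n => by
    rw [cpow_add _ _ (ofReal_ne_zero_of_pos hq0), cpow_add _ _ (ofReal_ne_zero_of_pos hq0),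
      cpow_natCast]
  simp only [e]
  constructor
  · intro h
    by_contra! hne
    exact qPochInf_ne_zero hq hne h
  · rintro ⟨n, hn⟩
    exact qPochInf_eq_zero hq hn

lemma poleProduct_eq_zero_iff (hq0 : 0 < q) (hq1 : q < 1) (a b c f s : ℂ) :
    poleProduct q ((q : ℂ) ^ a) ((q : ℂ) ^ b) ((q : ℂ) ^ c) ((q : ℂ) ^ f) ((q : ℂ) ^ s) = 0 ↔
      s ∈ decreasingPoles q a b c f := by
  simp only [poleProduct, mul_eq_zero, qPochInf_cpow_eq_zero_iff hq0 hq1, decreasingPoles,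
    mem_ofPred_eq, List.mem_cons, List.not_mem_nil, or_false, exists_eq_or_imp, exists_eq_left,
    or_assoc]

/-- A contour separating the two kinds of poles exists only if they do not meet. -/
lemma SeparatesPoles.notMem {γ : ℝ → ℂ} {a b c d f p : ℂ} (h : SeparatesPoles γ q a b c d f)
    (hp : p ∈ increasingPoles d) : p ∉ decreasingPoles q a b c f := fun hp' => by
  have := tendsto_nhds_unique (h.1 p hp').2 (h.2 p hp).2
  norm_num at this

lemma SeparatesPoles.noPole {γ : ℝ → ℂ} {a b c d f : ℂ} (hq0 : 0 < q)
    (h : SeparatesPoles γ q a b c d f) {x : ℂ} (hx : x ∈ [a, b, c, f]) :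
    NoPole q ((q : ℂ) ^ (1 - d)) ((q : ℂ) ^ x) := by
  have hqne := ofReal_ne_zero_of_pos hq0
  refine fun n => ⟨fun h1 => h.notMem ⟨0, .inl rfl⟩ ⟨x, hx, n, ?_⟩,
    fun h1 => h.notMem ⟨0, .inr rfl⟩ ⟨x, hx, n, ?_⟩⟩
  · rw [← cpow_natCast, ← cpow_add _ _ hqne] at h1
    simpa using h1
  · rw [← cpow_natCast, ← cpow_add _ _ hqne, ← cpow_add _ _ hqne] at h1
    convert h1 using 2
    push_cast
    ring

/-- Off countably many points the integrand agrees with its regularised form. -/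
lemma exists_countable_integrand_eq (hq0 : 0 < q) (hq1 : q < 1) (a b c : ℂ) {d : ℂ}
    (hd : ∀ n : ℤ, d ≠ n) (e f : ℂ) :
    ∃ S : Set ℂ, S.Countable ∧ ∀ s ∉ S, integrand q a b c d e f s =
      regIntegrand q d (fun x =>
        extSeries q ((q : ℂ) ^ a) ((q : ℂ) ^ b) ((q : ℂ) ^ e) ((q : ℂ) ^ (1 + a + b + c - d))
          ((q : ℂ) ^ (e + f)) ((q : ℂ) ^ (1 + c + f - d)) x /
        poleProduct q ((q : ℂ) ^ a) ((q : ℂ) ^ b) ((q : ℂ) ^ c) ((q : ℂ) ^ f) x) s := by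
  have hq := norm_ofReal_lt_one hq0 hq1
  have hqne := ofReal_ne_zero_of_pos hq0
  have hz : ∀ X : ℂ, {s : ℂ | qPochInf (X * (q : ℂ) ^ s) q = 0}.Countable := fun X => by
    have hG : Differentiable ℂ fun x : ℂ => qPochInf (X * x) q :=
      (differentiable_qPochInf hq).comp (differentiable_id.const_mul X)
    obtain ⟨z₀, hz₀⟩ := exists_comp_cpow_ne_zero hq0 hq1 hG (by simp)
    exact countable_zeros (differentiable_comp_cpow hq0 hG) hz₀
  have h1 := countable_zeros differentiable_sin_pi_mul (z₀ := d) (sin_pi_mul_ne_zero_of_ne_int hd)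
  have h2 := countable_zeros (N := fun s : ℂ => sin ((Real.pi : ℂ) * (d + s))) (z₀ := 0)
    (differentiable_sin_pi_mul.comp (by fun_prop : Differentiable ℂ fun s : ℂ => d + s))
    (by simpa using sin_pi_mul_ne_zero_of_ne_int hd)
  refine ⟨_, (h1.union h2).union ((hz ((q : ℂ) ^ (1 + a + b + c - d))).union
    (hz ((q : ℂ) ^ (e + f)))), fun s hs => ?_⟩
  simp only [mem_union, mem_ofPred_eq, not_or] at hs
  obtain ⟨⟨hs1, hs2⟩, hs3, hs4⟩ := hs
  have hadd : ∀ x : ℂ, (q : ℂ) ^ (x + s) = (q : ℂ) ^ x * (q : ℂ) ^ s := fun x => cpow_add _ _ hqne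
  rw [regIntegrand_of_ne hq0 _ hs1 hs2, residueWeight,
    ← mul_basicHypergeometric hq _ _ _ _ _ (mul_pow_ne_one_of_qPochInf_ne_zero hq hs3)
      (mul_pow_ne_one_of_qPochInf_ne_zero hq hs4), integrand, poleProduct]
  rw [show 1 + a + b + c + s - d = 1 + a + b + c - d + s by ring]
  simp only [hadd, cpow_one, qPochInfs, List.map_cons, List.map_nil, List.prod_cons, List.prod_nil,
    div_eq_mul_inv, mul_inv]
  ring

/-- A path passes through the points of a countable set with zero velocity, at almost all times, so
these points do not contribute to a contour integral. -/
lemma mul_deriv_ae_eq_of_countable {γ : ℝ → ℂ} {S : Set ℂ} (hS : S.Countable) {g h : ℂ → ℂ}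
    (heq : ∀ s ∉ S, g s = h s) :
    (fun t => h (γ t) * deriv γ t) =ᵐ[volume] fun t => g (γ t) * deriv γ t := by
  filter_upwards [ae_deriv_eq_zero_of_mem_countable hS] with t ht
  by_cases hm : γ t ∈ S
  · rw [ht hm, mul_zero, mul_zero]
  · rw [heq _ hm]

end Assembly

end QBarnes

theorem mainTheorem12 (q : ℝ) (hq0 : 0 < q) (hq1 : q < 1) (a b c d e f : ℂ)
    (hf : ‖(q : ℂ) ^ f‖ < 1) (hfd : ‖(q : ℂ) ^ (1 + f - d)‖ < 1)
    (hcfd : ‖(q : ℂ) ^ (1 + c + f - d)‖ < 1)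
    (hd : ∀ n : ℤ, d ≠ n)
    (hef : ∀ n : ℕ, (q : ℂ) ^ (e + f) * (q : ℂ) ^ n ≠ 1)
    (habd : ∀ n : ℕ, (q : ℂ) ^ (1 + a + b - d) * (q : ℂ) ^ n ≠ 1)
    (γ : ℝ → ℂ) (hγ : QBarnes.IsVerticalContour γ)
    (hsep : QBarnes.SeparatesPoles γ q a b c d f) :
    MeasureTheory.Integrable (fun t : ℝ => QBarnes.integrand q a b c d e f (γ t) * deriv γ t) ∧
    1 / (2 * (Real.pi : ℂ) * Complex.I) *
        ∫ t : ℝ, QBarnes.integrand q a b c d e f (γ t) * deriv γ t =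
      -(1 / Complex.sin ((Real.pi : ℂ) * d)) *
        (QBarnes.qPochInfs [(q : ℂ), (q : ℂ) ^ d, (q : ℂ) ^ (1 - d), (q : ℂ) ^ (1 + b + c - d),
            (q : ℂ) ^ (1 + a + c - d), (q : ℂ) ^ (1 + a + b - d), (q : ℂ) ^ (e + f)] q /
          QBarnes.qPochInfs [(q : ℂ) ^ a, (q : ℂ) ^ b, (q : ℂ) ^ c, (q : ℂ) ^ f,
            (q : ℂ) ^ (1 + a - d), (q : ℂ) ^ (1 + b - d), (q : ℂ) ^ (1 + c - d)] q) *
        QBarnes.basicHypergeometric [(q : ℂ) ^ a, (q : ℂ) ^ b, (q : ℂ) ^ e]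
          [(q : ℂ) ^ (e + f), (q : ℂ) ^ (1 + a + b - d)] q ((q : ℂ) ^ (1 + f - d)) := by
  have hq := QBarnes.norm_ofReal_lt_one hq0 hq1
  have hqne := QBarnes.ofReal_ne_zero_of_pos hq0
  have hadd : ∀ x y : ℂ, (q : ℂ) ^ (x + y) = (q : ℂ) ^ x * (q : ℂ) ^ y := fun x y =>
    Complex.cpow_add _ _ hqne
  have hne : ∀ x : ℂ, (q : ℂ) ^ x ≠ 0 := fun x => by simp [Complex.cpow_eq_zero_iff, hqne]
  have h1 : ∀ x : ℂ, (q : ℂ) ^ (1 + x - d) = (q : ℂ) ^ (1 - d) * (q : ℂ) ^ x := fun x => by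
    rw [← hadd]; ring_nf
  have h2 : (q : ℂ) ^ (1 + c + f - d) = (q : ℂ) ^ (1 - d) * (q : ℂ) ^ c * (q : ℂ) ^ f := by
    rw [← hadd, ← hadd]; ring_nf
  have h3 : (q : ℂ) ^ (1 + a + b - d) = (q : ℂ) ^ (1 - d) * (q : ℂ) ^ a * (q : ℂ) ^ b := by
    rw [← hadd, ← hadd]; ring_nf
  have h4 : (q : ℂ) ^ (1 + a + c - d) = (q : ℂ) ^ (1 - d) * (q : ℂ) ^ a * (q : ℂ) ^ c := by
    rw [← hadd, ← hadd]; ring_nf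
  have h5 : (q : ℂ) ^ (1 + b + c - d) = (q : ℂ) ^ (1 - d) * (q : ℂ) ^ b * (q : ℂ) ^ c := by
    rw [← hadd, ← hadd]; ring_nf
  have h6 : (q : ℂ) ^ (1 + a + b + c - d) =
      (q : ℂ) ^ (1 - d) * (q : ℂ) ^ a * (q : ℂ) ^ b * (q : ℂ) ^ c := by
    rw [← hadd, ← hadd, ← hadd]; ring_nf
  have h7 : (q : ℂ) ^ d = q / (q : ℂ) ^ (1 - d) := by
    rw [eq_div_iff (hne _), ← hadd, add_sub_cancel, Complex.cpow_one]
  obtain ⟨S, hS, hSeq⟩ := QBarnes.exists_countable_integrand_eq hq0 hq1 a b c hd e f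
  obtain ⟨hint, hval⟩ := QBarnes.integral_regIntegrand_div hq0 hq1 hd hγ
    (QBarnes.differentiable_extSeries hq ((q : ℂ) ^ a) ((q : ℂ) ^ b) ((q : ℂ) ^ e)
      ((q : ℂ) ^ (1 + a + b + c - d)) ((q : ℂ) ^ (e + f)) hcfd)
    (QBarnes.differentiable_poleProduct hq ((q : ℂ) ^ a) ((q : ℂ) ^ b) ((q : ℂ) ^ c) ((q : ℂ) ^ f))
    (by simp [QBarnes.poleProduct_zero])
    (fun p hp => hsep.1 p ((QBarnes.poleProduct_eq_zero_iff hq0 hq1 a b c f p).1 hp)) hsep.2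
  have hae := QBarnes.mul_deriv_ae_eq_of_countable (γ := γ) hS hSeq
  refine ⟨hint.congr hae, ?_⟩
  rw [← MeasureTheory.integral_congr_ae hae, hval]
  have key := QBarnes.jacksonDiff_extKernel (q := q) (p := (q : ℂ) ^ (1 - d)) (A := (q : ℂ) ^ a)
    (B := (q : ℂ) ^ b) (C := (q : ℂ) ^ c) (E := (q : ℂ) ^ e) (F := (q : ℂ) ^ f) hq hqne (hne _)
    (hne _) (hsep.noPole hq0 (by simp)) (hsep.noPole hq0 (by simp)) (hsep.noPole hq0 (by simp)) hf
    (by rwa [← h1]) (by rwa [← h2]) (by simpa only [hadd] using hef) (by simpa only [h3] using habd)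
  rw [← h7, ← h6, ← h2, ← h3, ← h4, ← h5, ← h1, ← h1, ← h1, ← h1, ← hadd] at key
  rw [mul_assoc, ← key]
  unfold QBarnes.residueWeight QBarnes.extKernel
  rw [hadd e f]
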